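/- Let $d\ge 2$, $n\ge 1$, $c>0$ and $t>0$. A particle starts at the origin of $\mathbb R^d$, moves with constant speed $c$, and changes direction at random instants $0=t_0<t_1<t_2<\cdots$. Put $\tau_k=t_k-t_{k-1}$ and $\mathcal N(t)=\sup\{k\ge 1: t_k\le t\}$ (with $\sup\emptyset=0$). The successive directions $V_1,V_2,\dots$ are independent, uniformly distributed on the unit sphere of $\mathbb R^d$, and (as a family) independent of the instants. On the event $\{\mathcal N(t)=n\}$ the position at time $t$ is $$X_d(t)=c\sum_{k=1}^{n+1}\tau_kV_k,\qquad \text{where } \tau_{n+1}:=t-\sum_{j=1}^n\tau_j .$$ Let $$S_n=\Big\{(\tau_1,\dots,\tau_n)\in\mathbb R^n:\ 0<\tau_k<t-\sum_{j=1}^{k-1}\tau_j,\ k=1,\dots,n\Big\},$$ and let $a_1,\dots,a_n,b_1,\dots,b_n>0$. Assume that $P(\mathcal N(t)=n)>0$ and that, given $\mathcal N(t)=n$, the vector $(\tau_1,\dots,\tau_n)$ has the rescaled generalized Dirichlet law, i.e. the probability density $$f(\tau_1,\dots,\tau_n)=\frac{1}{t^{\sum_{k=1}^n(a_k+b_k-1)}}\prod_{k=1}^n\frac{\Gamma\big(1+\sum_{j=k}^n(a_j+b_j-1)\big)}{\Gamma(a_k)\,\Gamma\big(b_k+\sum_{j=k+1}^n(a_j+b_j-1)\big)}\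 \prod_{k=1}^n\tau_k^{a_k-1}\Big(t-\sum_{j=1}^k\tau_j\Big)^{b_k-1}$$ on $S_n$. (So the parameters are such that this is a probability density, which amounts to $b_k+\sum_{j=k+1}^n(a_j+b_j-1)>0$ for all $k$.) Then, given $\mathcal N(t)=n$, the law of $X_d(t)$ is absolutely continuous with respect to Lebesgue measure on $\mathbb R^d$ and is carried by the ball $\{x:\|x\|<ct\}$, on which it has the density $$p_n(x,t)=\frac{\{2^{\frac d2-1}\Gamma(\frac d2)\}^{n+1}}{(2\pi)^{\frac d2}\|x\|^{\frac d2-1}}\int_0^\infty\rho^{\frac d2}J_{\frac d2-1}(\rho\|x\|)\left(\int_{S_n}f(\tau_1,\dots,\tau_n)\prod_{k=1}^{n+1}\frac{J_{\frac d2-1}(c\tau_k\rho)}{(c\tau_k\rho)^{\frac d2-1}}\,d\tau_1\cdots d\tau_n\right)d\rho ,$$ where $J_\nu(x)=\sum_{k=0}^\infty(-1)^k\left(\frac x2\right)^{2k+\nu}\frac1{k!\,\Gamma(k+\nu+1)}$ is the Bessel function of the first kind. Here the integral over $S_n$ converges absolutely for every $\rho>0$, and for every $x$ with $0<\|x\|<ct$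 the integral over $\rho$ converges as an improper integral $\lim_{R\to\infty}\int_0^R$ and $p_n(x,t)\ge 0$. -/

import Mathlib

open MeasureTheory ProbabilityTheory Filter Topology

noncomputable section

namespace RandomFlight

/-- The Euclidean space `ℝ^d`. -/
abbrev Space (d : ℕ) : Type := EuclideanSpace ℝ (Fin d)

/-- The unit sphere of `ℝ^d`: the set of directions. -/
abbrev Direction (d : ℕ) : Type := Metric.sphere (0 : Space d) 1

/-- The Bessel function of the first kind, through its power series. -/
def besselJ (ν x : ℝ) : ℝ :=
  ∑' k : ℕ, (-1 : ℝ) ^ k * (x / 2) ^ (2 * (k : ℝ) + ν) *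
    (1 / ((k.factorial : ℝ) * Real.Gamma ((k : ℝ) + ν + 1)))

/-- The uniform distribution on the unit sphere: normalised surface measure. -/
def uniformDirection (d : ℕ) : Measure (Direction d) :=
  ((volume : Measure (Space d)).toSphere Set.univ)⁻¹ • (volume : Measure (Space d)).toSphere

/-- The open simplex of vectors `τ` with `0 < τ_k < t - ∑_{j<k} τ_j` for all `k`. -/
def simplex (n : ℕ) (t : ℝ) : Set (Fin n → ℝ) :=
  {τ | ∀ k, 0 < τ k ∧ τ k < t - ∑ j ∈ Finset.Iio k, τ j}

/-- The normalising constant of the rescaled generalized Dirichlet density. -/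
def gdConst {n : ℕ} (a b : Fin n → ℝ) (t : ℝ) : ℝ :=
  1 / t ^ (∑ k, (a k + b k - 1)) *
    ∏ k, Real.Gamma (1 + ∑ j ∈ Finset.Ici k, (a j + b j - 1)) /
      (Real.Gamma (a k) * Real.Gamma (b k + ∑ j ∈ Finset.Ioi k, (a j + b j - 1)))

/-- The rescaled generalized Dirichlet density, given by its formula on the simplex. -/
def gdDensity {n : ℕ} (a b : Fin n → ℝ) (t : ℝ) (τ : Fin n → ℝ) : ℝ :=
  gdConst a b t * ∏ k, (τ k ^ (a k - 1) * (t - ∑ j ∈ Finset.Iic k, τ j) ^ (b k - 1))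

/-- The generalized Dirichlet law: density `gdDensity` on the simplex with respect to
Lebesgue measure, and no mass outside the simplex. -/
def gdLaw {n : ℕ} (a b : Fin n → ℝ) (t : ℝ) : Measure (Fin n → ℝ) :=
  (volume.restrict (simplex n t)).withDensity fun τ => ENNReal.ofReal (gdDensity a b t τ)

/-- The `n + 1` durations `τ_1, …, τ_n, τ_{n+1} = t - ∑ τ_j`. -/
def durations {n : ℕ} (t : ℝ) (τ : Fin n → ℝ) : Fin (n + 1) → ℝ :=
  Fin.snoc (α := fun _ => ℝ) τ (t - ∑ j, τ j)

section Walk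

variable {Ω : Type*} {d : ℕ}

/-- `IsFlight P T V`: the walker changes direction at the random instants
`0 = T 0 < T 1 < T 2 < ⋯`, and moves in the direction `V k` between `T k` and `T (k + 1)`. The
directions are independent, uniform on the sphere, and independent of the instants. -/
structure IsFlight [MeasurableSpace Ω] (P : Measure Ω)
    (T : ℕ → Ω → ℝ) (V : ℕ → Ω → Direction d) : Prop where
  measurable_time : ∀ k, Measurable (T k)
  measurable_dir : ∀ k, Measurable (V k)
  time_zero : ∀ᵐ ω ∂P, T 0 ω = 0
  time_strictMono : ∀ᵐ ω ∂P, StrictMono fun k => T k ω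
  dir_uniform : ∀ k, P.map (V k) = uniformDirection d
  dir_indep : iIndepFun V P
  dir_indep_time : IndepFun (fun ω k => V k ω) (fun ω k => T k ω) P

/-- The number of changes of direction up to time `t`: `N(t) = sup {k ≥ 1 | T k ≤ t}`. -/
def changes (T : ℕ → Ω → ℝ) (t : ℝ) (ω : Ω) : ℕ∞ :=
  sSup ((fun k : ℕ => (k : ℕ∞)) '' {k | 1 ≤ k ∧ T k ω ≤ t})

/-- The durations `τ_k = T k - T (k - 1)`, `k = 1, …, n`, of the first `n` steps. -/
def steps (T : ℕ → Ω → ℝ) (n : ℕ) (ω : Ω) : Fin n → ℝ :=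
  fun k => T ((k : ℕ) + 1) ω - T (k : ℕ) ω

/-- The position at time `t` after the complete steps up to `N(t)` and the current step, at
speed `c`. (The value where `N(t) = ∞` is irrelevant.) -/
def position (c : ℝ) (T : ℕ → Ω → ℝ) (V : ℕ → Ω → Direction d) (t : ℝ) (ω : Ω) : Space d :=
  let N := (changes T t ω).toNat
  c • (∑ k ∈ Finset.range N, (T (k + 1) ω - T k ω) • (V k ω : Space d)
    + (t - T N ω) • (V N ω : Space d))

end Walk

/-- The integrand over the simplex: the generalized Dirichlet density against the product of the
normalised Bessel functions of the `n + 1` steps. -/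
def simplexIntegrand (d : ℕ) (c t : ℝ) {n : ℕ} (a b : Fin n → ℝ) (ρ : ℝ) (τ : Fin n → ℝ) : ℝ :=
  gdDensity a b t τ *
    ∏ k, (besselJ ((d : ℝ) / 2 - 1) (c * durations t τ k * ρ) /
      (c * durations t τ k * ρ) ^ ((d : ℝ) / 2 - 1))

/-- The integrand of the outer integral over `ρ`, at distance `r` from the origin. -/
def hankelIntegrand (d : ℕ) (c t : ℝ) {n : ℕ} (a b : Fin n → ℝ) (r ρ : ℝ) : ℝ :=
  ρ ^ ((d : ℝ) / 2) * besselJ ((d : ℝ) / 2 - 1) (ρ * r) *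
    ∫ τ in simplex n t, simplexIntegrand d c t a b ρ τ

/-- `∫_0^∞ f = L` as a convergent improper integral. -/
def HasImproperIntegral (f : ℝ → ℝ) (L : ℝ) : Prop :=
  (∀ R : ℝ, 0 < R → IntervalIntegrable f volume 0 R) ∧
    Tendsto (fun R : ℝ => ∫ ρ in (0 : ℝ)..R, f ρ) atTop (𝓝 L)

/-- The improper integral `∫_0^∞ f = lim_{R → ∞} ∫_0^R f` (meaningful where it converges). -/
def improperIntegral (f : ℝ → ℝ) : ℝ :=
  limUnder atTop fun R : ℝ => ∫ ρ in (0 : ℝ)..R, f ρ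

/-- The conditional density of the position, in integral form. -/
def flightDensity (d : ℕ) (c t : ℝ) {n : ℕ} (a b : Fin n → ℝ) (x : Space d) : ℝ :=
  ((2 : ℝ) ^ ((d : ℝ) / 2 - 1) * Real.Gamma ((d : ℝ) / 2)) ^ (n + 1) /
      ((2 * Real.pi) ^ ((d : ℝ) / 2) * ‖x‖ ^ ((d : ℝ) / 2 - 1)) *
    improperIntegral (hankelIntegrand d c t a b ‖x‖)

end RandomFlight

end

open MeasureTheory ProbabilityTheory Filter Topology

noncomputable section

namespace RandomFlight

/-! Given the durations, the characteristic function of the end point at ξ is the product of the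
factors κ(c τ_k |ξ|), where κ = `coordChar d` is the characteristic function of one coordinate of a
uniform direction, that is, a normalised Bessel function. Averaging over the durations gives a
radial function F(|ξ|), and the asserted formula is Fourier inversion for F in polar coordinates.
The difficulty is convergence: κ is O(ρ^(-(d-1)/2)), and since there are at least two factors,
ρ^((d-1)/2) F(ρ) tends to 0, but this is too weak for the inversion integral to converge absolutely.
It must be shown to converge conditionally, uniformly for r = |x| in compact subsets of (0, ct).

For this, F is written as the Fourier transform of a law on [-ct, ct] that is smooth inside the
interval. Smoothness is encoded by repeated integration by parts along (1 - y²) d/dy, with bounded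
weights (`IsConormal`). One coordinate of a uniform direction has this property, and by
`IsConormal.mix` it passes from z₁, z₂ to β z₁ + (1 - β) z₂ with an independent beta variable β.
Stick breaking (`gdWeight_succ`) exhibits the generalized Dirichlet flight as an iterated mixture of
this kind.

A cutoff then splits the law. The part away from the end points has a rapidly decreasing transform,
and its inversion integral converges absolutely. The part near the end points, multiplied by ρ^(d-1)
κ(ρ r) with r < ct, has only frequencies bounded away from 0. Convolution with a Schwartz kernel of
integral one and low frequencies therefore annihilates it; as it also tends to 0, its primitive
converges at infinity (`norm_integral_sub_le_of_conv_eq_zero`).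

Finally, the truncated inversion integrals converge to the law when tested against Schwartz
functions. Together with locally uniform convergence this identifies the density on the open
punctured ball (`eq_withDensity_invLim`) and shows that it is nonnegative. No mass escapes this set:
almost surely the directions are not all equal and do not cancel, so 0 < |X| < ct. -/

/-! ### Polar coordinates and integration by parts on the sphere. -/

theorem integral_polar {d : ℕ} (hd : 1 ≤ d) {G : Space d → ℂ} (hG : Integrable G) :
    ∫ x, G x = ∫ r in Set.Ioi (0 : ℝ), (r ^ (d - 1) : ℝ) •
      ∫ v : Direction d, G (r • (v : Space d)) ∂(volume : Measure (Space d)).toSphere := by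
  have : Nontrivial (Space d) := by
    have : Nonempty (Fin d) := ⟨⟨0, hd⟩⟩
    infer_instance
  have mp := (volume : Measure (Space d)).measurePreserving_homeomorphUnitSphereProd
  have hemb : MeasurableEmbedding (homeomorphUnitSphereProd (Space d)) :=
    Homeomorph.measurableEmbedding _
  have hrank : Module.finrank ℝ (Space d) = d := by simp
  rw [hrank] at mp
  have hcompl : MeasurableSet ({0}ᶜ : Set (Space d)) := (measurableSet_singleton _).compl
  set H : Direction d × Set.Ioi (0 : ℝ) → ℂ := fun p => G (p.2.1 • (p.1 : Space d)) with hH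
  have key : ∀ x : ({0}ᶜ : Set (Space d)), H (homeomorphUnitSphereProd (Space d) x) = G x := by
    intro x
    have h0 : ‖(x : Space d)‖ ≠ 0 := norm_ne_zero_iff.2 x.2
    simp [hH, smul_smul, mul_inv_cancel₀ h0]
  have hint : Integrable H ((volume : Measure (Space d)).toSphere.prod
      (Measure.volumeIoiPow (d - 1))) := by
    rw [← mp.integrable_comp_emb hemb]
    have : (H ∘ homeomorphUnitSphereProd (Space d)) = G ∘ (Subtype.val) := funext key
    rw [this, ← integrableOn_iff_comap_subtypeVal hcompl]
    exact hG.integrableOn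
  have h1 : ∫ x, G x = ∫ p, H p ∂((volume : Measure (Space d)).toSphere.prod
      (Measure.volumeIoiPow (d - 1))) := by
    have h2 := integral_subtype_comap (μ := volume) hcompl G
    rw [restrict_compl_singleton] at h2
    rw [← mp.integral_comp hemb, ← h2]
    exact integral_congr_ae (Eventually.of_forall fun x => (key x).symm)
  rw [h1, integral_prod_symm _ hint, Measure.volumeIoiPow,
    integral_withDensity_eq_integral_toReal_smul (by fun_prop) (by simp),
    integral_subtype_comap measurableSet_Ioi
      (fun r : ℝ => (ENNReal.ofReal (r ^ (d - 1))).toReal •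
        ∫ v : Direction d, G (r • (v : Space d)) ∂(volume : Measure (Space d)).toSphere)]
  refine setIntegral_congr_fun measurableSet_Ioi fun r hr => ?_
  simp only [ENNReal.toReal_ofReal (pow_nonneg (le_of_lt hr) _)]

/-- The function `|x|² g(⟨x, e⟩ / |x|) exp (-|x|² / 2)`. -/
def sphereTest {d : ℕ} (e : Space d) (g : ℝ → ℂ) (x : Space d) : ℂ :=
  ((‖x‖ ^ 2 * Real.exp (-‖x‖ ^ 2 / 2) : ℝ) : ℂ) * g (inner ℝ x e / ‖x‖)

/-- The derivative of `sphereTest e g` in the direction `e`. -/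
def sphereTestDeriv {d : ℕ} (e : Space d) (g g' : ℝ → ℂ) (x : Space d) : ℂ :=
  (((2 * ‖x‖ - ‖x‖ ^ 3) * Real.exp (-‖x‖ ^ 2 / 2) : ℝ) : ℂ) *
      (((inner ℝ x e / ‖x‖ : ℝ) : ℂ) * g (inner ℝ x e / ‖x‖)) +
    ((‖x‖ * Real.exp (-‖x‖ ^ 2 / 2) : ℝ) : ℂ) *
      (((1 - (inner ℝ x e / ‖x‖) ^ 2 : ℝ) : ℂ) * g' (inner ℝ x e / ‖x‖))

/-- Away from the origin this is the chain rule for |x + s e|² = |x|² + 2 s ⟨x, e⟩ + s². At the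
origin, where the angular part is discontinuous, the factor |x|² makes the function quadratically
small along the line. -/
theorem hasLineDerivAt_sphereTest {d : ℕ} {e : Space d} (he : ‖e‖ = 1) {g g' : ℝ → ℂ}
    (hg : ∀ u, HasDerivAt g (g' u) u) (x : Space d) :
    HasLineDerivAt ℝ (sphereTest e g) (sphereTestDeriv e g g' x) x e := by
  unfold HasLineDerivAt
  by_cases hx : x = 0
  · subst hx
    have h0 : sphereTestDeriv e g g' 0 = 0 := by simp [sphereTestDeriv]
    rw [h0]
    -- On the line through the origin the argument of g is only ever 1 or -1, or 0 at s = 0, where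
    -- the quotient 0 / 0 is 0; three values of g bound everything.
    have hb : ∀ s : ℝ, ‖sphereTest e g (0 + s • e)‖ ≤ (‖g 1‖ + ‖g (-1)‖ + ‖g 0‖) * s ^ 2 := by
      intro s
      have hle : Real.exp (-|s| ^ 2 / 2) ≤ 1 := by
        apply Real.exp_le_one_iff.2; nlinarith [sq_nonneg |s|]
      have hgs : ‖g (inner ℝ (s • e) e / ‖s • e‖)‖ ≤ ‖g 1‖ + ‖g (-1)‖ + ‖g 0‖ := by
        rw [real_inner_smul_left, real_inner_self_eq_norm_sq, norm_smul, he]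
        rcases lt_trichotomy s 0 with h | h | h
        · have : s * 1 ^ 2 / (‖s‖ * 1) = -1 := by
            rw [Real.norm_eq_abs, abs_of_neg h]; have := h.ne; field_simp
          rw [this]; linarith [norm_nonneg (g 1), norm_nonneg (g 0)]
        · subst h; simp; positivity
        · have : s * 1 ^ 2 / (‖s‖ * 1) = 1 := by
            rw [Real.norm_eq_abs, abs_of_pos h]; field_simp
          rw [this]; linarith [norm_nonneg (g (-1)), norm_nonneg (g 0)]
      rw [zero_add, sphereTest, norm_mul, mul_comm]
      have h2 : ‖((‖s • e‖ ^ 2 * Real.exp (-‖s • e‖ ^ 2 / 2) : ℝ) : ℂ)‖ ≤ s ^ 2 := by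
        rw [Complex.norm_real, Real.norm_eq_abs, abs_of_nonneg (by positivity), norm_smul, he,
          mul_one, Real.norm_eq_abs, sq_abs]
        rw [sq_abs] at hle
        nlinarith [sq_nonneg s]
      gcongr
    have hbig : (fun s : ℝ => sphereTest e g (0 + s • e)) =O[𝓝 0] fun s : ℝ => s ^ 2 :=
      Asymptotics.IsBigO.of_bound _ (Eventually.of_forall fun s => by
        rw [norm_pow, Real.norm_eq_abs, sq_abs]; exact hb s)
    rw [hasDerivAt_iff_isLittleO]
    have hz : sphereTest e g 0 = 0 := by simp [sphereTest]
    have : (fun s : ℝ => s ^ 2) =o[𝓝 0] fun s : ℝ => s := by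
      simpa using Asymptotics.isLittleO_pow_pow (𝕜 := ℝ) (m := 1) (n := 2) (by norm_num)
    simpa [hz] using hbig.trans_isLittleO this
  · have hx0 : 0 < ‖x‖ := norm_pos_iff.2 hx
    set q : ℝ → ℝ := fun s => ‖x‖ ^ 2 + 2 * s * inner ℝ x e + s ^ 2 with hq
    have hqn : ∀ s, ‖x + s • e‖ ^ 2 = q s := by
      intro s
      rw [norm_add_sq_real, real_inner_smul_right, norm_smul, he, mul_one, Real.norm_eq_abs,
        sq_abs]
      simp only [hq]; ring
    have hqs : ∀ s, ‖x + s • e‖ = √(q s) := fun s => by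
      rw [← hqn, Real.sqrt_sq (norm_nonneg _)]
    have hq0 : q 0 = ‖x‖ ^ 2 := by simp [hq]
    have hs0 : √(q 0) = ‖x‖ := by rw [hq0, Real.sqrt_sq (norm_nonneg _)]
    have hqd : HasDerivAt q (2 * inner ℝ x e) 0 := by
      have h1 := ((hasDerivAt_id (0 : ℝ)).const_mul 2).mul_const (inner ℝ x e)
      have h2 := (hasDerivAt_id (0 : ℝ)).pow 2
      have := (h1.const_add (‖x‖ ^ 2)).add h2
      refine this.congr_deriv ?_
      simp
    have hsd : HasDerivAt (fun s => √(q s)) (inner ℝ x e / ‖x‖) 0 := by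
      have := hqd.sqrt (by rw [hq0]; positivity)
      refine this.congr_deriv ?_
      rw [hs0]; field_simp
    have hU : HasDerivAt (fun s => (inner ℝ x e + s) / √(q s))
        ((1 - (inner ℝ x e / ‖x‖) ^ 2) / ‖x‖) 0 := by
      have := ((hasDerivAt_id (0 : ℝ)).const_add (inner ℝ x e)).div hsd (by rw [hs0]; positivity)
      refine this.congr_deriv ?_
      rw [hs0]; simp; field_simp
    have hE : HasDerivAt (fun s => q s * Real.exp (-q s / 2))
        ((2 * ‖x‖ - ‖x‖ ^ 3) * Real.exp (-‖x‖ ^ 2 / 2) * (inner ℝ x e / ‖x‖)) 0 := by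
      have := hqd.mul ((hqd.neg.div_const 2).exp)
      refine this.congr_deriv ?_
      simp only [Pi.neg_apply]
      rw [hq0]; field_simp; ring
    have hfun : (fun s : ℝ => sphereTest e g (x + s • e)) = fun s =>
        ((q s * Real.exp (-q s / 2) : ℝ) : ℂ) * g ((inner ℝ x e + s) / √(q s)) := by
      funext s
      have : inner ℝ (x + s • e) e = inner ℝ x e + s := by
        rw [inner_add_left, real_inner_smul_left, real_inner_self_eq_norm_sq, he]; ring
      rw [sphereTest, hqn, hqs, this]
    rw [hfun]
    have hgc : HasDerivAt (fun s => g ((inner ℝ x e + s) / √(q s)))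
        (((1 - (inner ℝ x e / ‖x‖) ^ 2) / ‖x‖) • g' ((inner ℝ x e + 0) / √(q 0))) 0 :=
      (hg _).scomp (0 : ℝ) hU
    refine (hE.ofReal_comp.mul hgc).congr_deriv ?_
    rw [hs0, hq0, add_zero, sphereTestDeriv, Complex.real_smul]
    have hxc : (‖x‖ : ℂ) ≠ 0 := by exact_mod_cast hx0.ne'
    push_cast
    field_simp

theorem integrableOn_pow_mul_exp_neg_sq (m : ℕ) :
    IntegrableOn (fun r : ℝ => r ^ m * Real.exp (-r ^ 2 / 2)) (Set.Ioi 0) := by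
  have := integrableOn_rpow_mul_exp_neg_mul_sq (b := 1 / 2) (by norm_num) (s := m)
    (by have : (0 : ℝ) ≤ m := m.cast_nonneg
        linarith)
  refine this.congr_fun (fun r _ => ?_) measurableSet_Ioi
  simp only [Real.rpow_natCast]
  congr 2; ring

theorem integral_pow_mul_exp_neg_sq_pos (m : ℕ) :
    0 < ∫ r in Set.Ioi (0 : ℝ), r ^ m * Real.exp (-r ^ 2 / 2) := by
  rw [setIntegral_pos_iff_support_of_nonneg_ae]
  · have : Set.Ioi (0 : ℝ) ⊆ Function.support (fun r : ℝ => r ^ m * Real.exp (-r ^ 2 / 2)) :=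
      fun r hr => by
        rw [Function.mem_support]
        exact mul_ne_zero (pow_ne_zero _ (ne_of_gt hr)) (Real.exp_ne_zero _)
    rw [Set.inter_eq_self_of_subset_right this]
    simp
  · filter_upwards [ae_restrict_mem measurableSet_Ioi] with r hr
    exact mul_nonneg (pow_nonneg (le_of_lt hr) _) (Real.exp_pos _).le
  · exact integrableOn_pow_mul_exp_neg_sq m

/-- The moments are Gamma values, and Γ(x + 1) = x Γ(x). This recursion is the source of the factor
d - 1 in the integration by parts on the sphere. -/
theorem integral_pow_add_two_mul_exp_neg_sq (m : ℕ) :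
    ∫ r in Set.Ioi (0 : ℝ), r ^ (m + 2) * Real.exp (-r ^ 2 / 2) =
      (m + 1) * ∫ r in Set.Ioi (0 : ℝ), r ^ m * Real.exp (-r ^ 2 / 2) := by
  have h : ∀ j : ℕ, ∫ r in Set.Ioi (0 : ℝ), r ^ j * Real.exp (-r ^ 2 / 2) =
      (1 / 2) ^ (-((j : ℝ) + 1) / 2) * (1 / 2) * Real.Gamma (((j : ℝ) + 1) / 2) := by
    intro j
    rw [← integral_rpow_mul_exp_neg_mul_rpow (p := 2) (q := j) (b := 1 / 2) (by norm_num)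
      (by have : (0 : ℝ) ≤ j := j.cast_nonneg
          linarith) (by norm_num)]
    refine setIntegral_congr_fun measurableSet_Ioi fun r _ => ?_
    simp only [Real.rpow_natCast, Real.rpow_two]
    congr 2; ring
  rw [h, h]
  have h1 : ((m + 2 : ℕ) + 1 : ℝ) / 2 = ((m : ℝ) + 1) / 2 + 1 := by push_cast; ring
  have h2 : -((m + 2 : ℕ) + 1 : ℝ) / 2 = -((m : ℝ) + 1) / 2 - 1 := by push_cast; ring
  rw [h1, h2, Real.Gamma_add_one (by positivity), Real.rpow_sub_one (by norm_num)]
  ring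

theorem abs_inner_div_norm_le {d : ℕ} {e : Space d} (he : ‖e‖ = 1) (x : Space d) :
    |inner ℝ x e / ‖x‖| ≤ 1 := by
  rw [abs_div, abs_norm]
  refine div_le_one_of_le₀ ?_ (norm_nonneg _)
  simpa [he] using abs_real_inner_le_norm x e

theorem integrable_radial_mul {d : ℕ} (hd : 1 ≤ d) {e : Space d} (he : ‖e‖ = 1) (m : ℕ)
    {h : ℝ → ℂ} (hh : Continuous h) :
    Integrable fun x : Space d => ((‖x‖ ^ m * Real.exp (-‖x‖ ^ 2 / 2) : ℝ) : ℂ) *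
      h (inner ℝ x e / ‖x‖) := by
  have : Nontrivial (Space d) := by
    have : Nonempty (Fin d) := ⟨⟨0, hd⟩⟩
    infer_instance
  obtain ⟨C, hC⟩ := (isCompact_Icc (a := (-1 : ℝ)) (b := 1)).exists_bound_of_continuousOn
    hh.continuousOn
  refine Integrable.mul_bdd (c := C) ?_ ?_ (Eventually.of_forall fun x => hC _
    (abs_le.1 (abs_inner_div_norm_le he x)))
  · refine Integrable.ofReal ?_
    refine (integrable_fun_norm_addHaar (volume : Measure (Space d))
      (f := fun r : ℝ => r ^ m * Real.exp (-r ^ 2 / 2))).2 ?_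
    refine (integrableOn_pow_mul_exp_neg_sq (Module.finrank ℝ (Space d) - 1 + m)).congr_fun
      (fun r _ => ?_) measurableSet_Ioi
    simp only [smul_eq_mul, pow_add, mul_assoc]
  · exact (hh.measurable.comp (by fun_prop)).aestronglyMeasurable

/-- The integrand is a radial factor times a function of the direction, so the integral splits. The
Gaussian makes the radial factor finite, and it cancels in the end. -/
theorem integral_radial_mul {d : ℕ} (hd : 1 ≤ d) {e : Space d} (he : ‖e‖ = 1) (m : ℕ)
    {h : ℝ → ℂ} (hh : Continuous h) :
    ∫ x : Space d, ((‖x‖ ^ m * Real.exp (-‖x‖ ^ 2 / 2) : ℝ) : ℂ) * h (inner ℝ x e / ‖x‖) =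
      ((∫ r in Set.Ioi (0 : ℝ), r ^ (d - 1 + m) * Real.exp (-r ^ 2 / 2) : ℝ) : ℂ) *
      ∫ v : Direction d, h (inner ℝ (v : Space d) e) ∂(volume : Measure (Space d)).toSphere := by
  rw [integral_polar hd (integrable_radial_mul hd he m hh), ← integral_complex_ofReal,
    ← integral_mul_const]
  refine setIntegral_congr_fun measurableSet_Ioi fun r hr => ?_
  have hr : 0 < r := hr
  have : ∀ v : Direction d, ((‖r • (v : Space d)‖ ^ m *
      Real.exp (-‖r • (v : Space d)‖ ^ 2 / 2) : ℝ) : ℂ) *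
      h (inner ℝ (r • (v : Space d)) e / ‖r • (v : Space d)‖) =
      ((r ^ m * Real.exp (-r ^ 2 / 2) : ℝ) : ℂ) * h (inner ℝ (v : Space d) e) := by
    intro v
    rw [norm_smul, norm_eq_of_mem_sphere v, mul_one, Real.norm_eq_abs, abs_of_pos hr,
      real_inner_smul_left, mul_div_cancel_left₀ _ hr.ne']
  simp only [this]
  rw [integral_const_mul, Complex.real_smul, ← mul_assoc]
  congr 1
  push_cast
  ring

/-- Integration by parts for functions of one coordinate on the sphere. -/
theorem integral_sphere_byParts {d : ℕ} (hd : 2 ≤ d) {e : Space d} (he : ‖e‖ = 1) {g g' : ℝ → ℂ}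
    (hg : ∀ u, HasDerivAt g (g' u) u) (hg' : Continuous g') :
    ∫ v : Direction d, ((1 - (inner ℝ (v : Space d) e) ^ 2 : ℝ) : ℂ) *
        g' (inner ℝ (v : Space d) e) ∂(volume : Measure (Space d)).toSphere =
      ((d : ℂ) - 1) * ∫ v : Direction d, ((inner ℝ (v : Space d) e : ℝ) : ℂ) *
        g (inner ℝ (v : Space d) e) ∂(volume : Measure (Space d)).toSphere := by
  have hd1 : 1 ≤ d := by omega
  have hgc : Continuous g := continuous_iff_continuousAt.2 fun u => (hg u).continuousAt
  set h₁ : ℝ → ℂ := fun u => (u : ℂ) * g u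
  set h₂ : ℝ → ℂ := fun u => ((1 - u ^ 2 : ℝ) : ℂ) * g' u
  have hh₁ : Continuous h₁ := by fun_prop
  have hh₂ : Continuous h₂ := by fun_prop
  have i1 := integrable_radial_mul hd1 he 1 hh₁
  have i3 := integrable_radial_mul hd1 he 3 hh₁
  have i2 := integrable_radial_mul hd1 he 1 hh₂
  have hderiv : sphereTestDeriv e g g' = fun x =>
      2 * (((‖x‖ ^ 1 * Real.exp (-‖x‖ ^ 2 / 2) : ℝ) : ℂ) * h₁ (inner ℝ x e / ‖x‖)) -
      ((‖x‖ ^ 3 * Real.exp (-‖x‖ ^ 2 / 2) : ℝ) : ℂ) * h₁ (inner ℝ x e / ‖x‖) +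
      ((‖x‖ ^ 1 * Real.exp (-‖x‖ ^ 2 / 2) : ℝ) : ℂ) * h₂ (inner ℝ x e / ‖x‖) := by
    funext x
    simp only [sphereTestDeriv, h₁, h₂]
    push_cast
    ring
  -- A directional derivative integrates to zero: integration by parts against the constant 1.
  have hzero : ∫ x, sphereTestDeriv e g g' x = 0 := by
    have := integral_bilinear_hasLineDerivAt_right_eq_neg_left_of_integrable (μ := volume)
      (f := fun _ : Space d => (1 : ℂ)) (f' := fun _ => (0 : ℂ)) (g := sphereTest e g)
      (g' := sphereTestDeriv e g g') (v := e) (B := ContinuousLinearMap.mul ℝ ℂ)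
      (by simp) (by
        simp only [ContinuousLinearMap.mul_apply', one_mul]
        rw [hderiv]
        exact ((i1.const_mul 2).sub i3).add i2) (by
        simp only [ContinuousLinearMap.mul_apply', one_mul]
        exact integrable_radial_mul hd1 he 2 hgc)
      (fun x _ => by
        simpa [HasLineDerivAt] using hasDerivAt_const (0 : ℝ) (1 : ℂ))
      (fun x _ => hasLineDerivAt_sphereTest he hg x)
    simpa using this
  have hlin : ∀ k₁ k₃ k₂ : Space d → ℂ, Integrable k₁ → Integrable k₃ → Integrable k₂ →
      ∫ x, (2 * k₁ x - k₃ x + k₂ x) = 2 * (∫ x, k₁ x) - (∫ x, k₃ x) + ∫ x, k₂ x := by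
    intro k₁ k₃ k₂ j1 j3 j2
    rw [← integral_const_mul, ← integral_sub (j1.const_mul 2) j3,
      ← integral_add (by exact (j1.const_mul 2).sub j3) j2]
  rw [hderiv, hlin _ _ _ i1 i3 i2, integral_radial_mul hd1 he 1 hh₁, integral_radial_mul hd1 he 3 hh₁,
    integral_radial_mul hd1 he 1 hh₂] at hzero
  -- If A is the radial moment of order d, that of order d + 2 is (d + 1) A; the two terms in `h₁`
  -- combine to (2 - (d + 1)) A = -(d - 1) A.
  have hrec := integral_pow_add_two_mul_exp_neg_sq (d - 1 + 1)
  have hpos := integral_pow_mul_exp_neg_sq_pos (d - 1 + 1)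
  have hdc : ((d - 1 + 1 : ℕ) : ℝ) = d := by congr 1; omega
  rw [hdc] at hrec
  rw [show d - 1 + 3 = d - 1 + 1 + 2 by omega, hrec] at hzero
  set A := ∫ r in Set.Ioi (0 : ℝ), r ^ (d - 1 + 1) * Real.exp (-r ^ 2 / 2)
  have hA : (A : ℂ) ≠ 0 := by exact_mod_cast hpos.ne'
  push_cast at hzero
  have : (A : ℂ) * ((∫ v : Direction d, h₂ (inner ℝ (v : Space d) e)
      ∂(volume : Measure (Space d)).toSphere) - ((d : ℂ) - 1) *
      ∫ v : Direction d, h₁ (inner ℝ (v : Space d) e)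
        ∂(volume : Measure (Space d)).toSphere) = 0 := by
    linear_combination hzero
  exact sub_eq_zero.1 ((mul_eq_zero.1 this).resolve_left hA)

/-! ### The uniform direction: moments and characteristic function of one coordinate. -/

theorem toSphere_univ_ne_zero {d : ℕ} (hd : 1 ≤ d) :
    (volume : Measure (Space d)).toSphere Set.univ ≠ 0 := by
  have : Nontrivial (Space d) := by
    have : Nonempty (Fin d) := ⟨⟨0, hd⟩⟩
    infer_instance
  rw [Ne, Measure.measure_univ_eq_zero]
  exact Measure.toSphere_ne_zero _

theorem isProbabilityMeasure_uniformDirection {d : ℕ} (hd : 1 ≤ d) :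
    IsProbabilityMeasure (uniformDirection d) :=
  ⟨by
    rw [uniformDirection, Measure.smul_apply, smul_eq_mul]
    exact ENNReal.inv_mul_cancel (toSphere_univ_ne_zero hd) (measure_ne_top _ _)⟩

theorem toSphere_eq_smul_uniformDirection {d : ℕ} (hd : 1 ≤ d) :
    (volume : Measure (Space d)).toSphere =
      (volume : Measure (Space d)).toSphere Set.univ • uniformDirection d := by
  rw [uniformDirection, smul_smul, ENNReal.mul_inv_cancel (toSphere_univ_ne_zero hd)
    (measure_ne_top _ _), one_smul]

theorem integral_uniformDirection_byParts {d : ℕ} (hd : 2 ≤ d) {e : Space d} (he : ‖e‖ = 1)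
    {g g' : ℝ → ℂ} (hg : ∀ u, HasDerivAt g (g' u) u) (hg' : Continuous g') :
    ∫ v : Direction d, ((1 - (inner ℝ (v : Space d) e) ^ 2 : ℝ) : ℂ) *
        g' (inner ℝ (v : Space d) e) ∂uniformDirection d =
      ((d : ℂ) - 1) * ∫ v : Direction d, ((inner ℝ (v : Space d) e : ℝ) : ℂ) *
        g (inner ℝ (v : Space d) e) ∂uniformDirection d := by
  rw [uniformDirection, integral_smul_measure, integral_smul_measure,
    integral_sphere_byParts hd he hg hg', mul_smul_comm]

theorem abs_inner_direction_le {d : ℕ} {e : Space d} (he : ‖e‖ = 1) (v : Direction d) :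
    |inner ℝ (v : Space d) e| ≤ 1 := by
  simpa [he] using abs_real_inner_le_norm (v : Space d) e

theorem continuous_inner_direction {d : ℕ} (e : Space d) :
    Continuous fun v : Direction d => (inner ℝ (v : Space d) e : ℝ) := by fun_prop

theorem integrable_comp_inner_direction {d : ℕ} (hd : 1 ≤ d) (e : Space d) {h : ℝ → ℂ}
    (hh : Continuous h) :
    Integrable (fun v : Direction d => h (inner ℝ (v : Space d) e)) (uniformDirection d) := by
  have := isProbabilityMeasure_uniformDirection hd
  exact (hh.comp (continuous_inner_direction e)).integrable_of_hasCompactSupport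
    (HasCompactSupport.of_compactSpace _)

/-- The moments of one coordinate of a uniform direction. -/
theorem integral_inner_direction_pow {d : ℕ} (hd : 2 ≤ d) {e : Space d} (he : ‖e‖ = 1) (k : ℕ) :
    (∫ v : Direction d, ((inner ℝ (v : Space d) e : ℝ) : ℂ) ^ (2 * k) ∂uniformDirection d =
      ((Real.Gamma (d / 2) * (2 * k).factorial / (4 ^ k * k.factorial * Real.Gamma (k + d / 2)) :
        ℝ) : ℂ)) ∧
    ∫ v : Direction d, ((inner ℝ (v : Space d) e : ℝ) : ℂ) ^ (2 * k + 1) ∂uniformDirection d =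
      0 := by
  have hd1 : 1 ≤ d := by omega
  have := isProbabilityMeasure_uniformDirection hd1
  have hdR : (2 : ℝ) ≤ d := by exact_mod_cast hd
  set M : ℕ → ℂ := fun m => ∫ v : Direction d, ((inner ℝ (v : Space d) e : ℝ) : ℂ) ^ m
    ∂uniformDirection d with hM
  have hint : ∀ m : ℕ, Integrable (fun v : Direction d =>
      ((inner ℝ (v : Space d) e : ℝ) : ℂ) ^ m) (uniformDirection d) := fun m =>
    integrable_comp_inner_direction hd1 e (h := fun u => (u : ℂ) ^ m) (by fun_prop)
  -- Integration by parts with g(u) = u ^ (m + 1).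
  have hrec : ∀ m : ℕ, ((m : ℂ) + d) * M (m + 2) = (m + 1) * M m := by
    intro m
    have h := integral_uniformDirection_byParts hd he (g := fun u => (u : ℂ) ^ (m + 1))
      (g' := fun u => ((m : ℂ) + 1) * (u : ℂ) ^ m) (fun u => by
        have := (HasDerivAt.ofReal_comp (hasDerivAt_id u)).pow (m + 1)
        exact this.congr_deriv (by simp)) (by fun_prop)
    have h1 : ∀ v : Direction d, ((1 - (inner ℝ (v : Space d) e) ^ 2 : ℝ) : ℂ) *
        (((m : ℂ) + 1) * ((inner ℝ (v : Space d) e : ℝ) : ℂ) ^ m) =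
        ((m : ℂ) + 1) * (((inner ℝ (v : Space d) e : ℝ) : ℂ) ^ m -
          ((inner ℝ (v : Space d) e : ℝ) : ℂ) ^ (m + 2)) := fun v => by push_cast; ring
    have h2 : ∀ v : Direction d, ((inner ℝ (v : Space d) e : ℝ) : ℂ) *
        ((inner ℝ (v : Space d) e : ℝ) : ℂ) ^ (m + 1) =
        ((inner ℝ (v : Space d) e : ℝ) : ℂ) ^ (m + 2) := fun v => by ring
    simp only [h1, h2] at h
    rw [integral_const_mul, integral_sub (hint _) (hint _)] at h
    simp only [hM]
    linear_combination -h
  induction k with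
  | zero =>
    have hG : Real.Gamma (d / 2) ≠ 0 := (Real.Gamma_pos_of_pos (by linarith)).ne'
    refine ⟨by simp [hG], ?_⟩
    -- Taking g constant gives 0 = (d - 1) times the first moment.
    have h := integral_uniformDirection_byParts hd he (g := fun _ => 1)
      (g' := fun _ => 0) (fun u => hasDerivAt_const _ _) continuous_const
    simp only [mul_zero, integral_zero, mul_one] at h
    have hne : (d : ℂ) - 1 ≠ 0 := by
      intro h0
      have : (d : ℝ) - 1 = 0 := by exact_mod_cast h0
      linarith
    simpa using ((mul_eq_zero.1 h.symm).resolve_left hne)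
  | succ k ih =>
    have hne : ∀ m : ℕ, (m : ℂ) + d ≠ 0 := fun m h0 => by
      have h1 : (m : ℝ) + d = 0 := by exact_mod_cast h0
      have : (0 : ℝ) ≤ m := m.cast_nonneg
      linarith
    constructor
    · have h := hrec (2 * k)
      have hGk : Real.Gamma (k + d / 2) ≠ 0 := (Real.Gamma_pos_of_pos (by positivity)).ne'
      have hs : Real.Gamma ((k + 1 : ℕ) + d / 2) = (k + d / 2) * Real.Gamma (k + d / 2) := by
        rw [← Real.Gamma_add_one (by positivity)]; congr 1; push_cast; ring
      have h3 : M (2 * k) = _ := ih.1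
      rw [h3] at h
      change M (2 * (k + 1)) = _
      rw [show 2 * (k + 1) = 2 * k + 2 by ring, ← mul_right_inj' (hne (2 * k)), h, hs]
      rw [Nat.factorial_succ, Nat.factorial_succ, Nat.factorial_succ]
      have hk : (k : ℝ) + d / 2 ≠ 0 := by positivity
      norm_cast
      push_cast
      field_simp
      ring
    · have h := hrec (2 * k + 1)
      have h3 : M (2 * k + 1) = 0 := ih.2
      rw [h3, mul_zero] at h
      exact (mul_eq_zero.1 h).resolve_left (hne _)

/-- The characteristic function of one coordinate of a uniform direction, as a power series. -/
def coordChar (d : ℕ) (s : ℝ) : ℝ :=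
  Real.Gamma (d / 2) * ∑' k : ℕ, (-1 : ℝ) ^ k * (s / 2) ^ (2 * k) *
    (1 / ((k.factorial : ℝ) * Real.Gamma (k + d / 2)))

/-- The exponential series may be integrated term by term, dominated by ∑ |s|^m / m!; the moments
give the coefficients. -/
theorem integral_exp_inner_direction {d : ℕ} (hd : 2 ≤ d) {e : Space d} (he : ‖e‖ = 1) (s : ℝ) :
    ∫ v : Direction d, Complex.exp (Complex.I * (s * inner ℝ (v : Space d) e : ℝ))
      ∂uniformDirection d = coordChar d s := by
  have hd1 : 1 ≤ d := by omega
  have := isProbabilityMeasure_uniformDirection hd1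
  set f : ℕ → Direction d → ℂ := fun m v =>
    (Complex.I * (s * inner ℝ (v : Space d) e : ℝ)) ^ m / m.factorial
  have hsum : HasSum (fun m => ∫ v, f m v ∂uniformDirection d)
      (∫ v : Direction d, Complex.exp (Complex.I * (s * inner ℝ (v : Space d) e : ℝ))
        ∂uniformDirection d) := by
    refine hasSum_integral_of_dominated_convergence (fun m _ => |s| ^ m / m.factorial)
      (fun m => ?_) (fun m => Eventually.of_forall fun v => ?_)
      (Eventually.of_forall fun _ => Real.summable_pow_div_factorial _)
      (integrable_const _) (Eventually.of_forall fun v => ?_)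
    · exact (integrable_comp_inner_direction hd1 e
        (h := fun u => (Complex.I * (s * u : ℝ)) ^ m / m.factorial) (by fun_prop)).1
    · simp only [f, norm_div, norm_pow, norm_mul, Complex.norm_I, one_mul, Complex.norm_real,
        Complex.norm_natCast, Real.norm_eq_abs]
      gcongr
      exact mul_le_of_le_one_right (abs_nonneg _) (abs_inner_direction_le he v)
    · rw [Complex.exp_eq_exp_ℂ]
      exact NormedSpace.expSeries_div_hasSum_exp _
  have hval : ∀ m, ∫ v, f m v ∂uniformDirection d = (Complex.I * s) ^ m / m.factorial *
      ∫ v : Direction d, ((inner ℝ (v : Space d) e : ℝ) : ℂ) ^ m ∂uniformDirection d := by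
    intro m
    rw [← integral_const_mul]
    congr 1; funext v
    simp only [f]; push_cast; ring
  rw [← hsum.tsum_eq, coordChar, ← tsum_mul_left]
  -- The odd moments vanish, so the sum runs over the even indices only.
  have hinj : Function.Injective fun k : ℕ => 2 * k := fun a b h => by simpa using h
  rw [← hinj.tsum_eq, Complex.ofReal_tsum]
  · refine tsum_congr fun k => ?_
    rw [hval, (integral_inner_direction_pow hd he k).1, mul_pow, pow_mul Complex.I, Complex.I_sq]
    have h1 : (((2 * k).factorial : ℝ)) ≠ 0 := by positivity
    rw [show (s / 2) ^ (2 * k) = s ^ (2 * k) / 4 ^ k by rw [div_pow, pow_mul 2]; norm_num]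
    push_cast
    have h1 : (((2 * k).factorial : ℂ)) ≠ 0 := by exact_mod_cast h1
    field_simp
  · intro m hm
    rcases Nat.even_or_odd' m with ⟨k, rfl | rfl⟩
    · exact ⟨k, rfl⟩
    · rw [Function.mem_support, hval, (integral_inner_direction_pow hd he k).2, mul_zero] at hm
      exact absurd rfl hm

/-- The two series agree term by term once (s / 2) ^ ν is pulled out; s > 0 is needed to split the
real powers. -/
theorem besselJ_eq_coordChar {d : ℕ} (hd : 2 ≤ d) {s : ℝ} (hs : 0 < s) :
    besselJ ((d : ℝ) / 2 - 1) s =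
      s ^ ((d : ℝ) / 2 - 1) * (coordChar d s /
        ((2 : ℝ) ^ ((d : ℝ) / 2 - 1) * Real.Gamma ((d : ℝ) / 2))) := by
  have hdR : (2 : ℝ) ≤ d := by exact_mod_cast hd
  have hG : Real.Gamma ((d : ℝ) / 2) ≠ 0 := (Real.Gamma_pos_of_pos (by linarith)).ne'
  have h2 : (2 : ℝ) ^ ((d : ℝ) / 2 - 1) ≠ 0 := (Real.rpow_pos_of_pos two_pos _).ne'
  rw [coordChar, mul_comm ((2 : ℝ) ^ _), mul_div_mul_left _ _ hG, mul_div_assoc', mul_comm,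
    mul_div_assoc, mul_comm, ← tsum_mul_left, besselJ]
  refine tsum_congr fun k => ?_
  rw [Real.rpow_add (by positivity), Real.div_rpow hs.le two_pos.le ((d : ℝ) / 2 - 1),
    show 2 * (k : ℝ) = ((2 * k : ℕ) : ℝ) by push_cast; ring, Real.rpow_natCast,
    show (k : ℝ) + (d / 2 - 1) + 1 = k + d / 2 by ring]
  ring

theorem coordChar_eq_integral_cos {d : ℕ} (hd : 2 ≤ d) {e : Space d} (he : ‖e‖ = 1) (s : ℝ) :
    coordChar d s = ∫ v : Direction d, Real.cos (s * inner ℝ (v : Space d) e)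
      ∂uniformDirection d := by
  have h := congrArg Complex.re (integral_exp_inner_direction hd he s)
  rw [Complex.ofReal_re] at h
  rw [← h, ← RCLike.re_eq_complex_re, ← integral_re]
  · congr 1; funext v
    rw [RCLike.re_eq_complex_re, mul_comm, Complex.exp_ofReal_mul_I_re]
  · exact integrable_comp_inner_direction (by omega) e
      (h := fun u => Complex.exp (Complex.I * (s * u : ℝ))) (by fun_prop)

theorem exists_unit {d : ℕ} (hd : 2 ≤ d) : ∃ e : Space d, ‖e‖ = 1 :=
  ⟨EuclideanSpace.single ⟨0, by omega⟩ 1, by simp⟩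

theorem abs_coordChar_le_one {d : ℕ} (hd : 2 ≤ d) (s : ℝ) : |coordChar d s| ≤ 1 := by
  obtain ⟨e, he⟩ := exists_unit hd
  have := isProbabilityMeasure_uniformDirection (d := d) (by omega)
  rw [coordChar_eq_integral_cos hd he, ← Real.norm_eq_abs]
  refine (norm_integral_le_of_norm_le_const (C := 1)
    (Eventually.of_forall fun v => Real.abs_cos_le_one _)).trans ?_
  simp

theorem coordChar_neg {d : ℕ} (s : ℝ) : coordChar d (-s) = coordChar d s := by
  simp only [coordChar, neg_div, Even.neg_pow (even_two_mul _)]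

theorem coordChar_zero {d : ℕ} (hd : 2 ≤ d) : coordChar d 0 = 1 := by
  obtain ⟨e, he⟩ := exists_unit hd
  have := isProbabilityMeasure_uniformDirection (d := d) (by omega)
  rw [coordChar_eq_integral_cos hd he]; simp

theorem integrable_real_comp_inner_direction {d : ℕ} (hd : 1 ≤ d) (e : Space d) {h : ℝ → ℝ}
    (hh : Continuous h) :
    Integrable (fun v : Direction d => h (inner ℝ (v : Space d) e)) (uniformDirection d) := by
  have := isProbabilityMeasure_uniformDirection hd
  exact (hh.comp (continuous_inner_direction e)).integrable_of_hasCompactSupport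
    (HasCompactSupport.of_compactSpace _)

/-- Differentiation under the integral sign: the sphere has total mass one, so the constant 1 is an
integrable bound. -/
theorem hasDerivAt_integral_direction {d : ℕ} (hd : 1 ≤ d) {e : Space d} (he : ‖e‖ = 1)
    {h h' : ℝ → ℝ → ℝ} (hc : ∀ s, Continuous (h s)) (hc' : ∀ s, Continuous (h' s))
    (hd' : ∀ s u, HasDerivAt (fun s => h s u) (h' s u) s)
    (hb : ∀ s u, |u| ≤ 1 → |h' s u| ≤ 1) (s : ℝ) :
    HasDerivAt (fun s => ∫ v : Direction d, h s (inner ℝ (v : Space d) e) ∂uniformDirection d)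
      (∫ v : Direction d, h' s (inner ℝ (v : Space d) e) ∂uniformDirection d) s := by
  have := isProbabilityMeasure_uniformDirection hd
  refine (hasDerivAt_integral_of_dominated_loc_of_deriv_le (bound := fun _ => (1 : ℝ))
    (s := Set.univ) univ_mem (Eventually.of_forall fun s => ?_) ?_ ?_
    (Eventually.of_forall fun v s _ => ?_) (integrable_const _)
    (Eventually.of_forall fun v s _ => hd' s _)).2
  · exact (integrable_real_comp_inner_direction hd e (hc s)).1
  · exact integrable_real_comp_inner_direction hd e (hc s)
  · exact (integrable_real_comp_inner_direction hd e (hc' s)).1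
  · exact hb s _ (abs_inner_direction_le he v)

theorem continuous_coordChar {d : ℕ} (hd : 2 ≤ d) : Continuous (coordChar d) := by
  obtain ⟨e, he⟩ := exists_unit hd
  rw [show coordChar d = _ from funext (coordChar_eq_integral_cos hd he)]
  refine continuous_iff_continuousAt.2 fun s => HasDerivAt.continuousAt
    (f' := ∫ v : Direction d, -Real.sin (s * inner ℝ (v : Space d) e) * inner ℝ (v : Space d) e
      ∂uniformDirection d)
    (hasDerivAt_integral_direction (by omega) he (h := fun s u => Real.cos (s * u))
      (h' := fun s u => -Real.sin (s * u) * u) (fun s => by fun_prop) (fun s => by fun_prop)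
      (fun s u => ?_) (fun s u hu => ?_) s)
  · exact (Real.hasDerivAt_cos _).comp s (hasDerivAt_mul_const u)
  · rw [abs_mul, abs_neg]
    exact mul_le_one₀ (Real.abs_sin_le_one _) (abs_nonneg _) hu

/-- The characteristic function of one coordinate of a uniform direction is
`O(s ^ (-(d - 1) / 2))`. -/
theorem exists_abs_coordChar_le {d : ℕ} (hd : 2 ≤ d) :
    ∃ C : ℝ, 0 < C ∧ ∀ s, 0 < s → s ^ (((d : ℝ) - 1) / 2) * |coordChar d s| ≤ C := by
  obtain ⟨e, he⟩ := exists_unit hd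
  have hd1 : 1 ≤ d := by omega
  have hdR : (2 : ℝ) ≤ d := by exact_mod_cast hd
  have := isProbabilityMeasure_uniformDirection hd1
  set α : ℝ := ((d : ℝ) - 1) / 2 with hα
  have hα0 : 0 < α := by rw [hα]; linarith
  set k := coordChar d
  set S : ℝ → ℝ := fun s => ∫ v : Direction d,
    inner ℝ (v : Space d) e * Real.sin (s * inner ℝ (v : Space d) e) ∂uniformDirection d with hS
  set D : ℝ → ℝ := fun s => ∫ v : Direction d,
    (inner ℝ (v : Space d) e) ^ 2 * Real.cos (s * inner ℝ (v : Space d) e) ∂uniformDirection d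
    with hD
  have hk : ∀ s, HasDerivAt k (-S s) s := by
    intro s
    rw [show k = _ from funext (coordChar_eq_integral_cos hd he)]
    refine (hasDerivAt_integral_direction hd1 he (h := fun s u => Real.cos (s * u))
      (h' := fun s u => -(u * Real.sin (s * u))) (fun s => by fun_prop) (fun s => by fun_prop)
      (fun s u => ?_) (fun s u hu => ?_) s).congr_deriv (integral_neg _)
    · exact ((Real.hasDerivAt_cos _).comp s (hasDerivAt_mul_const u)).congr_deriv (by ring)
    · rw [abs_neg, abs_mul]
      exact mul_le_one₀ hu (abs_nonneg _) (Real.abs_sin_le_one _)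
  have hS' : ∀ s, HasDerivAt S (D s) s := by
    intro s
    refine (hasDerivAt_integral_direction hd1 he (h := fun s u => u * Real.sin (s * u))
      (h' := fun s u => u ^ 2 * Real.cos (s * u)) (fun s => by fun_prop) (fun s => by fun_prop)
      (fun s u => ?_) (fun s u hu => ?_) s)
    · exact (((Real.hasDerivAt_sin _).comp s (hasDerivAt_mul_const u)).const_mul u).congr_deriv
        (by ring)
    · rw [abs_mul, abs_pow]
      exact mul_le_one₀ (pow_le_one₀ (abs_nonneg _) hu) (abs_nonneg _) (Real.abs_cos_le_one _)
  -- Integration by parts on the sphere with g(u) = sin(s u). As k' = -S and S' = D, this is the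
  -- Bessel equation for k.
  have hode : ∀ s, s * (k s - D s) = 2 * α * S s := by
    intro s
    have h := integral_uniformDirection_byParts hd he
      (g := fun u => (Real.sin (s * u) : ℝ)) (g' := fun u => ((s * Real.cos (s * u) : ℝ) : ℂ))
      (fun u => by
        have h1 : HasDerivAt (fun u => Real.sin (s * u)) (s * Real.cos (s * u)) u := by
          have := (Real.hasDerivAt_sin (s * u)).comp u ((hasDerivAt_id u).const_mul s)
          exact this.congr_deriv (by simp; ring)
        exact h1.ofReal_comp) (by fun_prop)
    simp only [← Complex.ofReal_mul] at h
    rw [integral_complex_ofReal, integral_complex_ofReal] at h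
    have h2 : ∫ v : Direction d, (1 - (inner ℝ (v : Space d) e) ^ 2) *
        (s * Real.cos (s * inner ℝ (v : Space d) e)) ∂uniformDirection d =
        ((d : ℝ) - 1) * S s := by exact_mod_cast h
    have h3 : ∫ v : Direction d, (1 - (inner ℝ (v : Space d) e) ^ 2) *
        (s * Real.cos (s * inner ℝ (v : Space d) e)) ∂uniformDirection d = s * (k s - D s) := by
      rw [show k s = _ from coordChar_eq_integral_cos hd he s, ← integral_sub,
        ← integral_const_mul]
      · congr 1; funext v; ring
      · exact integrable_real_comp_inner_direction hd1 e (h := fun u => Real.cos (s * u))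
          (by fun_prop)
      · exact integrable_real_comp_inner_direction hd1 e
          (h := fun u => u ^ 2 * Real.cos (s * u)) (by fun_prop)
    rw [← h3, h2, hα]; ring
  -- The factor s^α removes the first-order term of the equation: with w = v', one gets v'' = -v + α
  -- (α - 1) v / s².
  set v : ℝ → ℝ := fun s => s ^ α * k s with hv
  set w : ℝ → ℝ := fun s => s ^ α * (α * k s / s - S s) with hw
  set K : ℝ := |α * (α - 1)| with hK
  have hpow : ∀ s : ℝ, 0 < s → HasDerivAt (fun s : ℝ => s ^ α) (s ^ α * α / s) s := by
    intro s hs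
    refine (Real.hasDerivAt_rpow_const (Or.inl hs.ne')).congr_deriv ?_
    rw [Real.rpow_sub_one hs.ne']; ring
  have hv' : ∀ s, 0 < s → HasDerivAt v (w s) s := by
    intro s hs
    refine ((hpow s hs).mul (hk s)).congr_deriv ?_
    simp only [hw]; ring
  have hw' : ∀ s, 0 < s → HasDerivAt w (-v s + α * (α - 1) * v s / s ^ 2) s := by
    intro s hs
    have h1 := ((hk s).const_mul α).div (hasDerivAt_id s) hs.ne'
    refine ((hpow s hs).mul (h1.sub (hS' s))).congr_deriv ?_
    have h2 : D s = k s - 2 * α * S s / s := by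
      rw [← hode]; field_simp; ring
    simp only [hv, Pi.sub_apply, id, Pi.div_apply, h2]
    field_simp
    ring
  -- The energy v² + v'² changes at relative rate at most K / s², which the factor exp(K / s)
  -- compensates. Hence E decreases and v is bounded on [1, ∞).
  set E : ℝ → ℝ := fun s => (v s ^ 2 + w s ^ 2) * Real.exp (K / s) with hE
  have hE' : ∀ s, 0 < s → HasDerivAt E ((2 * (α * (α - 1)) * v s * w s / s ^ 2 -
      (v s ^ 2 + w s ^ 2) * K / s ^ 2) * Real.exp (K / s)) s := by
    intro s hs
    have h1 : HasDerivAt (fun s => Real.exp (K / s)) (Real.exp (K / s) * (-K / s ^ 2)) s := by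
      have := ((hasDerivAt_const s K).div (hasDerivAt_id s) hs.ne').exp
      exact this.congr_deriv (by simp)
    refine ((((hv' s hs).pow 2).add ((hw' s hs).pow 2)).mul h1).congr_deriv ?_
    simp only [Pi.add_apply, Pi.pow_apply]
    push_cast
    field_simp
    ring
  have hanti : AntitoneOn E (Set.Ici 1) := by
    refine antitoneOn_of_deriv_nonpos (convex_Ici 1)
      (fun s hs => (hE' s (lt_of_lt_of_le one_pos hs)).continuousAt.continuousWithinAt)
      (fun s hs => ?_) (fun s hs => ?_)
    · rw [interior_Ici] at hs
      exact (hE' s (one_pos.trans hs)).differentiableAt.differentiableWithinAt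
    · rw [interior_Ici] at hs
      have hs0 : 0 < s := one_pos.trans hs
      rw [(hE' s hs0).deriv]
      refine mul_nonpos_of_nonpos_of_nonneg ?_ (Real.exp_pos _).le
      rw [← sub_div]
      refine div_nonpos_of_nonpos_of_nonneg ?_ (sq_nonneg s)
      have h1 : α * (α - 1) * (2 * (v s * w s)) ≤ K * |2 * (v s * w s)| := by
        rw [hK, ← abs_mul]; exact le_abs_self _
      have h2 : |2 * (v s * w s)| ≤ v s ^ 2 + w s ^ 2 :=
        abs_le.2 ⟨by nlinarith [sq_nonneg (v s + w s)], by nlinarith [sq_nonneg (v s - w s)]⟩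
      have h3 := mul_le_mul_of_nonneg_left h2 (abs_nonneg (α * (α - 1)))
      rw [← hK] at h3
      linarith
  refine ⟨1 + E 1, ?_, fun s hs => ?_⟩
  · have : 0 ≤ E 1 := by simp only [hE]; positivity
    linarith
  · have hE1 : 0 ≤ E 1 := by simp only [hE]; positivity
    rcases le_total s 1 with h | h
    · have h1 : s ^ α ≤ 1 := Real.rpow_le_one hs.le h hα0.le
      have := mul_le_one₀ h1 (abs_nonneg _) (abs_coordChar_le_one hd s)
      linarith
    · have h1 : v s ^ 2 ≤ E 1 := by
        refine le_trans ?_ (hanti Set.self_mem_Ici h h)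
        have h4 : 1 ≤ Real.exp (K / s) := Real.one_le_exp (by positivity)
        simp only [hE]
        nlinarith [sq_nonneg (v s), sq_nonneg (w s)]
      have h2 : s ^ α * |k s| = |v s| := by
        rw [hv, abs_mul, abs_of_pos (Real.rpow_pos_of_pos hs _)]
      rw [h2]
      nlinarith [sq_abs (v s), sq_nonneg (|v s| - 1), abs_nonneg (v s)]

/-! ### Integration by parts for the beta weight. -/

/-- The unnormalised beta law on `(0, 1)`, with density `x ^ (a - 1) * (1 - x) ^ (b - 1)`. -/
def betaWeight (a b : ℝ) : Measure ℝ :=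
  (volume.restrict (Set.Ioo 0 1)).withDensity fun x =>
    ENNReal.ofReal (x ^ (a - 1) * (1 - x) ^ (b - 1))

theorem integrableOn_betaWeight {a b : ℝ} (ha : 0 < a) (hb : 0 < b) :
    IntegrableOn (fun x : ℝ => x ^ (a - 1) * (1 - x) ^ (b - 1)) (Set.Ioo 0 1) := by
  have h := (Complex.betaIntegral_convergent (u := a) (v := b) (by simpa) (by simpa))
  rw [intervalIntegrable_iff_integrableOn_Ioo_of_le zero_le_one] at h
  refine (IntegrableOn.congr_fun h.norm (fun x hx => ?_) measurableSet_Ioo)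
  have h1 : 0 < 1 - x := by linarith [hx.2]
  rw [norm_mul, show (1 - (x : ℂ)) = ((1 - x : ℝ) : ℂ) by push_cast; ring,
    Complex.norm_cpow_eq_rpow_re_of_pos hx.1, Complex.norm_cpow_eq_rpow_re_of_pos h1]
  simp

theorem isFiniteMeasure_betaWeight {a b : ℝ} (ha : 0 < a) (hb : 0 < b) :
    IsFiniteMeasure (betaWeight a b) :=
  isFiniteMeasure_withDensity_ofReal (integrableOn_betaWeight ha hb).2

theorem ae_betaWeight_mem (a b : ℝ) : ∀ᵐ x ∂betaWeight a b, x ∈ Set.Ioo (0 : ℝ) 1 :=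
  (withDensity_absolutelyContinuous _ _).ae_le (ae_restrict_mem measurableSet_Ioo)

theorem integral_betaWeight (a b : ℝ) (G : ℝ → ℂ) :
    ∫ x, G x ∂betaWeight a b =
      ∫ x in Set.Ioo (0 : ℝ) 1, (x ^ (a - 1) * (1 - x) ^ (b - 1)) • G x := by
  rw [betaWeight, integral_withDensity_eq_integral_toReal_smul (by fun_prop) (by simp)]
  refine setIntegral_congr_fun measurableSet_Ioo fun x hx => ?_
  have h1 : 0 < 1 - x := by linarith [hx.2]
  have h0 : 0 < x := hx.1
  rw [ENNReal.toReal_ofReal (by positivity)]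

/-- The derivative of x^a (1 - x)^b is x^(a-1) (1 - x)^(b-1) (a - (a + b) x), and x^a (1 - x)^b
vanishes at both end points because a and b are positive. -/
theorem integral_betaWeight_byParts {a b : ℝ} (ha : 0 < a) (hb : 0 < b) {G G' : ℝ → ℂ}
    (hG : ∀ x, HasDerivAt G (G' x) x) (hG' : Continuous G') :
    ∫ x, ((x * (1 - x) : ℝ) : ℂ) * G' x ∂betaWeight a b =
      ∫ x, (((a + b) * x - a : ℝ) : ℂ) * G x ∂betaWeight a b := by
  have hGc : Continuous G := continuous_iff_continuousAt.2 fun u => (hG u).continuousAt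
  have hint : ∀ H : ℝ → ℂ, Continuous H →
      IntegrableOn (fun x : ℝ => (x ^ (a - 1) * (1 - x) ^ (b - 1)) • H x) (Set.Ioo 0 1) := by
    intro H hH
    obtain ⟨C, hC⟩ := (isCompact_Icc (a := (0 : ℝ)) (b := 1)).exists_bound_of_continuousOn
      hH.continuousOn
    refine Integrable.smul_bdd (integrableOn_betaWeight ha hb) C hH.aestronglyMeasurable ?_
    filter_upwards [ae_restrict_mem measurableSet_Ioo] with x hx
    exact hC x ⟨hx.1.le, hx.2.le⟩
  set H₁ : ℝ → ℂ := fun x => ((x * (1 - x) : ℝ) : ℂ) * G' x with hH₁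
  set H₂ : ℝ → ℂ := fun x => (((a + b) * x - a : ℝ) : ℂ) * G x with hH₂
  have i1 := hint H₁ (by fun_prop)
  have i2 := hint H₂ (by fun_prop)
  rw [integral_betaWeight, integral_betaWeight, ← sub_eq_zero, ← integral_sub i1 i2,
    ← integral_Ioc_eq_integral_Ioo, ← intervalIntegral.integral_of_le zero_le_one]
  have hF := intervalIntegral.integral_eq_sub_of_hasDerivAt_of_le
    (f := fun x : ℝ => (x ^ a * (1 - x) ^ b) • G x)
    (f' := fun x => (x ^ (a - 1) * (1 - x) ^ (b - 1)) • H₁ x -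
      (x ^ (a - 1) * (1 - x) ^ (b - 1)) • H₂ x) (zero_le_one' ℝ)
    (Continuous.continuousOn ?_) (fun x hx => ?_) ?_
  · rw [hF]
    simp [Real.zero_rpow ha.ne', Real.zero_rpow hb.ne']
  · have h1 : Continuous fun x : ℝ => x ^ a := Real.continuous_rpow_const ha.le
    have h2 : Continuous fun x : ℝ => (1 - x) ^ b :=
      (Real.continuous_rpow_const hb.le).comp (by fun_prop)
    exact (h1.mul h2).smul hGc
  · have h0 : 0 < x := hx.1
    have h1 : 0 < 1 - x := by linarith [hx.2]
    have d1 : HasDerivAt (fun x : ℝ => x ^ a) (x ^ (a - 1) * a) x :=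
      (Real.hasDerivAt_rpow_const (Or.inl h0.ne')).congr_deriv (by ring)
    have d2 : HasDerivAt (fun x : ℝ => (1 - x) ^ b) (-((1 - x) ^ (b - 1) * b)) x := by
      have := ((hasDerivAt_id x).const_sub 1).rpow_const (p := b) (Or.inl h1.ne')
      exact this.congr_deriv (by simp; ring)
    refine ((d1.mul d2).smul (hG x)).congr_deriv ?_
    have e1 : x ^ a = x ^ (a - 1) * x := by rw [Real.rpow_sub_one h0.ne']; field_simp
    have e2 : (1 - x) ^ b = (1 - x) ^ (b - 1) * (1 - x) := by
      rw [Real.rpow_sub_one h1.ne']; field_simp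
    simp only [hH₁, hH₂, Complex.real_smul, Pi.mul_apply, e1, e2]
    push_cast
    ring
  · rw [intervalIntegrable_iff_integrableOn_Ioo_of_le zero_le_one]
    exact i1.sub i2

/-! ### Conormal random variables. -/

/-- A bounded random variable `z` with values in `[-1, 1]` which carries an algebra of weights
against which the vector field `(1 - y²) d/dy` can be integrated by parts. -/
structure IsConormal {S : Type} [MeasurableSpace S] (μ : Measure S) (z : S → ℝ) : Prop where
  isFinite : IsFiniteMeasure μ
  measurable : Measurable z
  abs_le_one : ∀ᵐ s ∂μ, |z s| ≤ 1
  exists_weights : ∃ A : Submodule ℂ (S → ℂ), (fun _ => 1) ∈ A ∧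
    (∀ p ∈ A, Measurable p ∧ ∃ C : ℝ, ∀ᵐ s ∂μ, ‖p s‖ ≤ C) ∧
    (∀ p ∈ A, (fun s => (z s : ℂ) * p s) ∈ A) ∧
    ∀ p ∈ A, ∃ q ∈ A, ∀ ψ ψ' : ℝ → ℂ, (∀ y, HasDerivAt ψ (ψ' y) y) → Continuous ψ' →
      ∫ s, ((1 - z s ^ 2 : ℝ) : ℂ) * ψ' (z s) * p s ∂μ = ∫ s, ψ (z s) * q s ∂μ

/-- The weights are the smooth functions of the coordinate itself. Integration by parts on the
sphere applied to the product ψ h moves the derivative from ψ to h and stays in this class. -/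
theorem isConormal_direction {d : ℕ} (hd : 2 ≤ d) {e : Space d} (he : ‖e‖ = 1) :
    IsConormal (uniformDirection d) fun v : Direction d => inner ℝ (v : Space d) e := by
  have hd1 : 1 ≤ d := by omega
  have hprob := isProbabilityMeasure_uniformDirection hd1
  refine ⟨inferInstance, (continuous_inner_direction e).measurable,
    Eventually.of_forall fun v => abs_inner_direction_le he v, ?_⟩
  refine ⟨{ carrier := {p | ∃ h : ℝ → ℂ, ContDiff ℝ (⊤ : ℕ∞) h ∧
              p = fun v : Direction d => h (inner ℝ (v : Space d) e)}
            add_mem' := ?_, zero_mem' := ?_, smul_mem' := ?_ }, ?_, ?_, ?_, ?_⟩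
  · rintro _ _ ⟨h, hh, rfl⟩ ⟨k, hk, rfl⟩
    exact ⟨fun u => h u + k u, hh.add hk, rfl⟩
  · exact ⟨fun _ => 0, contDiff_const, rfl⟩
  · rintro c _ ⟨h, hh, rfl⟩
    exact ⟨fun u => c * h u, contDiff_const.mul hh, rfl⟩
  · exact ⟨fun _ => 1, contDiff_const, rfl⟩
  · rintro _ ⟨h, hh, rfl⟩
    obtain ⟨C, hC⟩ := (isCompact_Icc (a := (-1 : ℝ)) (b := 1)).exists_bound_of_continuousOn
      hh.continuous.continuousOn
    exact ⟨hh.continuous.measurable.comp (continuous_inner_direction e).measurable, C,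
      Eventually.of_forall fun v => hC _ (abs_le.1 (abs_inner_direction_le he v))⟩
  · rintro _ ⟨h, hh, rfl⟩
    exact ⟨fun u => (u : ℂ) * h u, Complex.ofRealCLM.contDiff.mul hh, rfl⟩
  · rintro _ ⟨h, hh, rfl⟩
    have hh' : ContDiff ℝ (⊤ : ℕ∞) (deriv h) := (contDiff_infty_iff_deriv.1 hh).2
    have hcoe : ContDiff ℝ (⊤ : ℕ∞) (fun u : ℝ => (u : ℂ)) := Complex.ofRealCLM.contDiff
    refine ⟨_, ⟨fun u => ((d : ℂ) - 1) * (u * h u) - (1 - (u : ℂ) ^ 2) * deriv h u,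
      (contDiff_const.mul (hcoe.mul hh)).sub ((contDiff_const.sub (hcoe.pow 2)).mul hh'), rfl⟩,
      fun ψ ψ' hψ hψ' => ?_⟩
    have hψc : Continuous ψ := continuous_iff_continuousAt.2 fun u => (hψ u).continuousAt
    have hhc := hh.continuous
    have hhc' := hh'.continuous
    have key := integral_uniformDirection_byParts hd he (g := fun u => ψ u * h u)
      (g' := fun u => ψ' u * h u + ψ u * deriv h u)
      (fun u => (hψ u).mul ((contDiff_infty_iff_deriv.1 hh).1 u).hasDerivAt) (by fun_prop)
    have e1 : ∀ v : Direction d, ((1 - (inner ℝ (v : Space d) e) ^ 2 : ℝ) : ℂ) *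
        (ψ' (inner ℝ (v : Space d) e) * h (inner ℝ (v : Space d) e) +
          ψ (inner ℝ (v : Space d) e) * deriv h (inner ℝ (v : Space d) e)) =
        ((1 - (inner ℝ (v : Space d) e) ^ 2 : ℝ) : ℂ) *
          ψ' (inner ℝ (v : Space d) e) * h (inner ℝ (v : Space d) e) +
        ψ (inner ℝ (v : Space d) e) * ((1 - ((inner ℝ (v : Space d) e : ℝ) : ℂ) ^ 2) *
          deriv h (inner ℝ (v : Space d) e)) := fun v => by push_cast; ring
    simp only [e1] at key
    rw [integral_add (integrable_comp_inner_direction hd1 e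
        (h := fun u => ((1 - u ^ 2 : ℝ) : ℂ) * ψ' u * h u) (by fun_prop))
      (integrable_comp_inner_direction hd1 e
        (h := fun u => ψ u * ((1 - (u : ℂ) ^ 2) * deriv h u)) (by fun_prop))] at key
    rw [eq_sub_of_add_eq key, ← integral_const_mul, ← integral_sub
      (integrable_comp_inner_direction hd1 e
        (h := fun u => ((d : ℂ) - 1) * (u * (ψ u * h u))) (by fun_prop))
      (integrable_comp_inner_direction hd1 e
        (h := fun u => ψ u * ((1 - (u : ℂ) ^ 2) * deriv h u)) (by fun_prop))]
    congr 1; funext v; ring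

section Fubini

variable {X Y Z : Type} [MeasurableSpace X] [MeasurableSpace Y] [MeasurableSpace Z]
  {μ : Measure X} {ν : Measure Y} {ρ : Measure Z}

/-- This lemma and the next two allow an integration by parts in a single variable of a product to
be transferred to the whole integral. -/
theorem integral_prod_congr_fst [SFinite μ] [SFinite ν] {f g : X × Y → ℂ}
    (hf : Integrable f (μ.prod ν)) (hg : Integrable g (μ.prod ν))
    (h : ∀ y, ∫ x, f (x, y) ∂μ = ∫ x, g (x, y) ∂μ) :
    ∫ p, f p ∂(μ.prod ν) = ∫ p, g p ∂(μ.prod ν) := by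
  rw [integral_prod_symm _ hf, integral_prod_symm _ hg]
  simp only [h]

theorem integral_prod_congr_snd_fst [SFinite μ] [SFinite ν] [SFinite ρ] {f g : X × Y × Z → ℂ}
    (hf : Integrable f (μ.prod (ν.prod ρ))) (hg : Integrable g (μ.prod (ν.prod ρ)))
    (h : ∀ x z, ∫ y, f (x, y, z) ∂ν = ∫ y, g (x, y, z) ∂ν) :
    ∫ p, f p ∂(μ.prod (ν.prod ρ)) = ∫ p, g p ∂(μ.prod (ν.prod ρ)) := by
  rw [integral_prod _ hf, integral_prod _ hg]
  refine integral_congr_ae ?_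
  filter_upwards [hf.prod_right_ae, hg.prod_right_ae] with x hfx hgx
  exact integral_prod_congr_fst hfx hgx (h x)

theorem integral_prod_congr_snd_snd [SFinite μ] [SFinite ν] [SFinite ρ] {f g : X × Y × Z → ℂ}
    (hf : Integrable f (μ.prod (ν.prod ρ))) (hg : Integrable g (μ.prod (ν.prod ρ)))
    (h : ∀ x y, ∫ z, f (x, y, z) ∂ρ = ∫ z, g (x, y, z) ∂ρ) :
    ∫ p, f p ∂(μ.prod (ν.prod ρ)) = ∫ p, g p ∂(μ.prod (ν.prod ρ)) := by
  rw [integral_prod _ hf, integral_prod _ hg]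
  refine integral_congr_ae ?_
  filter_upwards [hf.prod_right_ae, hg.prod_right_ae] with x hfx hgx
  rw [integral_prod _ hfx, integral_prod _ hgx]
  simp only [h]

end Fubini

theorem integrable_of_ae_bound {S : Type} [MeasurableSpace S] {μ : Measure S} [IsFiniteMeasure μ]
    {f : S → ℂ} (hf : Measurable f) {C : ℝ} (hC : ∀ᵐ s ∂μ, ‖f s‖ ≤ C) : Integrable f μ :=
  Integrable.of_bound hf.aestronglyMeasurable C hC

/-- If `|z| ≤ 1` almost surely, `h` is continuous and `p` is bounded, then `h z * p` is
integrable. -/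
theorem integrable_comp_mul {S : Type} [MeasurableSpace S] {μ : Measure S} [IsFiniteMeasure μ]
    {z : S → ℝ} (hz : Measurable z) (hz1 : ∀ᵐ s ∂μ, |z s| ≤ 1) {h : ℝ → ℂ} (hh : Continuous h)
    {p : S → ℂ} (hp : Measurable p) (hpb : ∃ C : ℝ, ∀ᵐ s ∂μ, ‖p s‖ ≤ C) :
    Integrable (fun s => h (z s) * p s) μ := by
  obtain ⟨C, hC⟩ := hpb
  obtain ⟨B, hB⟩ := (isCompact_Icc (a := (-1 : ℝ)) (b := 1)).exists_bound_of_continuousOn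
    hh.continuousOn
  refine integrable_of_ae_bound (C := B * C) ((hh.measurable.comp hz).mul hp) ?_
  filter_upwards [hz1, hC] with s h1 h2
  rw [norm_mul]
  have := hB _ (abs_le.1 h1)
  exact mul_le_mul this h2 (norm_nonneg _) ((norm_nonneg _).trans this)

/-- The class of conormal random variables is closed under mixing with a beta weight. -/
theorem IsConormal.mix {S₁ S₂ : Type} [MeasurableSpace S₁] [MeasurableSpace S₂]
    {μ₁ : Measure S₁} {μ₂ : Measure S₂} {z₁ : S₁ → ℝ} {z₂ : S₂ → ℝ}
    (h₁ : IsConormal μ₁ z₁) (h₂ : IsConormal μ₂ z₂) {a b : ℝ} (ha : 0 < a) (hb : 0 < b) :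
    IsConormal ((betaWeight a b).prod (μ₁.prod μ₂))
      fun s : ℝ × S₁ × S₂ => s.1 * z₁ s.2.1 + (1 - s.1) * z₂ s.2.2 := by
  have := h₁.isFinite
  have := h₂.isFinite
  have := isFiniteMeasure_betaWeight ha hb
  obtain ⟨A₁, one₁, bdd₁, mul₁, ibp₁⟩ := h₁.exists_weights
  obtain ⟨A₂, one₂, bdd₂, mul₂, ibp₂⟩ := h₂.exists_weights
  have mz₁ := h₁.measurable
  have mz₂ := h₂.measurable
  set π := (betaWeight a b).prod (μ₁.prod μ₂) with hπ
  set Φ : ℝ × S₁ × S₂ → ℝ := fun s => s.1 * z₁ s.2.1 + (1 - s.1) * z₂ s.2.2 with hΦ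
  have mΦ : Measurable Φ := by fun_prop
  have q1 : ∀ {P : ℝ → Prop}, (∀ᵐ x ∂betaWeight a b, P x) → ∀ᵐ s ∂π, P s.1 := fun h =>
    Measure.quasiMeasurePreserving_fst.ae h
  have q2 : ∀ {P : S₁ → Prop}, (∀ᵐ x ∂μ₁, P x) → ∀ᵐ s ∂π, P s.2.1 := fun h =>
    Measure.quasiMeasurePreserving_snd.ae (Measure.quasiMeasurePreserving_fst.ae h)
  have q3 : ∀ {P : S₂ → Prop}, (∀ᵐ x ∂μ₂, P x) → ∀ᵐ s ∂π, P s.2.2 := fun h =>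
    Measure.quasiMeasurePreserving_snd.ae (Measure.quasiMeasurePreserving_snd.ae h)
  have aβ := q1 (ae_betaWeight_mem a b)
  have az₁ := q2 h₁.abs_le_one
  have az₂ := q3 h₂.abs_le_one
  have aΦ : ∀ᵐ s ∂π, |Φ s| ≤ 1 := by
    filter_upwards [aβ, az₁, az₂] with s hs h1 h2
    have hs0 := hs.1
    have hs1 := hs.2
    obtain ⟨h1, h1'⟩ := abs_le.1 h1
    obtain ⟨h2, h2'⟩ := abs_le.1 h2
    exact abs_le.2 ⟨by simp only [hΦ]; nlinarith, by simp only [hΦ]; nlinarith⟩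
  -- The weights of the mixture are spanned by β^i p₁ p₂: powers of β are forced by closure under
  -- multiplication by β z₁ + (1 - β) z₂.
  set w : ℕ → (S₁ → ℂ) → (S₂ → ℂ) → ℝ × S₁ × S₂ → ℂ :=
    fun i p₁ p₂ s => (s.1 : ℂ) ^ i * p₁ s.2.1 * p₂ s.2.2 with hw
  have bw : ∀ i, ∀ p₁ ∈ A₁, ∀ p₂ ∈ A₂, Measurable (w i p₁ p₂) ∧
      ∃ C : ℝ, ∀ᵐ s ∂π, ‖w i p₁ p₂ s‖ ≤ C := by
    intro i p₁ hp₁ p₂ hp₂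
    obtain ⟨m1, C1, b1⟩ := bdd₁ p₁ hp₁
    obtain ⟨m2, C2, b2⟩ := bdd₂ p₂ hp₂
    refine ⟨by fun_prop, C1 * C2, ?_⟩
    filter_upwards [aβ, q2 b1, q3 b2] with s hs h1 h2
    have hs0 : 0 < s.1 := hs.1
    rw [norm_mul, norm_mul, norm_pow, Complex.norm_real, Real.norm_eq_abs, abs_of_pos hs.1]
    have h3 : s.1 ^ i ≤ 1 := pow_le_one₀ hs.1.le hs.2.le
    have h4 : s.1 ^ i * ‖p₁ s.2.1‖ ≤ C1 := (mul_le_of_le_one_left (norm_nonneg _) h3).trans h1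
    exact mul_le_mul h4 h2 (norm_nonneg _) ((by positivity : 0 ≤ s.1 ^ i * ‖p₁ s.2.1‖).trans h4)
  set A : Submodule ℂ (ℝ × S₁ × S₂ → ℂ) :=
    Submodule.span ℂ {p | ∃ i, ∃ p₁ ∈ A₁, ∃ p₂ ∈ A₂, p = w i p₁ p₂} with hA
  have wA : ∀ i, ∀ p₁ ∈ A₁, ∀ p₂ ∈ A₂, w i p₁ p₂ ∈ A := fun i p₁ hp₁ p₂ hp₂ =>
    Submodule.subset_span ⟨i, p₁, hp₁, p₂, hp₂, rfl⟩
  have bA : ∀ p ∈ A, Measurable p ∧ ∃ C : ℝ, ∀ᵐ s ∂π, ‖p s‖ ≤ C := by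
    intro p hp
    induction hp using Submodule.span_induction with
    | mem p hp => obtain ⟨i, p₁, hp₁, p₂, hp₂, rfl⟩ := hp; exact bw i p₁ hp₁ p₂ hp₂
    | zero => exact ⟨measurable_zero, 0, by simp⟩
    | add p q _ _ hp hq =>
      obtain ⟨mp, C, hC⟩ := hp
      obtain ⟨mq, D, hD⟩ := hq
      refine ⟨mp.add mq, C + D, ?_⟩
      filter_upwards [hC, hD] with s h1 h2
      exact (norm_add_le _ _).trans (add_le_add h1 h2)
    | smul c p _ hp =>
      obtain ⟨mp, C, hC⟩ := hp
      refine ⟨mp.const_smul c, ‖c‖ * C, ?_⟩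
      filter_upwards [hC] with s h1
      rw [Pi.smul_apply, norm_smul]
      gcongr
  refine ⟨inferInstance, mΦ, aΦ, A, ?_, bA, ?_, ?_⟩
  · have := wA 0 _ one₁ _ one₂
    simpa [hw] using this
  · intro p hp
    induction hp using Submodule.span_induction with
    | mem p hp =>
      obtain ⟨i, p₁, hp₁, p₂, hp₂, rfl⟩ := hp
      have := A.sub_mem (A.add_mem (wA (i + 1) _ (mul₁ _ hp₁) _ hp₂) (wA i _ hp₁ _ (mul₂ _ hp₂)))
        (wA (i + 1) _ hp₁ _ (mul₂ _ hp₂))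
      convert this using 1
      funext s
      simp only [hw, hΦ, Pi.add_apply, Pi.sub_apply]
      push_cast; ring
    | zero => convert A.zero_mem using 1; funext s; simp
    | add p q _ _ hp hq =>
      convert A.add_mem hp hq using 1; funext s; simp only [Pi.add_apply]; ring
    | smul c p _ hp =>
      convert A.smul_mem c hp using 1; funext s; simp only [Pi.smul_apply, smul_eq_mul]; ring
  · intro p hp
    induction hp using Submodule.span_induction with
    | zero => exact ⟨0, A.zero_mem, fun ψ ψ' _ _ => by simp⟩
    | add p q hpA hqA hp hq =>
      obtain ⟨p', hp', ep⟩ := hp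
      obtain ⟨q', hq', eq⟩ := hq
      refine ⟨p' + q', A.add_mem hp' hq', fun ψ ψ' hψ hψ' => ?_⟩
      have hψc : Continuous ψ := continuous_iff_continuousAt.2 fun u => (hψ u).continuousAt
      have hc : Continuous fun y : ℝ => ((1 - y ^ 2 : ℝ) : ℂ) * ψ' y := by fun_prop
      have j1 := integrable_comp_mul mΦ aΦ hc (bA p hpA).1 (bA p hpA).2
      have j2 := integrable_comp_mul mΦ aΦ hc (bA q hqA).1 (bA q hqA).2
      have j3 := integrable_comp_mul mΦ aΦ hψc (bA p' hp').1 (bA p' hp').2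
      have j4 := integrable_comp_mul mΦ aΦ hψc (bA q' hq').1 (bA q' hq').2
      simp only [Pi.add_apply, mul_add]
      rw [integral_add j1 j2, integral_add j3 j4, ep ψ ψ' hψ hψ', eq ψ ψ' hψ hψ']
    | smul c p _ hp =>
      obtain ⟨p', hp', ep⟩ := hp
      refine ⟨c • p', A.smul_mem c hp', fun ψ ψ' hψ hψ' => ?_⟩
      simp only [Pi.smul_apply, smul_eq_mul, mul_left_comm _ c]
      rw [integral_const_mul, integral_const_mul, ep ψ ψ' hψ hψ']
    | mem p hp =>
      obtain ⟨i, p₁, hp₁, p₂, hp₂, rfl⟩ := hp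
      obtain ⟨r₁, hr₁, e₁⟩ := ibp₁ p₁ hp₁
      obtain ⟨r₂, hr₂, e₂⟩ := ibp₂ p₂ hp₂
      set z₁p : S₁ → ℂ := fun s => (z₁ s : ℂ) * p₁ s with hz₁p
      set z₂p : S₂ → ℂ := fun s => (z₂ s : ℂ) * p₂ s with hz₂p
      have hz₁A := mul₁ p₁ hp₁
      have hz₂A := mul₂ p₂ hp₂
      -- The result of integrating by parts in β. The term i x^i (1 - x) from differentiating x^i
      -- combines with (a + b) x - a, giving (a + b + i) x^(i+1) - (a + i) x^i times z₁ - z₂.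
      set D : ℝ × S₁ × S₂ → ℂ := ((a : ℂ) + b + i) • (w (i + 1) z₁p p₂ - w (i + 1) p₁ z₂p) -
        ((a : ℂ) + i) • (w i z₁p p₂ - w i p₁ z₂p) with hD
      have hDA : D ∈ A := A.sub_mem
        (A.smul_mem _ (A.sub_mem (wA _ _ hz₁A _ hp₂) (wA _ _ hp₁ _ hz₂A)))
        (A.smul_mem _ (A.sub_mem (wA _ _ hz₁A _ hp₂) (wA _ _ hp₁ _ hz₂A)))
      have hq₁A := wA i _ hr₁ _ hp₂
      have hq₂A := wA i _ hp₁ _ hr₂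
      refine ⟨D + w i r₁ p₂ + w i p₁ r₂, A.add_mem (A.add_mem hDA hq₁A) hq₂A,
        fun ψ ψ' hψ hψ' => ?_⟩
      have hψc : Continuous ψ := continuous_iff_continuousAt.2 fun u => (hψ u).continuousAt
      obtain ⟨mw, C, hC⟩ := bw i p₁ hp₁ p₂ hp₂
      have bc : ∀ c : ℝ × S₁ × S₂ → ℝ, Measurable c → (∀ᵐ s ∂π, |c s| ≤ 4) →
          Integrable (fun s => ψ' (Φ s) * ((c s : ℂ) * w i p₁ p₂ s)) π := by
        intro c mc hc
        refine integrable_comp_mul mΦ aΦ hψ' (by fun_prop) ⟨4 * C, ?_⟩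
        filter_upwards [hc, hC] with s h1 h2
        rw [norm_mul, Complex.norm_real, Real.norm_eq_abs]
        exact mul_le_mul h1 h2 (norm_nonneg _) (by norm_num)
      have bψ : ∀ q ∈ A, Integrable (fun s => ψ (Φ s) * q s) π := fun q hq =>
        integrable_comp_mul mΦ aΦ hψc (bA q hq).1 (bA q hq).2
      have k0 := bc (fun s => s.1 * (1 - s.1) * (z₁ s.2.1 - z₂ s.2.2) ^ 2) (by fun_prop) (by
        filter_upwards [aβ, az₁, az₂] with s hs h1 h2
        have hs0 := hs.1
        have hs1 := hs.2
        obtain ⟨h1, h1'⟩ := abs_le.1 h1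
        obtain ⟨h2, h2'⟩ := abs_le.1 h2
        have h3 : s.1 * (1 - s.1) ≤ 1 := by nlinarith
        have h4 : 0 ≤ s.1 * (1 - s.1) := by nlinarith
        have h5 : (z₁ s.2.1 - z₂ s.2.2) ^ 2 ≤ 4 := by nlinarith
        rw [abs_of_nonneg (by positivity)]
        nlinarith [sq_nonneg (z₁ s.2.1 - z₂ s.2.2)])
      have k1 := bc (fun s => s.1 * (1 - z₁ s.2.1 ^ 2)) (by fun_prop) (by
        filter_upwards [aβ, az₁] with s hs h1
        have hs0 := hs.1
        have hs1 := hs.2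
        have h2 : z₁ s.2.1 ^ 2 ≤ 1 := (sq_le_one_iff_abs_le_one _).2 h1
        rw [abs_of_nonneg (mul_nonneg hs0.le (by linarith))]
        nlinarith [sq_nonneg (z₁ s.2.1)])
      have k2 := bc (fun s => (1 - s.1) * (1 - z₂ s.2.2 ^ 2)) (by fun_prop) (by
        filter_upwards [aβ, az₂] with s hs h1
        have hs0 := hs.1
        have hs1 := hs.2
        have h2 : z₂ s.2.2 ^ 2 ≤ 1 := (sq_le_one_iff_abs_le_one _).2 h1
        rw [abs_of_nonneg (mul_nonneg (by linarith) (by linarith))]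
        nlinarith [sq_nonneg (z₂ s.2.2)])
      -- Since ∂Φ/∂β = z₁ - z₂, one factor z₁ - z₂ is absorbed by ψ' and the beta weight supplies
      -- the vector field β (1 - β) d/dβ.
      have t0 := integral_prod_congr_fst k0 (bψ _ hDA) (fun y => by
        have hder : ∀ x : ℝ, HasDerivAt
            (fun x : ℝ => ψ (x * z₁ y.1 + (1 - x) * z₂ y.2) * (x : ℂ) ^ i)
            (((z₁ y.1 - z₂ y.2 : ℝ) : ℂ) * ψ' (x * z₁ y.1 + (1 - x) * z₂ y.2) * (x : ℂ) ^ i +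
              ψ (x * z₁ y.1 + (1 - x) * z₂ y.2) * (i * (x : ℂ) ^ (i - 1))) x := by
          intro x
          have d1 : HasDerivAt (fun x : ℝ => x * z₁ y.1 + (1 - x) * z₂ y.2)
              (z₁ y.1 - z₂ y.2) x :=
            (((hasDerivAt_id x).mul_const _).add
              (((hasDerivAt_id x).const_sub 1).mul_const _)).congr_deriv (by ring)
          have d2 := (HasDerivAt.ofReal_comp (hasDerivAt_id x)).pow i
          have d3 := ((hψ _).scomp x d1).mul d2
          refine d3.congr_deriv ?_
          simp
        have key := integral_betaWeight_byParts ha hb hder (by fun_prop)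
        have l : ∀ x : ℝ, ψ' (Φ (x, y)) * (((x * (1 - x) * (z₁ y.1 - z₂ y.2) ^ 2 : ℝ) : ℂ) *
            w i p₁ p₂ (x, y)) = (((z₁ y.1 - z₂ y.2 : ℝ) : ℂ) * p₁ y.1 * p₂ y.2) *
            ((((x * (1 - x) : ℝ) : ℂ) *
              (((z₁ y.1 - z₂ y.2 : ℝ) : ℂ) * ψ' (x * z₁ y.1 + (1 - x) * z₂ y.2) * (x : ℂ) ^ i +
              ψ (x * z₁ y.1 + (1 - x) * z₂ y.2) * (i * (x : ℂ) ^ (i - 1)))) -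
              ψ (x * z₁ y.1 + (1 - x) * z₂ y.2) * (i * ((x : ℂ) ^ i * (1 - x)))) := by
          intro x
          simp only [hw, hΦ]
          -- The truncated exponent i - 1 is harmless at i = 0, where the factor i vanishes.
          rcases i with _ | i
          · push_cast; simp; ring
          · push_cast; simp only [pow_succ]; ring
        have r : ∀ x : ℝ, ψ (Φ (x, y)) * D (x, y) =
            (((z₁ y.1 - z₂ y.2 : ℝ) : ℂ) * p₁ y.1 * p₂ y.2) *
            ((((a + b) * x - a : ℝ) : ℂ) * (ψ (x * z₁ y.1 + (1 - x) * z₂ y.2) * (x : ℂ) ^ i) -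
              ψ (x * z₁ y.1 + (1 - x) * z₂ y.2) * (i * ((x : ℂ) ^ i * (1 - x)))) := by
          intro x
          simp only [hw, hΦ, hD, hz₁p, hz₂p, Pi.sub_apply, Pi.smul_apply, smul_eq_mul]
          push_cast; ring
        have bdI : ∀ h : ℝ → ℂ, Continuous h → Integrable h (betaWeight a b) := by
          intro h hh
          obtain ⟨B, hB⟩ := (isCompact_Icc (a := (0 : ℝ)) (b := 1)).exists_bound_of_continuousOn
            hh.continuousOn
          refine integrable_of_ae_bound hh.measurable (C := B) ?_
          filter_upwards [ae_betaWeight_mem a b] with x hx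
          exact hB x ⟨hx.1.le, hx.2.le⟩
        simp only [l, r]
        rw [integral_const_mul, integral_const_mul, integral_sub (bdI _ (by fun_prop))
          (bdI _ (by fun_prop)), integral_sub (bdI _ (by fun_prop)) (bdI _ (by fun_prop)), key])
      -- With β and z₂ frozen, ∂Φ/∂z₁ = β, so the integration by parts available for z₁ applies to u
      -- ↦ ψ(β u + (1 - β) z₂); `t2` is the same for z₂.
      have t1 := integral_prod_congr_snd_fst k1 (bψ _ hq₁A) (fun x y => by
        have key := e₁ (fun u => ψ (x * u + (1 - x) * z₂ y))
          (fun u => (x : ℂ) * ψ' (x * u + (1 - x) * z₂ y)) (fun u => by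
            have d1 : HasDerivAt (fun u : ℝ => x * u + (1 - x) * z₂ y) x u :=
              (((hasDerivAt_id u).const_mul x).add_const _).congr_deriv (by simp)
            exact ((hψ _).scomp u d1).congr_deriv (by simp)) (by fun_prop)
        have l : ∀ s, ψ' (Φ (x, s, y)) * (((x * (1 - z₁ s ^ 2) : ℝ) : ℂ) * w i p₁ p₂ (x, s, y)) =
            ((x : ℂ) ^ i * p₂ y) * (((1 - z₁ s ^ 2 : ℝ) : ℂ) *
              ((x : ℂ) * ψ' (x * z₁ s + (1 - x) * z₂ y)) * p₁ s) := fun s => by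
          simp only [hw, hΦ]; push_cast; ring
        have r : ∀ s, ψ (Φ (x, s, y)) * w i r₁ p₂ (x, s, y) =
            ((x : ℂ) ^ i * p₂ y) * (ψ (x * z₁ s + (1 - x) * z₂ y) * r₁ s) := fun s => by
          simp only [hw, hΦ]; ring
        simp only [l, r]
        rw [integral_const_mul, integral_const_mul, key])
      have t2 := integral_prod_congr_snd_snd k2 (bψ _ hq₂A) (fun x y => by
        have key := e₂ (fun u => ψ (x * z₁ y + (1 - x) * u))
          (fun u => ((1 - x : ℝ) : ℂ) * ψ' (x * z₁ y + (1 - x) * u)) (fun u => by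
            have d1 : HasDerivAt (fun u : ℝ => x * z₁ y + (1 - x) * u) (1 - x) u :=
              (((hasDerivAt_id u).const_mul (1 - x)).const_add _).congr_deriv (by simp)
            exact ((hψ _).scomp u d1).congr_deriv (by simp)) (by fun_prop)
        have l : ∀ s, ψ' (Φ (x, y, s)) * ((((1 - x) * (1 - z₂ s ^ 2) : ℝ) : ℂ) *
            w i p₁ p₂ (x, y, s)) = ((x : ℂ) ^ i * p₁ y) * (((1 - z₂ s ^ 2 : ℝ) : ℂ) *
              (((1 - x : ℝ) : ℂ) * ψ' (x * z₁ y + (1 - x) * z₂ s)) * p₂ s) := fun s => by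
          simp only [hw, hΦ]; push_cast; ring
        have r : ∀ s, ψ (Φ (x, y, s)) * w i p₁ r₂ (x, y, s) =
            ((x : ℂ) ^ i * p₁ y) * (ψ (x * z₁ y + (1 - x) * z₂ s) * r₂ s) := fun s => by
          simp only [hw, hΦ]; ring
        simp only [l, r]
        rw [integral_const_mul, integral_const_mul, key])
      -- The identity 1 - Φ² = β (1 - β) (z₁ - z₂)² + β (1 - z₁²) + (1 - β) (1 - z₂²) decomposes the
      -- vector field for Φ into those for β, z₁ and z₂.
      have split : ∀ s, ((1 - Φ s ^ 2 : ℝ) : ℂ) * ψ' (Φ s) * w i p₁ p₂ s =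
          ψ' (Φ s) * (((s.1 * (1 - s.1) * (z₁ s.2.1 - z₂ s.2.2) ^ 2 : ℝ) : ℂ) * w i p₁ p₂ s) +
          ψ' (Φ s) * (((s.1 * (1 - z₁ s.2.1 ^ 2) : ℝ) : ℂ) * w i p₁ p₂ s) +
          ψ' (Φ s) * ((((1 - s.1) * (1 - z₂ s.2.2 ^ 2) : ℝ) : ℂ) * w i p₁ p₂ s) := by
        intro s
        have : 1 - Φ s ^ 2 = s.1 * (1 - s.1) * (z₁ s.2.1 - z₂ s.2.2) ^ 2 +
            s.1 * (1 - z₁ s.2.1 ^ 2) + (1 - s.1) * (1 - z₂ s.2.2 ^ 2) := by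
          simp only [hΦ]; ring
        rw [this]; push_cast; ring
      simp only [split, Pi.add_apply, mul_add]
      rw [integral_add (by exact k0.add k1) k2, integral_add k0 k1,
        integral_add (by exact (bψ _ hDA).add (bψ _ hq₁A)) (bψ _ hq₂A),
        integral_add (bψ _ hDA) (bψ _ hq₁A), t0, t1, t2]

/-- Localised away from the end points, the law of a conormal random variable has a rapidly
decreasing Fourier transform. -/
theorem IsConormal.exists_pow_mul_norm_integral_le {S : Type} [MeasurableSpace S] {μ : Measure S}
    {z : S → ℝ} (h : IsConormal μ z) {δ : ℝ} (hδ : 0 < δ) {χ : ℝ → ℂ}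
    (hχ : ContDiff ℝ (⊤ : ℕ∞) χ) (hχ0 : ∀ y, 1 - δ < |y| → χ y = 0) (N : ℕ) :
    ∃ C : ℝ, ∀ ρ : ℝ, |ρ| ^ N * ‖∫ s, χ (z s) * Complex.exp (Complex.I * (ρ * z s : ℝ)) ∂μ‖ ≤ C := by
  have := h.isFinite
  obtain ⟨A, hone, hbdd, -, hibp⟩ := h.exists_weights
  -- Each integration by parts changes both weight and cutoff, so the induction must quantify over
  -- all of them.
  suffices H : ∀ N : ℕ, ∀ p ∈ A, ∀ χ : ℝ → ℂ, ContDiff ℝ (⊤ : ℕ∞) χ →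
      (∀ y, 1 - δ < |y| → χ y = 0) → ∃ C : ℝ, ∀ ρ : ℝ, |ρ| ^ N *
        ‖∫ s, χ (z s) * Complex.exp (Complex.I * (ρ * z s : ℝ)) * p s ∂μ‖ ≤ C by
    simpa using H N _ hone χ hχ hχ0
  clear hχ hχ0 χ N
  intro N
  have hcoe : ContDiff ℝ (⊤ : ℕ∞) (fun u : ℝ => (u : ℂ)) := Complex.ofRealCLM.contDiff
  have hint : ∀ p ∈ A, ∀ χ : ℝ → ℂ, Continuous χ → ∀ ρ : ℝ,
      Integrable (fun s => χ (z s) * Complex.exp (Complex.I * (ρ * z s : ℝ)) * p s) μ :=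
    fun p hp χ hχ ρ => integrable_comp_mul h.measurable h.abs_le_one
      (h := fun y => χ y * Complex.exp (Complex.I * (ρ * y : ℝ))) (by fun_prop)
      (hbdd p hp).1 (hbdd p hp).2
  induction N with
  | zero =>
    intro p hp χ hχ _
    refine ⟨∫ s, ‖χ (z s) * p s‖ ∂μ, fun ρ => ?_⟩
    rw [pow_zero, one_mul]
    refine (norm_integral_le_integral_norm _).trans (le_of_eq ?_)
    congr 1; funext s
    rw [mul_right_comm, norm_mul, mul_comm Complex.I, Complex.norm_exp_ofReal_mul_I, mul_one]
  | succ N ih =>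
    intro p hp χ hχ hχ0
    obtain ⟨q, hq, hpq⟩ := hibp p hp
    have hopen : IsOpen {y : ℝ | 1 - δ < |y|} := isOpen_lt continuous_const continuous_abs
    -- The support of χ stays away from ±1, so χ may be divided by 1 - y², the coefficient of the
    -- vector field.
    set χ₁ : ℝ → ℂ := fun y => χ y * (1 - (y : ℂ) ^ 2)⁻¹ with hχ₁
    have hχ₁0 : ∀ y, 1 - δ < |y| → χ₁ y = 0 := fun y hy => by simp [hχ₁, hχ0 y hy]
    have hne : ∀ y : ℝ, |y| < 1 → 1 - (y : ℂ) ^ 2 ≠ 0 := by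
      intro y hy h0
      have h1 : 1 - y ^ 2 = 0 := by exact_mod_cast h0
      have := (sq_lt_one_iff_abs_lt_one y).2 hy
      linarith
    have hcd : ContDiff ℝ (⊤ : ℕ∞) χ₁ := by
      rw [contDiff_iff_contDiffAt]
      intro y
      by_cases hy : |y| < 1
      · exact hχ.contDiffAt.mul ((contDiff_const.sub (hcoe.pow 2)).contDiffAt.inv (hne y hy))
      · have : χ₁ =ᶠ[𝓝 y] fun _ => 0 := by
          filter_upwards [hopen.mem_nhds (show 1 - δ < |y| by linarith)] with x hx
          exact hχ₁0 x hx
        exact contDiffAt_const.congr_of_eventuallyEq this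
    have hcd' : ContDiff ℝ (⊤ : ℕ∞) (deriv χ₁) := (contDiff_infty_iff_deriv.1 hcd).2
    set χ₂ : ℝ → ℂ := fun y => (1 - (y : ℂ) ^ 2) * deriv χ₁ y with hχ₂
    have hχ₂0 : ∀ y, 1 - δ < |y| → χ₂ y = 0 := by
      intro y hy
      have : χ₁ =ᶠ[𝓝 y] fun _ => 0 := by
        filter_upwards [hopen.mem_nhds hy] with x hx
        exact hχ₁0 x hx
      simp [hχ₂, this.deriv_eq]
    have hcd₂ : ContDiff ℝ (⊤ : ℕ∞) χ₂ := (contDiff_const.sub (hcoe.pow 2)).mul hcd'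
    obtain ⟨C₁, hC₁⟩ := ih q hq χ₁ hcd hχ₁0
    obtain ⟨C₂, hC₂⟩ := ih p hp χ₂ hcd₂ hχ₂0
    refine ⟨C₁ + C₂, fun ρ => ?_⟩
    set I := ∫ s, χ (z s) * Complex.exp (Complex.I * (ρ * z s : ℝ)) * p s ∂μ
    set I₁ := ∫ s, χ₁ (z s) * Complex.exp (Complex.I * (ρ * z s : ℝ)) * q s ∂μ
    set I₂ := ∫ s, χ₂ (z s) * Complex.exp (Complex.I * (ρ * z s : ℝ)) * p s ∂μ
    have hχc := hcd'.continuous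
    have hχ₁c := hcd.continuous
    have key := hpq (fun y => χ₁ y * Complex.exp (Complex.I * (ρ * y : ℝ)))
      (fun y => deriv χ₁ y * Complex.exp (Complex.I * (ρ * y : ℝ)) +
        χ₁ y * (Complex.exp (Complex.I * (ρ * y : ℝ)) * (Complex.I * ρ))) (fun y => by
        have d1 : HasDerivAt (fun y : ℝ => Complex.I * ((ρ * y : ℝ) : ℂ)) (Complex.I * ρ) y := by
          have := (HasDerivAt.ofReal_comp ((hasDerivAt_id y).const_mul ρ)).const_mul Complex.I
          exact this.congr_deriv (by simp)
        exact ((contDiff_infty_iff_deriv.1 hcd).1 y).hasDerivAt.mul d1.cexp) (by fun_prop)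
    have e1 : ∀ s, ((1 - z s ^ 2 : ℝ) : ℂ) *
        (deriv χ₁ (z s) * Complex.exp (Complex.I * (ρ * z s : ℝ)) +
          χ₁ (z s) * (Complex.exp (Complex.I * (ρ * z s : ℝ)) * (Complex.I * ρ))) * p s =
        χ₂ (z s) * Complex.exp (Complex.I * (ρ * z s : ℝ)) * p s +
        (Complex.I * ρ) * (χ (z s) * Complex.exp (Complex.I * (ρ * z s : ℝ)) * p s) := by
      intro s
      have e2 : (1 - (z s : ℂ) ^ 2) * χ₁ (z s) = χ (z s) := by
        by_cases hy : |z s| < 1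
        · simp only [hχ₁]; field_simp [hne _ hy]
        · rw [hχ₁0 _ (by linarith), hχ0 _ (by linarith), mul_zero]
      rw [← e2]; simp only [hχ₂]; push_cast; ring
    simp only [e1] at key
    rw [integral_add (hint p hp _ hcd₂.continuous ρ)
      ((hint p hp _ hχ.continuous ρ).const_mul _), integral_const_mul] at key
    -- One integration by parts gains one factor ρ; `I₁` and `I₂` are integrals of the same type,
    -- covered by the induction hypothesis.
    have hI : Complex.I * ρ * I = I₁ - I₂ := by
      rw [eq_sub_iff_add_eq, add_comm]; exact key
    have hn : |ρ| * ‖I‖ = ‖I₁ - I₂‖ := by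
      rw [← hI, norm_mul, norm_mul, Complex.norm_I, one_mul, Complex.norm_real, Real.norm_eq_abs]
    calc |ρ| ^ (N + 1) * ‖I‖ = |ρ| ^ N * ‖I₁ - I₂‖ := by rw [← hn]; ring
      _ ≤ |ρ| ^ N * (‖I₁‖ + ‖I₂‖) := by gcongr; exact norm_sub_le _ _
      _ ≤ C₁ + C₂ := by rw [mul_add]; exact add_le_add (hC₁ ρ) (hC₂ ρ)

/-! ### Stick breaking for the generalized Dirichlet law. -/

/-- The generalized Dirichlet density without its normalising constant. -/
def gdKernel {n : ℕ} (a b : Fin n → ℝ) (t : ℝ) (τ : Fin n → ℝ) : ℝ :=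
  ∏ k, (τ k ^ (a k - 1) * (t - ∑ j ∈ Finset.Iic k, τ j) ^ (b k - 1))

/-- The generalized Dirichlet law without its normalising constant. -/
def gdWeight {n : ℕ} (a b : Fin n → ℝ) (t : ℝ) : Measure (Fin n → ℝ) :=
  (volume.restrict (simplex n t)).withDensity fun τ => ENNReal.ofReal (gdKernel a b t τ)

/-- Stick breaking: break off a fraction `β` of a stick of length `t`, and break the rest in the
proportions `σ`. -/
def stick {n : ℕ} (t : ℝ) (p : ℝ × (Fin n → ℝ)) : Fin (n + 1) → ℝ :=
  Fin.cons (t * p.1) fun j => t * (1 - p.1) * p.2 j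

theorem measurable_stick {n : ℕ} (t : ℝ) : Measurable (stick (n := n) t) := by
  refine measurable_pi_lambda _ fun k => ?_
  refine Fin.cases ?_ (fun k => ?_) k
  · simp only [stick, Fin.cons_zero]; fun_prop
  · simp only [stick, Fin.cons_succ]; fun_prop

theorem measurable_gdKernel {n : ℕ} (a b : Fin n → ℝ) (t : ℝ) : Measurable (gdKernel a b t) := by
  unfold gdKernel
  fun_prop

theorem measurableSet_simplex (n : ℕ) (t : ℝ) : MeasurableSet (simplex n t) := by
  simp only [simplex, Set.ofPred_forall]
  refine MeasurableSet.iInter fun k => ?_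
  exact (measurableSet_lt measurable_const (measurable_pi_apply k)).inter
    (measurableSet_lt (measurable_pi_apply k) (by fun_prop))

theorem sum_Iio_eq {n : ℕ} (k : Fin n) (f : Fin n → ℝ) :
    ∑ j ∈ Finset.Iio k, f j = ∑ j, if j < k then f j else 0 := by
  rw [← Finset.sum_filter]; congr 1; ext; simp

theorem sum_Iic_eq {n : ℕ} (k : Fin n) (f : Fin n → ℝ) :
    ∑ j ∈ Finset.Iic k, f j = ∑ j, if j ≤ k then f j else 0 := by
  rw [← Finset.sum_filter]; congr 1; ext; simp

theorem sum_Iio_stick_succ {n : ℕ} (t : ℝ) (p : ℝ × (Fin n → ℝ)) (k : Fin n) :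
    ∑ j ∈ Finset.Iio k.succ, stick t p j = t * p.1 + t * (1 - p.1) * ∑ j ∈ Finset.Iio k, p.2 j := by
  rw [sum_Iio_eq, sum_Iio_eq, Fin.sum_univ_succ, Finset.mul_sum]
  simp [stick, Fin.succ_lt_succ_iff]

theorem sum_Iic_stick_succ {n : ℕ} (t : ℝ) (p : ℝ × (Fin n → ℝ)) (k : Fin n) :
    ∑ j ∈ Finset.Iic k.succ, stick t p j = t * p.1 + t * (1 - p.1) * ∑ j ∈ Finset.Iic k, p.2 j := by
  rw [sum_Iic_eq, sum_Iic_eq, Fin.sum_univ_succ, Finset.mul_sum]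
  simp [stick, Fin.succ_le_succ_iff]

theorem sum_Iic_stick_zero {n : ℕ} (t : ℝ) (p : ℝ × (Fin n → ℝ)) :
    ∑ j ∈ Finset.Iic 0, stick t p j = t * p.1 := by
  rw [sum_Iic_eq, Fin.sum_univ_succ]
  simp [stick]

theorem sum_stick {n : ℕ} (t : ℝ) (p : ℝ × (Fin n → ℝ)) :
    ∑ j, stick t p j = t * p.1 + t * (1 - p.1) * ∑ j, p.2 j := by
  rw [Fin.sum_univ_succ, Finset.mul_sum]
  simp [stick]

theorem stick_mem_simplex_iff {n : ℕ} {t : ℝ} (ht : 0 < t) {p : ℝ × (Fin n → ℝ)}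
    (hp : p.1 ∈ Set.Ioo (0 : ℝ) 1) : stick t p ∈ simplex (n + 1) t ↔ p.2 ∈ simplex n 1 := by
  have h1 : 0 < 1 - p.1 := by linarith [hp.2]
  have h0 : 0 < p.1 := hp.1
  have hr : 0 < t * (1 - p.1) := by positivity
  simp only [simplex, Set.mem_ofPred_eq, Fin.forall_fin_succ, sum_Iio_stick_succ]
  have hz : 0 < stick t p 0 ∧ stick t p 0 < t - ∑ j ∈ Finset.Iio 0, stick t p j := by
    simp only [stick, Fin.cons_zero]
    refine ⟨by positivity, ?_⟩
    rw [sum_Iio_eq]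
    simp
    nlinarith
  have hk : ∀ k : Fin n, t - (t * p.1 + t * (1 - p.1) * ∑ j ∈ Finset.Iio k, p.2 j) =
      t * (1 - p.1) * (1 - ∑ j ∈ Finset.Iio k, p.2 j) := fun k => by ring
  simp only [hz, hk, true_and]
  simp only [stick, Fin.cons_succ, mul_lt_mul_iff_right₀ hr, mul_pos_iff_of_pos_left hr]

theorem rest_pos_of_mem_simplex {n : ℕ} {t : ℝ} {τ : Fin n → ℝ} (h : τ ∈ simplex n t)
    (k : Fin n) : 0 < t - ∑ j ∈ Finset.Iic k, τ j := by
  have h1 := (h k).2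
  have : Finset.Iic k = Finset.cons k (Finset.Iio k) (by simp) := by
    ext j; simp [le_iff_eq_or_lt]
  rw [this, Finset.sum_cons]
  linarith

/-- The factor t (t (1 - β))^n is the Jacobian of stick breaking. Every remaining length after the
first break is proportional to 1 - β, so the kernel splits into a beta density in β and a Dirichlet
kernel in σ. -/
theorem gdKernel_stick {n : ℕ} (a b : Fin (n + 1) → ℝ) {t : ℝ} (ht : 0 < t)
    {p : ℝ × (Fin n → ℝ)} (hp : p.1 ∈ Set.Ioo (0 : ℝ) 1) (hp2 : p.2 ∈ simplex n 1) :
    t * (t * (1 - p.1)) ^ n * gdKernel a b t (stick t p) =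
      t ^ (1 + n + ∑ k, (a k - 1 + (b k - 1))) *
        (p.1 ^ (a 0 - 1) * (1 - p.1) ^ (b 0 + ∑ k : Fin n, (a k.succ + b k.succ - 1) - 1)) *
        gdKernel (Fin.tail a) (Fin.tail b) 1 p.2 := by
  have h1 : 0 < 1 - p.1 := by linarith [hp.2]
  have h0 : 0 < p.1 := hp.1
  have hr : 0 < t * (1 - p.1) := by positivity
  have hk : ∀ k : Fin n, t - (t * p.1 + t * (1 - p.1) * ∑ j ∈ Finset.Iic k, p.2 j) =
      t * (1 - p.1) * (1 - ∑ j ∈ Finset.Iic k, p.2 j) := fun k => by ring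
  unfold gdKernel
  rw [Fin.prod_univ_succ, sum_Iic_stick_zero]
  simp only [sum_Iic_stick_succ, hk]
  have hz : stick t p 0 = t * p.1 := rfl
  have hs : ∀ k : Fin n, stick t p k.succ = t * (1 - p.1) * p.2 k := fun k => rfl
  simp only [hz, hs, Fin.tail]
  have e1 : ∀ k : Fin n, (t * (1 - p.1) * p.2 k) ^ (a k.succ - 1) *
      (t * (1 - p.1) * (1 - ∑ j ∈ Finset.Iic k, p.2 j)) ^ (b k.succ - 1) =
      (t ^ (a k.succ - 1 + (b k.succ - 1)) * (1 - p.1) ^ (a k.succ - 1 + (b k.succ - 1))) *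
      (p.2 k ^ (a k.succ - 1) * (1 - ∑ j ∈ Finset.Iic k, p.2 j) ^ (b k.succ - 1)) := by
    intro k
    rw [Real.mul_rpow hr.le (hp2 k).1.le, Real.mul_rpow hr.le (rest_pos_of_mem_simplex hp2 k).le,
      ← Real.mul_rpow ht.le h1.le, Real.rpow_add hr]
    ring
  simp only [e1]
  rw [Finset.prod_mul_distrib, Finset.prod_mul_distrib, ← Real.rpow_sum_of_pos ht,
    ← Real.rpow_sum_of_pos h1, Real.mul_rpow ht.le h0.le,
    show t - t * p.1 = t * (1 - p.1) by ring, Real.mul_rpow ht.le h1.le, Fin.sum_univ_succ,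
    Real.rpow_add ht, Real.rpow_add ht, Real.rpow_add ht, Real.rpow_add ht, Real.rpow_one,
    Real.rpow_natCast, mul_pow]
  -- The n powers of 1 - β from the Jacobian turn a + b - 2 into a + b - 1 in each summand.
  have e2 : b 0 + ∑ k : Fin n, (a k.succ + b k.succ - 1) - 1 =
      (b 0 - 1) + n + ∑ k : Fin n, (a k.succ - 1 + (b k.succ - 1)) := by
    have : ∑ k : Fin n, (a k.succ + b k.succ - 1) =
        ∑ k : Fin n, (a k.succ - 1 + (b k.succ - 1)) + n := by
      have hn : (n : ℝ) = ∑ _k : Fin n, (1 : ℝ) := by simp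
      rw [hn, ← Finset.sum_add_distrib]
      exact Finset.sum_congr rfl fun k _ => by ring
    rw [this]; ring
  rw [e2, Real.rpow_add h1, Real.rpow_add h1, Real.rpow_natCast]
  ring

theorem lintegral_comp_smul_pi {n : ℕ} {r : ℝ} (hr : 0 < r) {H : (Fin n → ℝ) → ENNReal}
    (hH : Measurable H) :
    ∫⁻ y, H y = ENNReal.ofReal (r ^ n) * ∫⁻ y : Fin n → ℝ, H (fun j => r * y j) := by
  have h := Measure.map_addHaar_smul (volume : Measure (Fin n → ℝ)) hr.ne'
  have h2 : ∫⁻ y : Fin n → ℝ, H (fun j => r * y j) = ∫⁻ y, H y ∂(Measure.map (r • ·) volume) := by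
    rw [lintegral_map hH (by fun_prop)]; rfl
  rw [h2, h, lintegral_smul_measure, smul_eq_mul, ← mul_assoc, ← ENNReal.ofReal_mul (by positivity),
    abs_of_pos (by positivity), Module.finrank_fin_fun, mul_inv_cancel₀ (by positivity),
    ENNReal.ofReal_one, one_mul]

theorem lintegral_comp_mul_real {r : ℝ} (hr : 0 < r) {H : ℝ → ENNReal} (hH : Measurable H) :
    ∫⁻ y, H y = ENNReal.ofReal r * ∫⁻ y, H (r * y) := by
  have h := Measure.map_addHaar_smul (volume : Measure ℝ) hr.ne'
  have h2 : ∫⁻ y, H (r * y) = ∫⁻ y, H y ∂(Measure.map (r • ·) volume) := by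
    rw [lintegral_map hH (by fun_prop)]; rfl
  rw [h2, h, lintegral_smul_measure, smul_eq_mul, ← mul_assoc, ← ENNReal.ofReal_mul (by positivity),
    abs_of_pos (by positivity), Module.finrank_self, pow_one, mul_inv_cancel₀ (by positivity),
    ENNReal.ofReal_one, one_mul]

/-- A change of variables in two scalings, τ₀ = t β and then the remaining coordinates by t (1 - β).
The support condition confines β to (0, 1), where both scalings are positive. -/
theorem lintegral_stick {n : ℕ} {t : ℝ} (ht : 0 < t) {H : (Fin (n + 1) → ℝ) → ENNReal}
    (hH : Measurable H) (h0 : ∀ τ, τ 0 ∉ Set.Ioo 0 t → H τ = 0) :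
    ∫⁻ τ, H τ = ∫⁻ β in Set.Ioo (0 : ℝ) 1, ∫⁻ σ : Fin n → ℝ,
      ENNReal.ofReal (t * (t * (1 - β)) ^ n) * H (stick t (β, σ)) := by
  have mp := (volume_preserving_piFinSuccAbove (fun _ : Fin (n + 1) => ℝ) 0).symm
  have hsymm : ⇑(MeasurableEquiv.piFinSuccAbove (fun _ : Fin (n + 1) => ℝ) 0).symm =
      fun q : ℝ × (Fin n → ℝ) => (Fin.cons q.1 q.2 : Fin (n + 1) → ℝ) :=
    funext fun q => Fin.insertNth_zero' q.1 q.2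
  have hcons : Measurable fun q : ℝ × (Fin n → ℝ) => (Fin.cons q.1 q.2 : Fin (n + 1) → ℝ) := by
    rw [← hsymm]
    exact (MeasurableEquiv.piFinSuccAbove (fun _ : Fin (n + 1) => ℝ) 0).symm.measurable
  have hHc : Measurable fun q : ℝ × (Fin n → ℝ) => H (Fin.cons q.1 q.2) := hH.comp hcons
  have e1 : ∫⁻ τ, H τ = ∫⁻ x : ℝ, ∫⁻ y : Fin n → ℝ, H (Fin.cons x y) := by
    rw [← mp.lintegral_comp hH, hsymm]
    exact lintegral_prod _ hHc.aemeasurable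
  rw [e1, lintegral_comp_mul_real ht hHc.lintegral_prod_right', ← lintegral_const_mul' _ _ (by simp),
    ← lintegral_indicator measurableSet_Ioo]
  congr 1
  funext β
  by_cases hβ : β ∈ Set.Ioo (0 : ℝ) 1
  · have h1 : 0 < 1 - β := by linarith [hβ.2]
    rw [Set.indicator_of_mem hβ]
    change ENNReal.ofReal t * ∫⁻ y : Fin n → ℝ, H (Fin.cons (t * β) y) = _
    rw [lintegral_comp_smul_pi (r := t * (1 - β)) (by positivity)
      (show Measurable fun y : Fin n → ℝ => H (Fin.cons (t * β) y) from
        hHc.comp measurable_prodMk_left), ← mul_assoc, ← ENNReal.ofReal_mul ht.le,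
      ← lintegral_const_mul' _ _ (by simp)]
    rfl
  · rw [Set.indicator_of_notMem hβ]
    have : ∀ y : Fin n → ℝ, H (Fin.cons (t * β) y) = 0 := by
      intro y
      refine h0 _ fun h => hβ ?_
      simp only [Fin.cons_zero, Set.mem_Ioo] at h
      exact ⟨pos_of_mul_pos_right h.1 ht.le, by nlinarith [h.2]⟩
    simp [this]

/-- The recursive structure of the law: the first fraction is a beta variable independent of the
proportions of the remainder, which are again generalized Dirichlet. Inductions on n rest on this.
-/
theorem gdWeight_succ {n : ℕ} (a b : Fin (n + 1) → ℝ) {t : ℝ} (ht : 0 < t) :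
    gdWeight a b t = ENNReal.ofReal (t ^ (1 + n + ∑ k, (a k - 1 + (b k - 1)))) •
      ((betaWeight (a 0) (b 0 + ∑ k : Fin n, (a k.succ + b k.succ - 1))).prod
        (gdWeight (Fin.tail a) (Fin.tail b) 1)).map (stick t) := by
  refine Measure.ext_of_lintegral _ fun G hG => ?_
  have hsm := measurableSet_simplex (n + 1) t
  have hkm := (measurable_gdKernel a b t).ennreal_ofReal
  have hkm' := (measurable_gdKernel (Fin.tail a) (Fin.tail b) 1).ennreal_ofReal
  have hGs : Measurable fun p : ℝ × (Fin n → ℝ) => G (stick t p) := hG.comp (measurable_stick t)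
  have hsf : SFinite (gdWeight (Fin.tail a) (Fin.tail b) 1) := by unfold gdWeight; infer_instance
  rw [lintegral_smul_measure, lintegral_map hG (measurable_stick t),
    lintegral_prod _ hGs.aemeasurable, gdWeight,
    lintegral_withDensity_eq_lintegral_mul _ hkm hG, ← lintegral_indicator hsm,
    lintegral_stick ht ((hkm.mul hG).indicator hsm), betaWeight,
    lintegral_withDensity_eq_lintegral_mul _ (by fun_prop) hGs.lintegral_prod_right', smul_eq_mul,
    ← lintegral_const_mul' _ _ (by simp)]
  · refine setLIntegral_congr_fun measurableSet_Ioo fun β hβ => ?_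
    have h1 : 0 < 1 - β := by linarith [hβ.2]
    have hb0 : 0 < β := hβ.1
    simp only [Pi.mul_apply]
    rw [gdWeight, lintegral_withDensity_eq_lintegral_mul _ hkm'
        (show Measurable fun σ => G (stick t (β, σ)) from hGs.comp measurable_prodMk_left),
      ← mul_assoc, ← lintegral_const_mul' _ _ (ENNReal.mul_ne_top (by simp) (by simp)),
      ← lintegral_indicator (measurableSet_simplex n 1)]
    congr 1
    funext σ
    have hiff := stick_mem_simplex_iff ht (p := (β, σ)) hβ
    by_cases hσ : σ ∈ simplex n 1
    · rw [Set.indicator_of_mem (hiff.2 hσ), Set.indicator_of_mem hσ]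
      simp only [Pi.mul_apply]
      rw [← mul_assoc, ← mul_assoc, ← ENNReal.ofReal_mul (by positivity),
        ← ENNReal.ofReal_mul (by positivity), ← ENNReal.ofReal_mul (by positivity)]
      congr 2
      exact gdKernel_stick a b ht (p := (β, σ)) hβ hσ
    · rw [Set.indicator_of_notMem (fun h => hσ (hiff.1 h)), Set.indicator_of_notMem hσ, mul_zero]
  · intro τ hτ
    refine Set.indicator_of_notMem (fun h => hτ ?_) _
    have := h 0
    rw [sum_Iio_eq] at this
    simpa using this

theorem betaWeight_ne_zero (a b : ℝ) : betaWeight a b ≠ 0 := by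
  intro h
  have hac : volume.restrict (Set.Ioo (0 : ℝ) 1) ≪ betaWeight a b := by
    refine withDensity_absolutelyContinuous' (by fun_prop) ?_
    filter_upwards [ae_restrict_mem measurableSet_Ioo] with x hx
    have h1 : 0 < 1 - x := by linarith [hx.2]
    have h0 : 0 < x := hx.1
    exact (ENNReal.ofReal_pos.2 (by positivity)).ne'
  have := hac (s := Set.univ) (by simp [h])
  simp at this

/-- On (1/2, 1) the factor x^(a-1) can be divided out at bounded cost, so (1 - x)^(b-1) is
integrable near 1, which forces b > 0. -/
theorem pos_of_isFiniteMeasure_betaWeight {a b : ℝ} [IsFiniteMeasure (betaWeight a b)] :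
    0 < b := by
  have hint : IntegrableOn (fun x : ℝ => x ^ (a - 1) * (1 - x) ^ (b - 1)) (Set.Ioo 0 1) := by
    refine ⟨by fun_prop, ?_⟩
    have h := measure_lt_top (betaWeight a b) Set.univ
    rw [betaWeight, withDensity_apply _ MeasurableSet.univ, Measure.restrict_univ] at h
    rw [hasFiniteIntegral_iff_norm]
    convert h using 1
    refine setLIntegral_congr_fun measurableSet_Ioo fun x hx => ?_
    have h1 : 0 < 1 - x := by linarith [hx.2]
    have h0 : 0 < x := hx.1
    rw [Real.norm_of_nonneg (by positivity)]
  have h2 : IntegrableOn (fun x : ℝ => (1 - x) ^ (b - 1)) (Set.Ioo (1 / 2) 1) := by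
    have h3 := hint.mono_set (Set.Ioo_subset_Ioo_left (by norm_num : (0 : ℝ) ≤ 1 / 2))
    have hc : ContinuousOn (fun x : ℝ => x ^ (1 - a)) (Set.Icc (1 / 2) 1) :=
      ContinuousOn.rpow_const continuousOn_id fun x hx => Or.inl (by
        have : (1 / 2 : ℝ) ≤ x := hx.1
        exact ne_of_gt (lt_of_lt_of_le (by norm_num) this))
    obtain ⟨C, hC⟩ := isCompact_Icc.exists_bound_of_continuousOn hc
    have h4 := Integrable.mul_bdd (c := C) h3 (g := fun x : ℝ => x ^ (1 - a)) (by fun_prop) (by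
      filter_upwards [ae_restrict_mem measurableSet_Ioo] with x hx
      exact hC x ⟨hx.1.le, hx.2.le⟩)
    refine IntegrableOn.congr_fun h4 (fun x hx => ?_) measurableSet_Ioo
    have h0 : 0 < x := lt_trans (by norm_num) hx.1
    rw [mul_right_comm, ← Real.rpow_add h0]
    simp
  have h5 : IntegrableOn (fun x : ℝ => x ^ (b - 1)) (Set.Ioo 0 (1 / 2)) := by
    rw [← intervalIntegrable_iff_integrableOn_Ioo_of_le (by norm_num)] at h2 ⊢
    have := h2.comp_sub_left 1
    norm_num at this
    exact this.symm
  rw [intervalIntegral.integrableOn_Ioo_rpow_iff (by norm_num)] at h5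
  linarith

theorem gdWeight_zero (a b : Fin 0 → ℝ) (t : ℝ) :
    gdWeight a b t = Measure.dirac (fun _ => 0 : Fin 0 → ℝ) := by
  have h1 : simplex 0 t = Set.univ := by
    ext τ; simp [simplex]
  have h2 : (fun τ => ENNReal.ofReal (gdKernel a b t τ)) = 1 := by
    funext τ; simp [gdKernel]
  rw [gdWeight, h1, h2, Measure.restrict_univ, withDensity_one, volume_pi,
    Measure.pi_of_empty _ (fun _ => 0)]

theorem gdWeight_ne_zero {n : ℕ} (a b : Fin n → ℝ) {t : ℝ} (ht : 0 < t) : gdWeight a b t ≠ 0 := by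
  induction n generalizing t with
  | zero => rw [gdWeight_zero]; exact Measure.dirac_ne_zero
  | succ n ih =>
    have hsf : SFinite (gdWeight (Fin.tail a) (Fin.tail b) 1) := by unfold gdWeight; infer_instance
    rw [gdWeight_succ a b ht, Ne, ← Measure.measure_univ_eq_zero, Measure.smul_apply, smul_eq_mul,
      Measure.map_apply (measurable_stick t) MeasurableSet.univ, Set.preimage_univ,
      ← Set.univ_prod_univ, Measure.prod_prod]
    refine mul_ne_zero (ENNReal.ofReal_pos.2 (Real.rpow_pos_of_pos ht _)).ne'
      (mul_ne_zero ?_ ?_)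
    · rw [Ne, Measure.measure_univ_eq_zero]; exact betaWeight_ne_zero _ _
    · rw [Ne, Measure.measure_univ_eq_zero]; exact ih _ _ one_pos

theorem durations_stick {n : ℕ} (t : ℝ) (p : ℝ × (Fin n → ℝ)) :
    durations t (stick t p) =
      Fin.cons (t * p.1) fun k => t * (1 - p.1) * durations 1 p.2 k := by
  rw [durations, sum_stick, stick, ← Fin.cons_snoc_eq_snoc_cons]
  congr 1
  funext k
  refine Fin.lastCases ?_ (fun k => ?_) k
  · simp only [durations, Fin.snoc_last]; ring
  · simp only [durations, Fin.snoc_castSucc]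

theorem measurable_durations {n : ℕ} (t : ℝ) : Measurable (durations (n := n) t) := by
  refine measurable_pi_lambda _ fun k => ?_
  refine Fin.lastCases ?_ (fun k => ?_) k
  · simp only [durations, Fin.snoc_last]; fun_prop
  · simp only [durations, Fin.snoc_castSucc]; fun_prop

/-! ### The flight as an iterated mixture. -/

/-- The characteristic function of one coordinate of the flight with durations `τ`. -/
def stepsChar (d : ℕ) {n : ℕ} (t : ℝ) (τ : Fin n → ℝ) (s : ℝ) : ℝ :=
  ∏ k, coordChar d (durations t τ k * s)

theorem measurable_stepsChar {d : ℕ} (hd : 2 ≤ d) {n : ℕ} (t s : ℝ) :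
    Measurable fun τ : Fin n → ℝ => stepsChar d t τ s := by
  unfold stepsChar
  refine Finset.measurable_prod _ fun k _ => ?_
  exact (continuous_coordChar hd).measurable.comp
    (((measurable_pi_apply k).comp (measurable_durations t)).mul_const s)

theorem abs_stepsChar_le_one {d : ℕ} (hd : 2 ≤ d) {n : ℕ} (t : ℝ) (τ : Fin n → ℝ) (s : ℝ) :
    |stepsChar d t τ s| ≤ 1 := by
  rw [stepsChar, Finset.abs_prod]
  exact Finset.prod_le_one (fun _ _ => abs_nonneg _) fun _ _ => abs_coordChar_le_one hd _

/-- The first step has length t β and the other steps form a unit-time flight scaled by t (1 - β).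
-/
theorem stepsChar_stick (d : ℕ) {n : ℕ} (t : ℝ) (p : ℝ × (Fin n → ℝ)) (s : ℝ) :
    stepsChar d t (stick t p) s =
      coordChar d (p.1 * (t * s)) * stepsChar d 1 p.2 ((1 - p.1) * (t * s)) := by
  rw [stepsChar, durations_stick, Fin.prod_univ_succ, stepsChar]
  simp only [Fin.cons_zero, Fin.cons_succ]
  congr 1
  · congr 1; ring
  · refine Finset.prod_congr rfl fun k _ => ?_
    congr 1; ring

/-- The characteristic function of one coordinate of the flight is, up to a constant, that of a
conormal random variable. -/
theorem exists_isConormal_stepsChar {d : ℕ} (hd : 2 ≤ d) {n : ℕ} {a b : Fin n → ℝ}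
    (ha : ∀ k, 0 < a k) {t : ℝ} (ht : 0 < t) (hfin : IsFiniteMeasure (gdWeight a b t)) :
    ∃ (S : Type) (_ : MeasurableSpace S) (μ : Measure S) (z : S → ℝ) (C : ℝ), IsConormal μ z ∧
      ∀ s : ℝ, ∫ τ, (stepsChar d t τ s : ℂ) ∂gdWeight a b t =
        C * ∫ x, Complex.exp (Complex.I * (t * s * z x : ℝ)) ∂μ := by
  obtain ⟨e, he⟩ := exists_unit hd
  have hprob := isProbabilityMeasure_uniformDirection (d := d) (by omega)
  induction n generalizing t with
  | zero =>
    refine ⟨Direction d, inferInstance, uniformDirection d, _, 1, isConormal_direction hd he,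
      fun s => ?_⟩
    rw [gdWeight_zero, integral_dirac, integral_exp_inner_direction hd he]
    simp [stepsChar, durations, Fin.snoc]
  | succ n ih =>
    set B := b 0 + ∑ k : Fin n, (a k.succ + b k.succ - 1) with hB
    have hsf : SFinite (gdWeight (Fin.tail a) (Fin.tail b) 1) := by unfold gdWeight; infer_instance
    have hsf' : SFinite (betaWeight (a 0) B) := by unfold betaWeight; infer_instance
    -- The total mass is a product of nonzero factors, so its finiteness passes to each factor.
    have hlt := measure_lt_top (gdWeight a b t) Set.univ
    rw [gdWeight_succ a b ht, Measure.smul_apply, smul_eq_mul,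
      Measure.map_apply (measurable_stick t) MeasurableSet.univ, Set.preimage_univ,
      ← Set.univ_prod_univ, Measure.prod_prod] at hlt
    have hne1 : betaWeight (a 0) B Set.univ ≠ 0 := by
      rw [Ne, Measure.measure_univ_eq_zero]; exact betaWeight_ne_zero _ _
    have hne2 : gdWeight (Fin.tail a) (Fin.tail b) 1 Set.univ ≠ 0 := by
      rw [Ne, Measure.measure_univ_eq_zero]; exact gdWeight_ne_zero _ _ one_pos
    have hne3 : ENNReal.ofReal (t ^ (1 + n + ∑ k, (a k - 1 + (b k - 1)))) ≠ 0 :=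
      (ENNReal.ofReal_pos.2 (Real.rpow_pos_of_pos ht _)).ne'
    have hlt2 := ENNReal.lt_top_of_mul_ne_top_right hlt.ne hne3
    have hf1 : IsFiniteMeasure (betaWeight (a 0) B) :=
      ⟨ENNReal.lt_top_of_mul_ne_top_left hlt2.ne hne2⟩
    have hf2 : IsFiniteMeasure (gdWeight (Fin.tail a) (Fin.tail b) 1) :=
      ⟨ENNReal.lt_top_of_mul_ne_top_right hlt2.ne hne1⟩
    obtain ⟨S, _, μ, z, C, hz, hC⟩ := ih (a := Fin.tail a) (b := Fin.tail b)
      (fun k => ha k.succ) one_pos hf2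
    -- The positivity of the second beta parameter, which the mixing step requires, is read off from
    -- the finiteness of the mass.
    have hBpos : 0 < B := pos_of_isFiniteMeasure_betaWeight (a := a 0)
    have := hz.isFinite
    have hmz := hz.measurable
    refine ⟨ℝ × Direction d × S, inferInstance, _, _,
      t ^ (1 + n + ∑ k, (a k - 1 + (b k - 1))) * C,
      (isConormal_direction hd he).mix hz (ha 0) hBpos, fun s => ?_⟩
    have hms : Measurable fun τ : Fin (n + 1) → ℝ => (stepsChar d t τ s : ℂ) :=
      Complex.measurable_ofReal.comp (measurable_stepsChar hd t s)
    rw [gdWeight_succ a b ht, integral_smul_measure, integral_map (measurable_stick t).aemeasurable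
      hms.aestronglyMeasurable,
      ENNReal.toReal_ofReal (Real.rpow_pos_of_pos ht _).le, Complex.real_smul, Complex.ofReal_mul,
      mul_assoc]
    congr 1
    have hi1 : Integrable (fun p : ℝ × (Fin n → ℝ) => (stepsChar d t (stick t p) s : ℂ))
        ((betaWeight (a 0) B).prod (gdWeight (Fin.tail a) (Fin.tail b) 1)) :=
      Integrable.of_bound ((Complex.measurable_ofReal.comp
        ((measurable_stepsChar hd t s).comp (measurable_stick t))).aestronglyMeasurable) 1
        (Eventually.of_forall fun p => by
          rw [Complex.norm_real]; exact abs_stepsChar_le_one hd _ _ _)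
    have hi2 : Integrable (fun p : ℝ × Direction d × S => Complex.exp (Complex.I *
        (t * s * (p.1 * inner ℝ (p.2.1 : Space d) e + (1 - p.1) * z p.2.2) : ℝ)))
        ((betaWeight (a 0) B).prod ((uniformDirection d).prod μ)) :=
      Integrable.of_bound (by fun_prop) 1 (Eventually.of_forall fun p => by
        rw [mul_comm Complex.I, Complex.norm_exp_ofReal_mul_I])
    rw [integral_prod _ hi1, integral_prod _ hi2, ← integral_const_mul]
    congr 1
    funext β
    -- The exponential of the mixture factorises, so for fixed β the integral is a product: the
    -- characteristic function of one direction times that of the shorter flight, the latter taken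
    -- at total time 1.
    have e1 : ∀ p : Direction d × S, Complex.exp (Complex.I *
        (t * s * (β * inner ℝ (p.1 : Space d) e + (1 - β) * z p.2) : ℝ)) =
        Complex.exp (Complex.I * (β * (t * s) * inner ℝ (p.1 : Space d) e : ℝ)) *
        Complex.exp (Complex.I * (1 * ((1 - β) * (t * s)) * z p.2 : ℝ)) := by
      intro p
      rw [← Complex.exp_add]; congr 1; push_cast; ring
    simp only [e1]
    rw [integral_prod_mul (fun v : Direction d => Complex.exp (Complex.I *
        (β * (t * s) * inner ℝ (v : Space d) e : ℝ))) (fun x => Complex.exp (Complex.I *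
        (1 * ((1 - β) * (t * s)) * z x : ℝ))), integral_exp_inner_direction hd he,
      mul_left_comm, ← hC, ← integral_const_mul]
    congr 1
    funext σ
    rw [stepsChar_stick]; push_cast; rfl

/-! ### Improper integrals of functions without low frequencies. -/

/-- If `B` is dominated by a bounded function `b` which tends to `0` at infinity, and `B` is
annihilated by convolution with a kernel `K` of integral one, then the improper integral of `B`
over `(0, ∞)` converges, at a rate which depends on `b` only. -/
theorem norm_integral_sub_le_of_conv_eq_zero {K : ℝ → ℂ} (hK : Integrable K)
    (hK1 : Integrable fun s => |s| * ‖K s‖) (hone : ∫ s, K s = 1) {b : ℝ → ℝ} (hb : Continuous b)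
    {M : ℝ} (hM : ∀ x, b x ≤ M) {B : ℝ → ℂ} (hB : Continuous B) (hBb : ∀ x, ‖B x‖ ≤ b x)
    (hconv : ∀ x, ∫ s, K s * B (x - s) = 0) (R : ℝ) (hR : 0 ≤ R) :
    ‖(∫ x in (0 : ℝ)..R, B x) - ∫ s, K s * ∫ x in (0 : ℝ)..(-s), B x‖ ≤
      ∫ s, ‖K s‖ * |∫ x in (R - s)..R, b x| := by
  have hBM : ∀ x, ‖B x‖ ≤ M := fun x => (hBb x).trans (hM x)
  set G : ℝ → ℂ := fun y => ∫ x in (0 : ℝ)..y, B x with hG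
  have hi : ∀ u v, IntervalIntegrable B volume u v := fun u v => hB.intervalIntegrable u v
  have hGc : Continuous G := intervalIntegral.continuous_primitive hi 0
  have hGb : ∀ y, ‖G y‖ ≤ M * |y| := fun y => by
    have := intervalIntegral.norm_integral_le_of_norm_le_const (a := 0) (b := y) (f := B) (C := M)
      (fun x _ => hBM x)
    simpa using this
  have hM0 : 0 ≤ M := (norm_nonneg _).trans (hBM 0)
  have hKG : ∀ R : ℝ, Integrable fun s => K s * G (R - s) := by
    intro R
    have h1 : Integrable fun s => M * (|R| * ‖K s‖ + |s| * ‖K s‖) :=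
      ((hK.norm.const_mul _).add hK1).const_mul M
    refine h1.mono' (hK.1.mul (by fun_prop)) (Eventually.of_forall fun s => ?_)
    rw [norm_mul]
    have h2 : |R - s| ≤ |R| + |s| := abs_sub _ _
    calc ‖K s‖ * ‖G (R - s)‖ ≤ ‖K s‖ * (M * (|R| + |s|)) := by
          gcongr; exact (hGb _).trans (by gcongr)
      _ = _ := by ring
  -- The increment of K * G between 0 and R is the integral of K * B, which is zero; so K * G is
  -- constant and its value is the limit sought.
  have hswap : ∫ s, K s * (G (R - s) - G (0 - s)) = 0 := by
    have h1 : ∀ s, K s * (G (R - s) - G (0 - s)) =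
        ∫ x in Set.Ioc 0 R, K s * B (x - s) := by
      intro s
      rw [integral_const_mul, ← intervalIntegral.integral_of_le hR,
        intervalIntegral.integral_comp_sub_right B s]
      simp only [hG]
      rw [intervalIntegral.integral_interval_sub_left (hi _ _) (hi _ _)]
    simp only [h1]
    rw [integral_integral_swap]
    · simp [hconv]
    · have h2 : Integrable (fun p : ℝ × ℝ => K p.1)
          (volume.prod (volume.restrict (Set.Ioc 0 R))) := hK.comp_fst _
      exact h2.mul_bdd (c := M) (g := fun p : ℝ × ℝ => B (p.2 - p.1)) (by fun_prop)
        (Eventually.of_forall fun p => hBM _)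
  have hL : ∫ s, K s * G (R - s) = ∫ s, K s * G (-s) := by
    have h0 : ∀ s, K s * (G (R - s) - G (0 - s)) = K s * G (R - s) - K s * G (0 - s) :=
      fun s => by ring
    simp only [h0] at hswap
    rw [integral_sub (hKG R) (hKG 0), sub_eq_zero] at hswap
    simpa using hswap
  -- Since K has integral one, the error is the average of G(R) - G(R - s) against K, and these
  -- differences are controlled by b.
  have hGR : G R = ∫ s, K s * G R := by rw [integral_mul_const, hone, one_mul]
  change ‖G R - ∫ s, K s * G (-s)‖ ≤ _
  rw [← hL, hGR, ← integral_sub (hK.mul_const _) (hKG R)]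
  refine (norm_integral_le_integral_norm _).trans (integral_mono_of_nonneg
    (Eventually.of_forall fun _ => norm_nonneg _) ?_ (Eventually.of_forall fun s => ?_))
  · have hcb : Continuous fun s : ℝ => ∫ x in (R - s)..R, b x := by
      have h3 : Continuous fun y : ℝ => ∫ x in (0 : ℝ)..y, b x :=
        intervalIntegral.continuous_primitive (fun u v => hb.intervalIntegrable u v) 0
      have h4 : (fun s : ℝ => ∫ x in (R - s)..R, b x) =
          fun s => (∫ x in (0 : ℝ)..R, b x) - ∫ x in (0 : ℝ)..(R - s), b x := by
        funext s
        rw [intervalIntegral.integral_interval_sub_left (hb.intervalIntegrable _ _)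
          (hb.intervalIntegrable _ _)]
      rw [h4]; fun_prop
    refine (hK1.const_mul M).mono' (hK.norm.1.mul hcb.abs.aestronglyMeasurable)
      (Eventually.of_forall fun s => ?_)
    have := intervalIntegral.norm_integral_le_of_norm_le_const (a := R - s) (b := R) (f := b)
      (C := M) (fun x _ => by
        rw [Real.norm_of_nonneg ((norm_nonneg _).trans (hBb x))]; exact hM x)
    rw [Real.norm_eq_abs, sub_sub_cancel] at this
    rw [norm_mul, norm_norm, Real.norm_eq_abs, abs_abs]
    calc _ ≤ ‖K s‖ * (M * |s|) := by gcongr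
      _ = _ := by ring
  · simp only
    rw [← mul_sub, norm_mul]
    refine mul_le_mul_of_nonneg_left ?_ (norm_nonneg _)
    simp only [hG]
    rw [intervalIntegral.integral_interval_sub_left (hi _ _) (hi _ _)]
    exact intervalIntegral.norm_integral_le_abs_of_norm_le (Eventually.of_forall fun x => hBb x)
      (hb.intervalIntegrable _ _)

/-- For fixed s the window between R - s and R has constant length |s| while b tends to 0 on it; M
|s| ‖K s‖ dominates. -/
theorem tendsto_integral_kernel_mul_abs_integral {K : ℝ → ℂ} (hK : Integrable K)
    (hK1 : Integrable fun s => |s| * ‖K s‖) {b : ℝ → ℝ} (hb : Continuous b) (hb0 : ∀ x, 0 ≤ b x)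
    {M : ℝ} (hM : ∀ x, b x ≤ M) (hlim : Tendsto b atTop (𝓝 0)) :
    Tendsto (fun R : ℝ => ∫ s, ‖K s‖ * |∫ x in (R - s)..R, b x|) atTop (𝓝 0) := by
  have hi : ∀ u v, IntervalIntegrable b volume u v := fun u v => hb.intervalIntegrable u v
  have hz : ∫ _ : ℝ, (0 : ℝ) = 0 := by simp
  rw [← hz]
  have h3 : Continuous fun y : ℝ => ∫ x in (0 : ℝ)..y, b x :=
    intervalIntegral.continuous_primitive hi 0
  refine tendsto_integral_filter_of_dominated_convergence (fun s => M * (|s| * ‖K s‖))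
    (Eventually.of_forall fun R => ?_) (Eventually.of_forall fun R => Eventually.of_forall fun s => ?_)
    (hK1.const_mul M) (Eventually.of_forall fun s => ?_)
  · have h4 : (fun s : ℝ => ∫ x in (R - s)..R, b x) =
        fun s => (∫ x in (0 : ℝ)..R, b x) - ∫ x in (0 : ℝ)..(R - s), b x := by
      funext s
      rw [intervalIntegral.integral_interval_sub_left (hi _ _) (hi _ _)]
    refine hK.norm.1.mul (Continuous.aestronglyMeasurable ?_)
    refine Continuous.abs ?_
    rw [h4]; fun_prop
  · have := intervalIntegral.norm_integral_le_of_norm_le_const (a := R - s) (b := R) (f := b)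
      (C := M) (fun x _ => by rw [Real.norm_of_nonneg (hb0 x)]; exact hM x)
    rw [Real.norm_eq_abs, sub_sub_cancel] at this
    rw [norm_mul, norm_norm, Real.norm_eq_abs, abs_abs]
    calc _ ≤ ‖K s‖ * (M * |s|) := by gcongr
      _ = _ := by ring
  · rw [← mul_zero ‖K s‖]
    refine Tendsto.const_mul _ ?_
    rw [Metric.tendsto_atTop]
    intro ε hε
    have hε' : 0 < ε / (|s| + 1) := by positivity
    obtain ⟨N, hN⟩ := (Metric.tendsto_atTop.1 hlim) _ hε'
    -- From here on the whole window lies beyond N.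
    refine ⟨N + |s|, fun R hR => ?_⟩
    have := intervalIntegral.norm_integral_le_of_norm_le_const (a := R - s) (b := R) (f := b)
      (C := ε / (|s| + 1)) (fun x hx => by
        have h5 : N ≤ x := by
          rcases Set.mem_uIoc.1 hx with h | h
          · linarith [le_abs_self s, h.1]
          · linarith [abs_nonneg s, h.1]
        have := hN x h5
        rw [dist_zero_right] at this
        exact this.le)
    rw [sub_sub_cancel] at this
    rw [dist_zero_right, Real.norm_eq_abs, abs_abs]
    refine this.trans_lt ?_
    rw [div_mul_eq_mul_div, div_lt_iff₀ (by positivity)]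
    nlinarith

open FourierTransform in
/-- A Schwartz function of integral one whose Fourier transform vanishes outside a given
neighbourhood of the origin. -/
theorem exists_kernel {ε : ℝ} (hε : 0 < ε) : ∃ K : SchwartzMap ℝ ℂ, ∫ s, K s = 1 ∧
    ∀ (j : ℕ) (θ : ℝ), ε < |θ| →
      ∫ s : ℝ, K s * (s : ℂ) ^ j * Complex.exp (Complex.I * (-(s * θ) : ℝ)) = 0 := by
  have hε' : 0 < ε / (2 * Real.pi) := by positivity
  -- K is the inverse Fourier transform of a bump supported in [-ε/(2π), ε/(2π)], since the Fourier
  -- variable is θ/(2π). Its value 1 at the origin is the integral of K.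
  let f₀ : ContDiffBump (0 : ℝ) := ⟨ε / (2 * Real.pi) / 2, ε / (2 * Real.pi), by positivity,
    by linarith⟩
  have hc : HasCompactSupport (fun x => (f₀ x : ℂ)) :=
    f₀.hasCompactSupport.comp_left (g := fun y : ℝ => (y : ℂ)) Complex.ofReal_zero
  have hsm : ContDiff ℝ (⊤ : ℕ∞) (fun x => (f₀ x : ℂ)) :=
    Complex.ofRealCLM.contDiff.comp f₀.contDiff
  let f : SchwartzMap ℝ ℂ := hc.toSchwartzMap hsm
  have hf : ∀ x, f x = f₀ x := fun x => rfl
  let K : SchwartzMap ℝ ℂ := 𝓕⁻ f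
  have hFK : 𝓕 (K : ℝ → ℂ) = f := by
    rw [← SchwartzMap.fourier_coe]
    simp [K]
  have hval : ∀ w : ℝ, ∫ s : ℝ, Complex.exp (Complex.I * (-(s * (2 * Real.pi * w)) : ℝ)) * K s =
      f w := by
    intro w
    rw [← hFK, Real.fourier_eq']
    congr 1; funext s
    simp only [RCLike.inner_apply, conj_trivial, smul_eq_mul]
    congr 2; push_cast; ring
  refine ⟨K, ?_, fun j θ hθ => ?_⟩
  · have h := hval 0
    have h1 : f 0 = 1 := by rw [hf, f₀.one_of_mem_closedBall (by simp [f₀.rIn_pos.le])]; simp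
    rw [h1] at h
    simpa using h
  · have hpi := Real.pi_pos
    -- The integral with s^j is, up to a nonzero constant, the j-th derivative of the Fourier
    -- transform, which vanishes off the support.
    have hit := Real.iteratedDeriv_fourier (f := (K : ℝ → ℂ)) (N := ⊤) (n := j)
      (fun n _ => by
        have := K.integrable_pow_mul volume n
        refine (this.mono' ?_ ?_)
        · exact ((continuous_id.pow n).smul K.continuous).aestronglyMeasurable
        · exact Eventually.of_forall fun x => by rw [norm_smul, norm_pow]) le_top
    have h0 : iteratedDeriv j (𝓕 (K : ℝ → ℂ)) (θ / (2 * Real.pi)) = 0 := by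
      have : 𝓕 (K : ℝ → ℂ) =ᶠ[𝓝 (θ / (2 * Real.pi))] fun _ => 0 := by
        have hopen : IsOpen {x : ℝ | ε / (2 * Real.pi) < |x|} :=
          isOpen_lt continuous_const continuous_abs
        filter_upwards [hopen.mem_nhds (show ε / (2 * Real.pi) < |θ / (2 * Real.pi)| by
          rw [abs_div, abs_of_pos (by positivity : (0 : ℝ) < 2 * Real.pi)]
          gcongr)] with x hx
        rw [hFK, hf, f₀.zero_of_le_dist, Complex.ofReal_zero]
        rw [dist_zero_right]
        exact le_of_lt hx
      rw [this.iteratedDeriv_eq]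
      simp
    rw [hit, Real.fourier_eq'] at h0
    have hne : (-2 * Real.pi * Complex.I : ℂ) ^ j ≠ 0 := by
      refine pow_ne_zero _ ?_
      simp [hpi.ne']
    refine (mul_eq_zero.1 ?_).resolve_left hne
    rw [← h0, ← integral_const_mul]
    congr 1; funext s
    simp only [RCLike.inner_apply, conj_trivial, smul_eq_mul]
    rw [show (((-2 * Real.pi * (θ / (2 * Real.pi) * s) : ℝ) : ℂ) * Complex.I) =
      Complex.I * ((-(s * θ) : ℝ) : ℂ) by
        rw [mul_comm]; congr 2; field_simp]
    rw [mul_pow _ (s : ℂ) j]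
    ring

/-- Binomial expansion of (x - s)^m reduces the convolution with x^m exp(i θ x) to the vanishing
integrals with s^j. -/
theorem integral_kernel_mul_pow_eq_zero {K : SchwartzMap ℝ ℂ} {θ : ℝ}
    (hK : ∀ j : ℕ, ∫ s : ℝ, K s * (s : ℂ) ^ j * Complex.exp (Complex.I * (-(s * θ) : ℝ)) = 0)
    (m : ℕ) (x : ℝ) :
    ∫ s : ℝ, K s * ((x - s : ℝ) : ℂ) ^ m * Complex.exp (Complex.I * ((x - s) * θ : ℝ)) = 0 := by
  have hint : ∀ j : ℕ, Integrable fun s : ℝ =>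
      K s * (s : ℂ) ^ j * Complex.exp (Complex.I * (-(s * θ) : ℝ)) := by
    intro j
    have hKc := K.continuous
    refine (K.integrable_pow_mul volume j).mono'
      (Continuous.aestronglyMeasurable (by fun_prop)) (Eventually.of_forall fun s => ?_)
    rw [norm_mul, norm_mul, mul_comm Complex.I, Complex.norm_exp_ofReal_mul_I, mul_one, norm_pow,
      Complex.norm_real, mul_comm]
  have h1 : ∀ s : ℝ, K s * ((x - s : ℝ) : ℂ) ^ m * Complex.exp (Complex.I * ((x - s) * θ : ℝ)) =
      ∑ j ∈ Finset.range (m + 1), (Complex.exp (Complex.I * (x * θ : ℝ)) * (-1) ^ j *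
        (x : ℂ) ^ (m - j) * m.choose j) *
        (K s * (s : ℂ) ^ j * Complex.exp (Complex.I * (-(s * θ) : ℝ))) := by
    intro s
    have h2 : ((x - s : ℝ) : ℂ) ^ m = ∑ j ∈ Finset.range (m + 1),
        (-1) ^ j * (s : ℂ) ^ j * (x : ℂ) ^ (m - j) * m.choose j := by
      rw [show ((x - s : ℝ) : ℂ) = -(s : ℂ) + x by push_cast; ring, add_pow]
      refine Finset.sum_congr rfl fun j _ => ?_
      rw [neg_pow (s : ℂ)]
    have h3 : Complex.exp (Complex.I * ((x - s) * θ : ℝ)) =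
        Complex.exp (Complex.I * (x * θ : ℝ)) * Complex.exp (Complex.I * (-(s * θ) : ℝ)) := by
      rw [← Complex.exp_add]; congr 1; push_cast; ring
    rw [h2, h3, Finset.mul_sum, Finset.sum_mul]
    exact Finset.sum_congr rfl fun j _ => by ring
  simp only [h1]
  rw [integral_finsetSum _ fun j _ => (hint j).const_mul _]
  refine Finset.sum_eq_zero fun j _ => ?_
  rw [integral_const_mul, hK, mul_zero]

theorem continuous_integral_mul_exp {S : Type} [MeasurableSpace S] {μ : Measure S}
    [IsFiniteMeasure μ] {z : S → ℝ} (hz : Measurable z) {h : ℝ → ℝ} (hh : Continuous h)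
    (hb : ∀ y, |h y| ≤ 1) (T : ℝ) :
    Continuous fun ρ : ℝ => ∫ s, (h (z s) : ℂ) * Complex.exp (Complex.I * (T * ρ * z s : ℝ)) ∂μ := by
  refine continuous_of_dominated (bound := fun _ => (1 : ℝ)) (fun ρ => ?_)
    (fun ρ => Eventually.of_forall fun s => ?_) (integrable_const _)
    (Eventually.of_forall fun s => by fun_prop)
  · have := hh.measurable
    exact Measurable.aestronglyMeasurable (by fun_prop)
  · rw [norm_mul, mul_comm Complex.I, Complex.norm_exp_ofReal_mul_I, mul_one, Complex.norm_real]
    exact hb _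

/-- The frequencies of `ρ ^ (d - 1) * coordChar d (ρ r) * ∫ h(z) exp (i T ρ z)` stay away from the
origin if `h` vanishes near `[-r / T, r / T]`; hence convolution with a suitable kernel gives
zero. -/
theorem integral_kernel_mul_eq_zero {d : ℕ} (hd : 2 ≤ d) {S : Type} [MeasurableSpace S]
    {μ : Measure S} [IsFiniteMeasure μ] {z : S → ℝ} (hz : Measurable z) {h : ℝ → ℝ}
    (hh : Continuous h) (hb : ∀ y, |h y| ≤ 1) {T r ε : ℝ} (hT : 0 < T) (hr : 0 ≤ r)
    {K : SchwartzMap ℝ ℂ} (hK : ∀ (j : ℕ) (θ : ℝ), ε < |θ| →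
      ∫ s : ℝ, K s * (s : ℂ) ^ j * Complex.exp (Complex.I * (-(s * θ) : ℝ)) = 0)
    (h0 : ∀ y, h y ≠ 0 → r + ε < T * |y|) (x : ℝ) :
    ∫ y : ℝ, K y * (((x - y : ℝ) : ℂ) ^ (d - 1) * coordChar d ((x - y) * r) *
      ∫ s, (h (z s) : ℂ) * Complex.exp (Complex.I * (T * (x - y) * z s : ℝ)) ∂μ) = 0 := by
  obtain ⟨e, he⟩ := exists_unit hd
  have hprob := isProbabilityMeasure_uniformDirection (d := d) (by omega)
  have hKc := K.continuous
  -- Writing `coordChar` as an average over directions v superposes the integrand from polynomials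
  -- times exponentials of frequency r ⟨v, e⟩ + T z.
  have h1 : ∀ y : ℝ, K y * (((x - y : ℝ) : ℂ) ^ (d - 1) * coordChar d ((x - y) * r) *
      ∫ s, (h (z s) : ℂ) * Complex.exp (Complex.I * (T * (x - y) * z s : ℝ)) ∂μ) =
      ∫ p : Direction d × S, K y * ((x - y : ℝ) : ℂ) ^ (d - 1) * ((h (z p.2) : ℂ) *
        Complex.exp (Complex.I * ((x - y) * (r * inner ℝ (p.1 : Space d) e + T * z p.2) : ℝ)))
        ∂((uniformDirection d).prod μ) := by
    intro y
    rw [← integral_exp_inner_direction hd he, mul_assoc, ← integral_prod_mul, ← mul_assoc,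
      ← integral_const_mul]
    congr 1; funext p
    have : Complex.exp (Complex.I * ((x - y) * (r * inner ℝ (p.1 : Space d) e + T * z p.2) : ℝ)) =
        Complex.exp (Complex.I * ((x - y) * r * inner ℝ (p.1 : Space d) e : ℝ)) *
        Complex.exp (Complex.I * (T * (x - y) * z p.2 : ℝ)) := by
      rw [← Complex.exp_add]; congr 1; push_cast; ring
    rw [this]; ring
  simp only [h1]
  rw [integral_integral_swap]
  · have : ∀ p : Direction d × S, ∫ y : ℝ, K y * ((x - y : ℝ) : ℂ) ^ (d - 1) * ((h (z p.2) : ℂ) *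
        Complex.exp (Complex.I * ((x - y) * (r * inner ℝ (p.1 : Space d) e + T * z p.2) : ℝ))) =
        0 := by
      intro p
      by_cases hp : h (z p.2) = 0
      · simp [hp]
      · have h2 := h0 _ hp
        -- As |r ⟨v, e⟩| ≤ r and T |z| > r + ε on the support of h, the frequencies cannot cancel.
        have h3 : ε < |r * inner ℝ (p.1 : Space d) e + T * z p.2| := by
          have h4 : |r * inner ℝ (p.1 : Space d) e| ≤ r := by
            rw [abs_mul, abs_of_nonneg hr]
            exact mul_le_of_le_one_right hr (abs_inner_direction_le he _)
          have h5 : |T * z p.2| = T * |z p.2| := by rw [abs_mul, abs_of_pos hT]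
          have h6 := abs_sub_abs_le_abs_sub (T * z p.2) (-(r * inner ℝ (p.1 : Space d) e))
          rw [abs_neg, sub_neg_eq_add, add_comm (T * z p.2)] at h6
          linarith
        have h7 := integral_kernel_mul_pow_eq_zero (fun j => hK j _ h3) (d - 1) x
        have h8 : ∀ y : ℝ, K y * ((x - y : ℝ) : ℂ) ^ (d - 1) * ((h (z p.2) : ℂ) *
            Complex.exp (Complex.I *
              ((x - y) * (r * inner ℝ (p.1 : Space d) e + T * z p.2) : ℝ))) =
            (h (z p.2) : ℂ) * (K y * ((x - y : ℝ) : ℂ) ^ (d - 1) *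
            Complex.exp (Complex.I *
              ((x - y) * (r * inner ℝ (p.1 : Space d) e + T * z p.2) : ℝ))) := fun y => by ring
        simp only [h8]
        rw [integral_const_mul, h7, mul_zero]
    simp only [this, integral_zero]
  · have hKi : Integrable fun y : ℝ => K y * ((x - y : ℝ) : ℂ) ^ (d - 1) := by
      have hi := ((K.integrable_pow_mul volume 0).const_mul (2 ^ (d - 1) * |x| ^ (d - 1))).add
        ((K.integrable_pow_mul volume (d - 1)).const_mul (2 ^ (d - 1)))
      refine hi.mono' (Continuous.aestronglyMeasurable (by fun_prop))
        (Eventually.of_forall fun y => ?_)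
      rw [norm_mul, norm_pow, Complex.norm_real, Real.norm_eq_abs, Pi.add_apply]
      have h9 : |x - y| ^ (d - 1) ≤ 2 ^ (d - 1) * |x| ^ (d - 1) + 2 ^ (d - 1) * |y| ^ (d - 1) := by
        rcases le_total |x| |y| with hxy | hxy
        · have : |x - y| ≤ 2 * |y| := by linarith [abs_sub x y]
          have h10 := pow_le_pow_left₀ (abs_nonneg _) this (d - 1)
          rw [mul_pow] at h10
          have : 0 ≤ (2 : ℝ) ^ (d - 1) * |x| ^ (d - 1) := by positivity
          linarith
        · have : |x - y| ≤ 2 * |x| := by linarith [abs_sub x y]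
          have h10 := pow_le_pow_left₀ (abs_nonneg _) this (d - 1)
          rw [mul_pow] at h10
          have : 0 ≤ (2 : ℝ) ^ (d - 1) * |y| ^ (d - 1) := by positivity
          linarith
      have := mul_le_mul_of_nonneg_left h9 (norm_nonneg (K y))
      rw [Real.norm_eq_abs, pow_zero, one_mul]
      linarith
    have h2 : Integrable (fun p : ℝ × Direction d × S => K p.1 * ((x - p.1 : ℝ) : ℂ) ^ (d - 1))
        (volume.prod ((uniformDirection d).prod μ)) := hKi.comp_fst _
    have := hh.measurable
    refine h2.mul_bdd (c := 1) (g := fun p : ℝ × Direction d × S => (h (z p.2.2) : ℂ) *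
        Complex.exp (Complex.I * ((x - p.1) * (r * inner ℝ (p.2.1 : Space d) e + T * z p.2.2) : ℝ)))
      (Measurable.aestronglyMeasurable (by fun_prop)) (Eventually.of_forall fun p => ?_)
    rw [norm_mul, mul_comm Complex.I, Complex.norm_exp_ofReal_mul_I, mul_one, Complex.norm_real]
    exact hb _

/-! ### Convergence of the inversion integral. -/

/-- Convergence of the inversion integral, uniformly on compact sets of radii in `(0, T)`, for the
Fourier transform `F` of a conormal law scaled by `T`. -/
theorem exists_tendstoUniformlyOn_inversion {d : ℕ} (hd : 2 ≤ d) {S : Type} [MeasurableSpace S]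
    {μ : Measure S} {z : S → ℝ} (hz : IsConormal μ z) {T : ℝ} (hT : 0 < T) {C : ℝ} {F : ℝ → ℝ}
    (hF : ∀ ρ, (F ρ : ℂ) = C * ∫ s, Complex.exp (Complex.I * (T * ρ * z s : ℝ)) ∂μ)
    (hdecay : Tendsto (fun ρ : ℝ => ρ ^ (((d : ℝ) - 1) / 2) * |F ρ|) atTop (𝓝 0))
    {δ : ℝ} (hδ : 0 < δ) (hδT : δ < T) :
    ∃ L : ℝ → ℝ, TendstoUniformlyOn
      (fun R r => ∫ ρ in (0 : ℝ)..R, ρ ^ (d - 1) * (coordChar d (ρ * r) * F ρ)) L atTop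
      (Set.Icc δ (T - δ)) := by
  have := hz.isFinite
  have hmz := hz.measurable
  have hdR : (2 : ℝ) ≤ d := by exact_mod_cast hd
  set α : ℝ := ((d : ℝ) - 1) / 2 with hα
  have hα0 : 0 < α := by rw [hα]; linarith
  -- With this η one has T - δ = T (1 - 3 η). The cutoff is 1 up to 1 - 2 η, so frequencies outside
  -- it exceed r by more than T η, leaving room for the kernel width T η / 2.
  set η : ℝ := δ / (3 * T) with hη
  have hη0 : 0 < η := by positivity
  have hη1 : 3 * η < 1 := by
    rw [hη, mul_div_assoc', mul_div_mul_left _ _ (by norm_num : (3 : ℝ) ≠ 0), div_lt_one hT]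
    exact hδT
  have hTη : T * (3 * η) = δ := by rw [hη]; field_simp
  let χ : ContDiffBump (0 : ℝ) := ⟨1 - 2 * η, 1 - η, by linarith, by linarith⟩
  have hχc : Continuous χ := χ.continuous
  have hχ1 : ∀ y, |χ y| ≤ 1 := fun y => by rw [abs_of_nonneg χ.nonneg]; exact χ.le_one
  have hχ1' : ∀ y, |1 - χ y| ≤ 1 := fun y => by
    rw [abs_of_nonneg (sub_nonneg.2 χ.le_one)]; linarith [χ.nonneg (x := y)]
  set J₁ : ℝ → ℂ := fun ρ => ∫ s, (χ (z s) : ℂ) * Complex.exp (Complex.I * (T * ρ * z s : ℝ)) ∂μ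
  set J₂ : ℝ → ℂ := fun ρ =>
    ∫ s, ((1 - χ (z s) : ℝ) : ℂ) * Complex.exp (Complex.I * (T * ρ * z s : ℝ)) ∂μ
  have hJ₁c : Continuous J₁ := continuous_integral_mul_exp hmz hχc hχ1 T
  have hJ₂c : Continuous J₂ :=
    continuous_integral_mul_exp hmz (h := fun y => 1 - χ y) (by fun_prop) hχ1' T
  set A₁ : ℝ → ℂ := fun ρ => C * J₁ ρ with hA₁
  set A₂ : ℝ → ℂ := fun ρ => C * J₂ ρ with hA₂
  have hA₁c : Continuous A₁ := by fun_prop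
  have hA₂c : Continuous A₂ := by fun_prop
  have hFA : ∀ ρ, (F ρ : ℂ) = A₁ ρ + A₂ ρ := by
    intro ρ
    have hi : ∀ h : ℝ → ℝ, Continuous h → (∀ y, |h y| ≤ 1) → Integrable (fun s =>
        (h (z s) : ℂ) * Complex.exp (Complex.I * (T * ρ * z s : ℝ))) μ := by
      intro h hh hb
      have := hh.measurable
      refine Integrable.of_bound (Measurable.aestronglyMeasurable (by fun_prop)) 1
        (Eventually.of_forall fun s => ?_)
      rw [norm_mul, mul_comm Complex.I, Complex.norm_exp_ofReal_mul_I, mul_one, Complex.norm_real]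
      exact hb _
    rw [hF, hA₁, hA₂]
    simp only
    rw [← mul_add, ← integral_add (hi _ hχc hχ1) (hi (fun y => 1 - χ y) (by fun_prop) hχ1')]
    congr 2; funext s
    push_cast; ring
  -- rapid decay of `A₁`
  have hrapid : ∀ N : ℕ, ∃ D : ℝ, 0 ≤ D ∧ ∀ ρ, |ρ| ^ N * ‖A₁ ρ‖ ≤ D := by
    intro N
    obtain ⟨D, hD⟩ := hz.exists_pow_mul_norm_integral_le hη0 (χ := fun y => (χ y : ℂ))
      (Complex.ofRealCLM.contDiff.comp χ.contDiff) (fun y hy => by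
        rw [χ.zero_of_le_dist, Complex.ofReal_zero]
        rw [dist_zero_right]; exact le_of_lt hy) N
    have hD' : ∀ ρ, |ρ| ^ N * ‖A₁ ρ‖ ≤ |C| / T ^ N * D := by
      intro ρ
      have h1 := hD (T * ρ)
      rw [abs_mul, abs_of_pos hT, mul_pow] at h1
      simp only [hA₁]
      rw [norm_mul, Complex.norm_real, Real.norm_eq_abs]
      calc |ρ| ^ N * (|C| * ‖J₁ ρ‖) = |C| / T ^ N * (T ^ N * |ρ| ^ N * ‖J₁ ρ‖) := by
            field_simp
        _ ≤ _ := by gcongr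
    refine ⟨_, ?_, hD'⟩
    exact (by positivity : 0 ≤ |(0 : ℝ)| ^ N * ‖A₁ 0‖).trans (hD' 0)
  -- the part away from the end points
  set g : ℝ → ℝ := fun ρ => |ρ| ^ (d - 1) * ‖A₁ ρ‖ with hg
  have hgc : Continuous g := by fun_prop
  have hgi : Integrable g := by
    obtain ⟨D, hD0, hD⟩ := hrapid (d - 1)
    obtain ⟨D', hD0', hD'⟩ := hrapid (d - 1 + 2)
    refine (integrable_inv_one_add_sq.const_mul (D + D')).mono' hgc.aestronglyMeasurable
      (Eventually.of_forall fun ρ => ?_)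
    rw [Real.norm_of_nonneg (by positivity), ← div_eq_mul_inv, le_div_iff₀ (by positivity)]
    have h1 := hD ρ
    have h2 := hD' ρ
    rw [pow_add, sq_abs] at h2
    simp only [hg]
    nlinarith
  set B₁ : ℝ → ℝ → ℂ := fun r ρ => (ρ : ℂ) ^ (d - 1) * coordChar d (ρ * r) * A₁ ρ with hB₁
  set B₂ : ℝ → ℝ → ℂ := fun r ρ => (ρ : ℂ) ^ (d - 1) * coordChar d (ρ * r) * A₂ ρ with hB₂
  have hκc := continuous_coordChar hd
  have hB₁c : ∀ r, Continuous (B₁ r) := fun r => by fun_prop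
  have hB₂c : ∀ r, Continuous (B₂ r) := fun r => by fun_prop
  have hB₁g : ∀ r ρ, ‖B₁ r ρ‖ ≤ g ρ := by
    intro r ρ
    simp only [hB₁, hg]
    rw [norm_mul, norm_mul, norm_pow, Complex.norm_real, Complex.norm_real, Real.norm_eq_abs,
      Real.norm_eq_abs]
    gcongr
    exact mul_le_of_le_one_right (by positivity) (abs_coordChar_le_one hd _)
  have hB₁i : ∀ r, Integrable (B₁ r) := fun r =>
    hgi.mono' (hB₁c r).aestronglyMeasurable (Eventually.of_forall (hB₁g r))
  have hlim₁ : Tendsto (fun R : ℝ => ∫ ρ in Set.Ioi R, g ρ) atTop (𝓝 0) := by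
    have h1 := intervalIntegral_tendsto_integral_Ioi 0 hgi.integrableOn tendsto_id
    have h2 : ∀ R : ℝ, ∫ ρ in Set.Ioi R, g ρ =
        (∫ ρ in Set.Ioi 0, g ρ) - ∫ ρ in (0 : ℝ)..R, g ρ := fun R => by
      rw [← intervalIntegral.integral_interval_add_Ioi (a := 0) (b := R) hgi.integrableOn
        hgi.integrableOn, add_sub_cancel_left]
    rw [funext h2]
    simpa using h1.const_sub (∫ ρ in Set.Ioi 0, g ρ)
  have herr₁ : ∀ r R, ‖(∫ ρ in (0 : ℝ)..R, B₁ r ρ) - ∫ ρ in Set.Ioi 0, B₁ r ρ‖ ≤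
      ∫ ρ in Set.Ioi R, g ρ := by
    intro r R
    rw [← intervalIntegral.integral_interval_add_Ioi (a := 0) (b := R) (hB₁i r).integrableOn
      (hB₁i r).integrableOn, sub_add_cancel_left, norm_neg]
    exact norm_integral_le_of_norm_le hgi.integrableOn (Eventually.of_forall (hB₁g r))
  -- the part near the end points
  obtain ⟨Cκ, hCκ0, hCκ⟩ := exists_abs_coordChar_le hd
  -- Of ρ^(d-1) = ρ^(2α), one factor ρ^α is absorbed by the decay of `coordChar`, uniformly for r ≥
  -- δ; the other is left for `A₂`.
  set b : ℝ → ℝ := fun ρ => Cκ / δ ^ α * (|ρ| ^ α * ‖A₂ ρ‖) with hb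
  have hbc : Continuous b := by
    have : Continuous fun ρ : ℝ => |ρ| ^ α :=
      (Real.continuous_rpow_const hα0.le).comp continuous_abs
    fun_prop
  have hb0 : ∀ ρ, 0 ≤ b ρ := fun ρ => by positivity
  have hB₂b : ∀ r ∈ Set.Icc δ (T - δ), ∀ ρ, ‖B₂ r ρ‖ ≤ b ρ := by
    intro r hr ρ
    have hr0 : 0 < r := hδ.trans_le hr.1
    simp only [hB₂, hb]
    rw [norm_mul, norm_mul, norm_pow, Complex.norm_real, Complex.norm_real, Real.norm_eq_abs,
      Real.norm_eq_abs, ← mul_assoc]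
    refine mul_le_mul_of_nonneg_right ?_ (norm_nonneg _)
    rcases eq_or_ne ρ 0 with rfl | hρ
    · rw [abs_zero, zero_pow (by omega), zero_mul]; positivity
    · have hρ0 : 0 < |ρ| := abs_pos.2 hρ
      have h1 := hCκ (|ρ| * r) (by positivity)
      have h2 : |coordChar d (|ρ| * r)| = |coordChar d (ρ * r)| := by
        rcases abs_choice ρ with h | h
        · rw [h]
        · rw [h, neg_mul, coordChar_neg]
      rw [h2, Real.mul_rpow hρ0.le hr0.le] at h1
      have h3 : δ ^ α ≤ r ^ α := Real.rpow_le_rpow hδ.le hr.1 hα0.le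
      have h4 : |ρ| ^ (d - 1) = |ρ| ^ α * |ρ| ^ α := by
        rw [← Real.rpow_add hρ0, ← Real.rpow_natCast, Nat.cast_sub (by omega), hα]
        congr 1; push_cast; ring
      have h5 : 0 < δ ^ α := Real.rpow_pos_of_pos hδ _
      have h6 : |ρ| ^ α * |coordChar d (ρ * r)| ≤ Cκ / δ ^ α := by
        rw [le_div_iff₀ h5]
        refine le_trans ?_ h1
        calc |ρ| ^ α * |coordChar d (ρ * r)| * δ ^ α
            ≤ |ρ| ^ α * |coordChar d (ρ * r)| * r ^ α := by gcongr
          _ = _ := by ring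
      rw [h4]
      calc |ρ| ^ α * |ρ| ^ α * |coordChar d (ρ * r)|
          = |ρ| ^ α * |coordChar d (ρ * r)| * |ρ| ^ α := by ring
        _ ≤ _ := by gcongr
  -- `A₂` is F minus a rapidly decreasing function, so it inherits the decay of F.
  have hblim : Tendsto b atTop (𝓝 0) := by
    obtain ⟨D, hD0, hD⟩ := hrapid (d - 1 + 1)
    have h1 : Tendsto (fun ρ : ℝ => ρ ^ α * |F ρ| + D / ρ) atTop (𝓝 0) := by
      simpa using hdecay.add (tendsto_const_nhds.div_atTop tendsto_id)
    have h2 : Tendsto (fun ρ : ℝ => |ρ| ^ α * ‖A₂ ρ‖) atTop (𝓝 0) := by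
      refine squeeze_zero' (Eventually.of_forall fun ρ => by positivity) ?_ h1
      filter_upwards [eventually_ge_atTop 1] with ρ hρ
      have hρ0 : 0 < ρ := one_pos.trans_le hρ
      have h3 : A₂ ρ = F ρ - A₁ ρ := by rw [hFA]; ring
      have h4 : ‖A₂ ρ‖ ≤ |F ρ| + ‖A₁ ρ‖ := by
        rw [h3]; refine (norm_sub_le _ _).trans ?_
        rw [Complex.norm_real, Real.norm_eq_abs]
      have h5 : ρ ^ α * ‖A₁ ρ‖ ≤ D / ρ := by
        rw [le_div_iff₀ hρ0]
        refine le_trans ?_ (hD ρ)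
        rw [abs_of_pos hρ0, pow_succ]
        have h6 : ρ ^ α ≤ ρ ^ (d - 1) := by
          rw [← Real.rpow_natCast, Nat.cast_sub (by omega)]
          refine Real.rpow_le_rpow_of_exponent_le hρ ?_
          rw [hα]; push_cast; linarith
        nlinarith [mul_le_mul_of_nonneg_right h6 (mul_nonneg (norm_nonneg (A₁ ρ)) hρ0.le)]
      rw [abs_of_pos hρ0]
      calc ρ ^ α * ‖A₂ ρ‖ ≤ ρ ^ α * (|F ρ| + ‖A₁ ρ‖) := by gcongr
        _ ≤ _ := by rw [mul_add]; gcongr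
    simpa using h2.const_mul (Cκ / δ ^ α)
  -- The decay is known at +∞ only; evenness extends it to a global bound on b.
  have hbeven : ∀ ρ, b (-ρ) = b ρ := by
    intro ρ
    have h1 : J₂ (-ρ) = starRingEnd ℂ (J₂ ρ) := by
      simp only [J₂]
      rw [← integral_conj]
      congr 1; funext s
      rw [map_mul, Complex.conj_ofReal, ← Complex.exp_conj, map_mul, Complex.conj_I,
        Complex.conj_ofReal]
      congr 2; push_cast; ring
    simp only [hb, hA₂]
    rw [abs_neg, norm_mul, norm_mul, h1, RCLike.norm_conj]
  obtain ⟨M, hM⟩ : ∃ M, ∀ ρ, b ρ ≤ M := by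
    obtain ⟨N, hN⟩ := (hblim.eventually_le_const one_pos).exists_forall_of_atTop
    obtain ⟨D, hD⟩ := (isCompact_Icc (a := -|N|) (b := |N|)).exists_bound_of_continuousOn
      hbc.continuousOn
    refine ⟨1 + |D|, fun ρ => ?_⟩
    rcases le_total |ρ| |N| with h | h
    · have := hD ρ (abs_le.1 h)
      rw [Real.norm_of_nonneg (hb0 ρ)] at this
      linarith [le_abs_self D]
    · have h1 : b |ρ| ≤ 1 := hN _ ((le_abs_self N).trans h)
      have h2 : b |ρ| = b ρ := by
        rcases abs_choice ρ with h | h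
        · rw [h]
        · rw [h, hbeven]
      linarith [abs_nonneg D]
  obtain ⟨K, hK1, hK0⟩ := exists_kernel (ε := T * η / 2) (by positivity)
  have hKi : Integrable K := K.integrable
  have hKi1 : Integrable fun s => |s| * ‖K s‖ := by
    simpa using K.integrable_pow_mul volume 1
  have hconv : ∀ r ∈ Set.Icc δ (T - δ), ∀ x, ∫ s, K s * B₂ r (x - s) = 0 := by
    intro r hr x
    have h1 := integral_kernel_mul_eq_zero hd (μ := μ) hmz (h := fun y => 1 - χ y) (by fun_prop)
      hχ1' hT (hδ.le.trans hr.1) hK0 (fun y hy => by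
        have h2 : 1 - 2 * η < |y| := by
          by_contra! h
          refine hy ?_
          rw [χ.one_of_mem_closedBall, sub_self]
          rw [Metric.mem_closedBall, dist_zero_right]
          exact h
        nlinarith [hr.2]) x
    have h2 : ∀ s, K s * B₂ r (x - s) = C * (K s * (((x - s : ℝ) : ℂ) ^ (d - 1) *
        coordChar d ((x - s) * r) * J₂ (x - s))) := fun s => by
      simp only [hB₂, hA₂]; ring
    simp only [h2]
    rw [integral_const_mul]
    simp only [J₂]
    rw [h1, mul_zero]
  set L₂ : ℝ → ℂ := fun r => ∫ s, K s * ∫ x in (0 : ℝ)..(-s), B₂ r x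
  have hlim₂ := tendsto_integral_kernel_mul_abs_integral hKi hKi1 hbc hb0 hM hblim
  have herr₂ : ∀ r ∈ Set.Icc δ (T - δ), ∀ R, 0 ≤ R → ‖(∫ ρ in (0 : ℝ)..R, B₂ r ρ) - L₂ r‖ ≤
      ∫ s, ‖K s‖ * |∫ x in (R - s)..R, b x| := fun r hr R hR =>
    norm_integral_sub_le_of_conv_eq_zero hKi hKi1 hK1 hbc hM (hB₂c r) (hB₂b r hr) (hconv r hr) R hR
  refine ⟨fun r => ((∫ ρ in Set.Ioi 0, B₁ r ρ) + L₂ r).re, ?_⟩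
  rw [Metric.tendstoUniformlyOn_iff]
  intro ε hε
  have hlim := hlim₁.add hlim₂
  rw [add_zero] at hlim
  filter_upwards [hlim.eventually_lt_const hε, eventually_ge_atTop 0] with R hR hR0 r hr
  have h1 : ((∫ ρ in (0 : ℝ)..R, ρ ^ (d - 1) * (coordChar d (ρ * r) * F ρ) : ℝ) : ℂ) =
      (∫ ρ in (0 : ℝ)..R, B₁ r ρ) + ∫ ρ in (0 : ℝ)..R, B₂ r ρ := by
    rw [← intervalIntegral.integral_ofReal, ← intervalIntegral.integral_add
      ((hB₁c r).intervalIntegrable _ _) ((hB₂c r).intervalIntegrable _ _)]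
    congr 1; funext ρ
    simp only [hB₁, hB₂]
    push_cast
    rw [hFA]; ring
  have h2 : ∫ ρ in (0 : ℝ)..R, ρ ^ (d - 1) * (coordChar d (ρ * r) * F ρ) =
      ((∫ ρ in (0 : ℝ)..R, B₁ r ρ) + ∫ ρ in (0 : ℝ)..R, B₂ r ρ).re := by
    rw [← h1, Complex.ofReal_re]
  rw [dist_comm, Real.dist_eq, h2, ← Complex.sub_re]
  refine (Complex.abs_re_le_norm _).trans_lt (lt_of_le_of_lt ?_ hR)
  rw [add_sub_add_comm]
  exact (norm_add_le _ _).trans (add_le_add (herr₁ r R) (herr₂ r hr R hR0))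

/-! ### Decay of the characteristic function of the flight. -/

theorem sum_durations {n : ℕ} (t : ℝ) (τ : Fin n → ℝ) : ∑ k, durations t τ k = t := by
  rw [Fin.sum_univ_castSucc]
  simp [durations]

theorem durations_pos {n : ℕ} {t : ℝ} (ht : 0 < t) {τ : Fin n → ℝ} (h : τ ∈ simplex n t)
    (k : Fin (n + 1)) : 0 < durations t τ k := by
  refine Fin.lastCases ?_ (fun k => ?_) k
  · simp only [durations, Fin.snoc_last]
    rcases n with _ | n
    · simpa using ht
    · have h1 := rest_pos_of_mem_simplex h (Fin.last n)
      rwa [show Finset.Iic (Fin.last n) = Finset.univ from by ext; simp [Fin.le_last]] at h1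
  · simp only [durations, Fin.snoc_castSucc]
    exact (h k).1

theorem ae_mem_simplex_gdWeight {n : ℕ} (a b : Fin n → ℝ) (t : ℝ) :
    ∀ᵐ τ ∂gdWeight a b t, τ ∈ simplex n t :=
  (withDensity_absolutelyContinuous _ _).ae_le (ae_restrict_mem (measurableSet_simplex n t))

/-- The Fourier transform of the flight with a generalized Dirichlet law of the durations decays
faster than that of a uniform direction. -/
theorem tendsto_pow_mul_integral_stepsChar {d : ℕ} (hd : 2 ≤ d) {n : ℕ} (hn : 1 ≤ n)
    (a b : Fin n → ℝ) {c t : ℝ} (hc : 0 < c) (ht : 0 < t) [IsFiniteMeasure (gdWeight a b t)] :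
    Tendsto (fun ρ : ℝ => ρ ^ (((d : ℝ) - 1) / 2) *
      |∫ τ, stepsChar d t τ (c * ρ) ∂gdWeight a b t|) atTop (𝓝 0) := by
  obtain ⟨C, hC0, hC⟩ := exists_abs_coordChar_le hd
  have hdR : (2 : ℝ) ≤ d := by exact_mod_cast hd
  set α : ℝ := ((d : ℝ) - 1) / 2 with hα
  have hα0 : 0 < α := by rw [hα]; linarith
  -- each factor is `O(ρ ^ (-α))`
  have hfac : ∀ {u ρ : ℝ}, 0 < u → 0 < ρ →
      ρ ^ α * |coordChar d (u * (c * ρ))| ≤ C * (u * c) ^ (-α) := by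
    intro u ρ hu hρ
    have h1 := hC (u * (c * ρ)) (by positivity)
    rw [← mul_assoc, Real.mul_rpow (by positivity) hρ.le] at h1
    rw [Real.rpow_neg (by positivity), ← div_eq_mul_inv, le_div_iff₀ (by positivity)]
    rw [← mul_assoc]
    linarith
  have hlim : Tendsto (fun ρ : ℝ => ∫ τ, ρ ^ α * |stepsChar d t τ (c * ρ)| ∂gdWeight a b t)
      atTop (𝓝 0) := by
    rw [show (0 : ℝ) = ∫ _, 0 ∂gdWeight a b t by simp]
    refine tendsto_integral_filter_of_dominated_convergence
      (fun _ => C * (t / (n + 1) * c) ^ (-α)) ?_ ?_ (integrable_const _) ?_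
    · exact Eventually.of_forall fun ρ =>
        ((measurable_stepsChar hd t (c * ρ)).abs.const_mul _).aestronglyMeasurable
    · filter_upwards [eventually_gt_atTop 0] with ρ hρ
      filter_upwards [ae_mem_simplex_gdWeight a b t] with τ hτ
      -- The n + 1 durations add up to t, so one of them is at least t / (n + 1); its factor alone
      -- gives a bound independent of τ.
      obtain ⟨k, -, hk⟩ : ∃ k ∈ Finset.univ, t / (n + 1) ≤ durations t τ k := by
        refine Finset.exists_le_of_sum_le Finset.univ_nonempty ?_
        rw [sum_durations, Finset.sum_const, Finset.card_univ, Fintype.card_fin, nsmul_eq_mul]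
        push_cast
        rw [mul_div_cancel₀ _ (by positivity)]
      have hk0 := durations_pos ht hτ k
      rw [Real.norm_of_nonneg (by positivity)]
      have h1 : |stepsChar d t τ (c * ρ)| ≤ |coordChar d (durations t τ k * (c * ρ))| := by
        rw [stepsChar, Finset.abs_prod, ← Finset.mul_prod_erase _ _ (Finset.mem_univ k)]
        exact mul_le_of_le_one_right (abs_nonneg _)
          (Finset.prod_le_one (fun _ _ => abs_nonneg _) fun _ _ => abs_coordChar_le_one hd _)
      calc ρ ^ α * |stepsChar d t τ (c * ρ)|
          ≤ ρ ^ α * |coordChar d (durations t τ k * (c * ρ))| := by gcongr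
        _ ≤ C * (durations t τ k * c) ^ (-α) := hfac hk0 hρ
        _ ≤ _ := by
          refine mul_le_mul_of_nonneg_left ?_ hC0.le
          exact Real.rpow_le_rpow_of_nonpos (by positivity) (by gcongr) (by linarith)
    · filter_upwards [ae_mem_simplex_gdWeight a b t] with τ hτ
      -- As n ≥ 1 there are two distinct steps. Two factors O(ρ^(-α)) beat the single weight ρ^α,
      -- though not uniformly in τ.
      have h0 : (0 : Fin (n + 1)) ≠ Fin.last n := by
        intro h; have := congrArg Fin.val h; simp at this; omega
      have hu := durations_pos ht hτ 0
      have hv := durations_pos ht hτ (Fin.last n)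
      set u := durations t τ 0 with hu'
      set v := durations t τ (Fin.last n) with hv'
      have h1 : ∀ ρ : ℝ, |stepsChar d t τ (c * ρ)| ≤
          |coordChar d (u * (c * ρ))| * |coordChar d (v * (c * ρ))| := by
        intro ρ
        rw [stepsChar, Finset.abs_prod, ← Finset.mul_prod_erase _ _ (Finset.mem_univ 0),
          ← Finset.mul_prod_erase _ _ (Finset.mem_erase.2 ⟨h0.symm, Finset.mem_univ _⟩),
          ← mul_assoc]
        exact mul_le_of_le_one_right (by positivity)
          (Finset.prod_le_one (fun _ _ => abs_nonneg _) fun _ _ => abs_coordChar_le_one hd _)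
      have h2 : Tendsto (fun ρ : ℝ => C * (u * c) ^ (-α) * (C * (v * c) ^ (-α)) * ρ ^ (-α)) atTop
          (𝓝 0) := by
        simpa using (tendsto_rpow_neg_atTop hα0).const_mul _
      refine squeeze_zero' (by
        filter_upwards [eventually_ge_atTop 0] with ρ hρ using by positivity) ?_ h2
      filter_upwards [eventually_gt_atTop 0] with ρ hρ
      have h3 := hfac hu hρ
      have h4 := hfac hv hρ
      have h5 : 0 < ρ ^ α := by positivity
      rw [Real.rpow_neg hρ.le, ← div_eq_mul_inv, le_div_iff₀ h5]
      calc ρ ^ α * |stepsChar d t τ (c * ρ)| * ρ ^ α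
          ≤ ρ ^ α * (|coordChar d (u * (c * ρ))| * |coordChar d (v * (c * ρ))|) * ρ ^ α := by
            gcongr; exact h1 ρ
        _ = (ρ ^ α * |coordChar d (u * (c * ρ))|) * (ρ ^ α * |coordChar d (v * (c * ρ))|) := by
            ring
        _ ≤ _ := by gcongr
  refine squeeze_zero' (by
    filter_upwards [eventually_ge_atTop 0] with ρ hρ using by positivity) ?_ hlim
  filter_upwards [eventually_gt_atTop 0] with ρ hρ
  rw [integral_const_mul]
  gcongr
  exact abs_integral_le_integral_abs

/-- The Fourier transform of the flight is continuous. -/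
theorem continuous_integral_stepsChar {d : ℕ} (hd : 2 ≤ d) {n : ℕ} (a b : Fin n → ℝ) (t : ℝ)
    [IsFiniteMeasure (gdWeight a b t)] :
    Continuous fun s : ℝ => ∫ τ, stepsChar d t τ s ∂gdWeight a b t := by
  refine continuous_of_dominated (bound := fun _ => 1) (fun s =>
    (measurable_stepsChar hd t s).aestronglyMeasurable) (fun s => Eventually.of_forall fun τ => ?_)
    (integrable_const _) (Eventually.of_forall fun τ => ?_)
  · exact abs_stepsChar_le_one hd t τ s
  · have := continuous_coordChar hd
    unfold stepsChar
    fun_prop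

/-! ### Fourier inversion in polar coordinates, in weak form. -/

/-- The Fourier inversion integral of a radial function, truncated at frequency `R`, up to the
constant `invConst d`. -/
def invPart (d : ℕ) (F : ℝ → ℝ) (R r : ℝ) : ℝ :=
  ∫ ρ in (0 : ℝ)..R, ρ ^ (d - 1) * (coordChar d (ρ * r) * F ρ)

/-- The constant of Fourier inversion in polar coordinates. -/
def invConst (d : ℕ) : ℝ :=
  ((2 * Real.pi) ^ d)⁻¹ * (volume : Measure (Space d)).toSphere.real Set.univ

theorem integral_exp_inner_uniformDirection {d : ℕ} (hd : 2 ≤ d) (x : Space d) :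
    ∫ v, Complex.exp ((inner ℝ (v : Space d) x : ℝ) * Complex.I) ∂uniformDirection d =
      coordChar d ‖x‖ := by
  rcases eq_or_ne x 0 with rfl | hx
  · have := isProbabilityMeasure_uniformDirection (d := d) (by omega)
    simp [coordChar_zero hd]
  · have hx0 : 0 < ‖x‖ := norm_pos_iff.2 hx
    rw [← integral_exp_inner_direction hd (e := ‖x‖⁻¹ • x) (by
      rw [norm_smul, norm_inv, norm_norm, inv_mul_cancel₀ hx0.ne'])]
    congr 1; funext v
    rw [inner_smul_right, mul_inv_cancel_left₀ hx0.ne', mul_comm]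

theorem continuous_invPart {d : ℕ} (hd : 2 ≤ d) {F : ℝ → ℝ} (hF : Continuous F) (R : ℝ) :
    Continuous (invPart d F R) := by
  have := continuous_coordChar hd
  refine intervalIntegral.continuous_parametric_intervalIntegral_of_continuous' ?_ _ _
  simp only [Function.uncurry_def]
  fun_prop

theorem integrable_indicator_ball_radial {d : ℕ} {F : ℝ → ℝ} (hF : Continuous F) (R : ℝ) :
    Integrable ((Metric.ball (0 : Space d) R).indicator
      fun ξ => (F (2 * Real.pi * ‖ξ‖) : ℂ)) := by
  rw [integrable_indicator_iff measurableSet_ball]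
  have hc : Continuous fun ξ : Space d => (F (2 * Real.pi * ‖ξ‖) : ℂ) := by fun_prop
  exact (hc.continuousOn.integrableOn_compact (isCompact_closedBall 0 R)).mono_set
    Metric.ball_subset_closedBall

open FourierTransform in
-- On each sphere the exponential averages to `coordChar`; the substitution ρ = 2π r accounts for
-- the power of 2π in `invConst`.
theorem fourier_indicator_ball_radial {d : ℕ} (hd : 2 ≤ d) {F : ℝ → ℝ} (hF : Continuous F)
    {R : ℝ} (hR : 0 ≤ R) (x : Space d) :
    𝓕 ((Metric.ball (0 : Space d) R).indicator fun ξ => (F (2 * Real.pi * ‖ξ‖) : ℂ)) x =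
      (invConst d * invPart d F (2 * Real.pi * R) ‖x‖ : ℝ) := by
  have hpi := Real.pi_pos
  set G := (Metric.ball (0 : Space d) R).indicator fun ξ => (F (2 * Real.pi * ‖ξ‖) : ℂ) with hG
  have hGi : Integrable G := integrable_indicator_ball_radial hF R
  have hexp : Continuous fun ξ : Space d =>
      Complex.exp (↑(-2 * Real.pi * inner ℝ ξ x) * Complex.I) := by fun_prop
  have hint : Integrable fun ξ : Space d =>
      Complex.exp (↑(-2 * Real.pi * inner ℝ ξ x) * Complex.I) * G ξ :=
    hGi.bdd_mul (c := 1) hexp.aestronglyMeasurable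
      (Eventually.of_forall fun ξ => (Complex.norm_exp_ofReal_mul_I _).le)
  rw [Real.fourier_eq']
  simp only [smul_eq_mul]
  rw [integral_polar (by omega) hint]
  have hS := toSphere_eq_smul_uniformDirection (d := d) (by omega)
  set σ := (volume : Measure (Space d)).toSphere.real Set.univ with hσ
  have hinner : ∀ r ∈ Set.Ioi (0 : ℝ), (r ^ (d - 1) : ℝ) • ∫ v : Direction d,
      Complex.exp (↑(-2 * Real.pi * inner ℝ (r • (v : Space d)) x) * Complex.I) *
        G (r • (v : Space d)) ∂(volume : Measure (Space d)).toSphere =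
      (Set.Iio R).indicator (fun r => ((σ * (r ^ (d - 1) *
        (coordChar d (2 * Real.pi * r * ‖x‖) * F (2 * Real.pi * r))) : ℝ) : ℂ)) r := by
    intro r hr
    have hr0 : 0 < r := hr
    have hnorm : ∀ v : Direction d, ‖r • (v : Space d)‖ = r := fun v => by
      rw [norm_smul, norm_eq_of_mem_sphere, mul_one, Real.norm_of_nonneg hr0.le]
    by_cases hrR : r < R
    · rw [Set.indicator_of_mem (show r ∈ Set.Iio R from hrR)]
      have h1 : ∀ v : Direction d, Complex.exp (↑(-2 * Real.pi * inner ℝ (r • (v : Space d)) x) *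
          Complex.I) * G (r • (v : Space d)) =
          Complex.exp ((inner ℝ (v : Space d) ((-2 * Real.pi * r) • x) : ℝ) * Complex.I) *
            F (2 * Real.pi * r) := by
        intro v
        rw [hG, Set.indicator_of_mem (by rw [mem_ball_zero_iff, hnorm]; exact hrR), hnorm,
          inner_smul_left, inner_smul_right]
        simp [mul_assoc]
      simp only [h1]
      rw [integral_mul_const]
      have h2 : ∫ v : Direction d, Complex.exp ((inner ℝ (v : Space d) ((-2 * Real.pi * r) • x) : ℝ)
          * Complex.I) ∂(volume : Measure (Space d)).toSphere =
          σ * coordChar d (2 * Real.pi * r * ‖x‖) := by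
        rw [hS, integral_smul_measure, integral_exp_inner_uniformDirection hd, norm_smul, ← measureReal_def, ← hσ,
          Real.norm_eq_abs, show -2 * Real.pi * r = -(2 * Real.pi * r) by ring, abs_neg,
          abs_of_pos (by positivity)]
        simp
      rw [h2, Complex.real_smul]
      push_cast; ring
    · rw [Set.indicator_of_notMem (show r ∉ Set.Iio R from hrR)]
      have h1 : ∀ v : Direction d, G (r • (v : Space d)) = 0 := fun v => by
        rw [hG, Set.indicator_of_notMem (by rw [mem_ball_zero_iff, hnorm]; exact hrR)]
      simp [h1]
  rw [setIntegral_congr_fun measurableSet_Ioi hinner, setIntegral_indicator measurableSet_Iio,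
    Set.Ioi_inter_Iio, integral_complex_ofReal, integral_const_mul]
  rw [← integral_Ioc_eq_integral_Ioo, ← intervalIntegral.integral_of_le hR]
  have h3 := intervalIntegral.integral_comp_mul_left (a := 0) (b := R)
    (fun ρ => ρ ^ (d - 1) * (coordChar d (ρ * ‖x‖) * F ρ))
    (c := 2 * Real.pi) (by positivity)
  rw [mul_zero] at h3
  have h4 : ∫ r in (0 : ℝ)..R, r ^ (d - 1) *
      (coordChar d (2 * Real.pi * r * ‖x‖) * F (2 * Real.pi * r)) =
      ((2 * Real.pi) ^ (d - 1))⁻¹ * ∫ r in (0 : ℝ)..R, (2 * Real.pi * r) ^ (d - 1) *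
      (coordChar d (2 * Real.pi * r * ‖x‖) * F (2 * Real.pi * r)) := by
    rw [← intervalIntegral.integral_const_mul]
    congr 1; funext r
    rw [mul_pow (2 * Real.pi) r, mul_assoc ((2 * Real.pi) ^ (d - 1)),
      inv_mul_cancel_left₀ (by positivity)]
  rw [h4, h3, invConst, invPart, ← hσ, smul_eq_mul]
  congr 1
  have h5 : (2 * Real.pi) ^ d = (2 * Real.pi) ^ (d - 1) * (2 * Real.pi) := by
    rw [← pow_succ]; congr 1; omega
  rw [h5, mul_inv]
  ring

open FourierTransform in
/-- Fourier inversion for a finite measure with radial characteristic function, in weak form. -/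
theorem tendsto_integral_mul_invPart {d : ℕ} (hd : 2 ≤ d) {μ : Measure (Space d)}
    [IsFiniteMeasure μ] {F : ℝ → ℝ} (hF : Continuous F) (hμ : ∀ ξ, charFun μ ξ = F ‖ξ‖)
    (φ : SchwartzMap (Space d) ℂ) :
    Tendsto (fun R : ℝ => ∫ x, φ x * (invConst d * invPart d F R ‖x‖ : ℝ)) atTop
      (𝓝 (∫ x, φ x ∂μ)) := by
  have hpi := Real.pi_pos
  have hFφ : Integrable (𝓕 φ : SchwartzMap (Space d) ℂ) := (𝓕 φ).integrable
  have hsub : ∀ R : ℝ, 0 ≤ R → ∫ x, φ x * (invConst d * invPart d F R ‖x‖ : ℝ) =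
      ∫ ξ in Metric.ball (0 : Space d) (R / (2 * Real.pi)),
        (𝓕 φ) ξ * (F (2 * Real.pi * ‖ξ‖) : ℂ) := by
    intro R hR
    -- The Fourier transform is moved from the truncated radial function to the test function.
    have h1 := VectorFourier.integral_fourierIntegral_smul_eq_flip (L := innerₗ (Space d))
      Real.continuous_fourierChar continuous_inner (φ.integrable (μ := volume))
      (integrable_indicator_ball_radial hF (R / (2 * Real.pi)))
    rw [flip_innerₗ] at h1
    have h2 : ∀ x, VectorFourier.fourierIntegral Real.fourierChar volume (innerₗ (Space d))
        ((Metric.ball (0 : Space d) (R / (2 * Real.pi))).indicator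
          fun ξ => (F (2 * Real.pi * ‖ξ‖) : ℂ)) x = (invConst d * invPart d F R ‖x‖ : ℝ) := by
      intro x
      have := fourier_indicator_ball_radial hd hF (R := R / (2 * Real.pi)) (by positivity) x
      rw [mul_div_cancel₀ _ (by positivity)] at this
      exact this
    simp only [h2, smul_eq_mul] at h1
    rw [← h1, ← integral_indicator measurableSet_ball]
    congr 1; funext ξ
    rw [SchwartzMap.fourier_coe]
    by_cases hξ : ξ ∈ Metric.ball (0 : Space d) (R / (2 * Real.pi))
    · rw [Set.indicator_of_mem hξ, Set.indicator_of_mem hξ]; rfl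
    · rw [Set.indicator_of_notMem hξ, Set.indicator_of_notMem hξ, mul_zero]
  have hval : ∫ x, φ x ∂μ = ∫ ξ, (𝓕 φ) ξ * (F (2 * Real.pi * ‖ξ‖) : ℂ) := by
    have h1 : ∀ x, φ x = ∫ ξ, Complex.exp (↑(2 * Real.pi * inner ℝ ξ x) * Complex.I) * (𝓕 φ) ξ := by
      intro x
      have h2 : φ x = (𝓕⁻ (𝓕 φ) : SchwartzMap (Space d) ℂ) x := by
        rw [FourierTransform.fourierInv_fourier_eq]
      rw [h2, SchwartzMap.fourierInv_coe, Real.fourierInv_eq']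
      rfl
    simp only [h1]
    rw [integral_integral_swap]
    · congr 1; funext ξ
      rw [integral_mul_const, mul_comm]
      congr 1
      have h3 := hμ ((2 * Real.pi) • ξ)
      rw [norm_smul, Real.norm_of_nonneg (by positivity), charFun_apply] at h3
      rw [← h3]
      congr 1; funext x
      rw [inner_smul_right, real_inner_comm]
    · have h4 : Integrable (fun p : Space d × Space d => (𝓕 φ) p.2) (μ.prod volume) :=
        hFφ.comp_snd μ
      refine h4.norm.mono' ?_ (Eventually.of_forall fun p => ?_)
      · refine Continuous.aestronglyMeasurable ?_
        have := (𝓕 φ : SchwartzMap (Space d) ℂ).continuous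
        simp only [Function.uncurry_def]
        fun_prop
      · simp only [Function.uncurry_def]
        rw [norm_mul, Complex.norm_exp_ofReal_mul_I, one_mul]
  -- F is bounded because it is the characteristic function of a finite measure; against the
  -- Schwartz function `𝓕 φ` the truncation can then be removed by dominated convergence.
  have hbd : ∀ ξ : Space d, ‖(F (2 * Real.pi * ‖ξ‖) : ℂ)‖ ≤ μ.real Set.univ := by
    intro ξ
    have h3 := hμ ((2 * Real.pi) • ξ)
    rw [norm_smul, Real.norm_of_nonneg (by positivity)] at h3
    rw [← h3]
    exact norm_charFun_le _
  have hint : Integrable fun ξ => (𝓕 φ) ξ * (F (2 * Real.pi * ‖ξ‖) : ℂ) :=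
    hFφ.mul_bdd (c := μ.real Set.univ) (Continuous.aestronglyMeasurable (by fun_prop))
      (Eventually.of_forall hbd)
  have hlim : Tendsto (fun R : ℝ => ∫ ξ in Metric.ball (0 : Space d) (R / (2 * Real.pi)),
      (𝓕 φ) ξ * (F (2 * Real.pi * ‖ξ‖) : ℂ)) atTop (𝓝 (∫ x, φ x ∂μ)) := by
    rw [hval]
    simp only [← integral_indicator (measurableSet_ball (x := (0 : Space d)))]
    refine tendsto_integral_filter_of_dominated_convergence _
      (Eventually.of_forall fun R => (hint.indicator measurableSet_ball).aestronglyMeasurable)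
      (Eventually.of_forall fun R => Eventually.of_forall fun ξ => norm_indicator_le_norm_self _ _)
      hint.norm (Eventually.of_forall fun ξ => ?_)
    refine tendsto_const_nhds.congr' ?_
    filter_upwards [eventually_gt_atTop (2 * Real.pi * ‖ξ‖)] with R hR
    rw [Set.indicator_of_mem]
    rw [mem_ball_zero_iff, lt_div_iff₀ (by positivity)]
    linarith
  refine hlim.congr' ?_
  filter_upwards [eventually_ge_atTop 0] with R hR
  rw [hsub R hR]

/-! ### Identification of the density on the punctured ball. -/

/-- A difference of two bumps. Both the origin and the boundary sphere must be avoided, as uniform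
convergence is available only between them. -/
theorem exists_annulus_cutoff (d : ℕ) {T δ : ℝ} (hδ : 0 < δ) (hδT : 4 * δ ≤ T) :
    ∃ η : Space d → ℝ, ContDiff ℝ (⊤ : ℕ∞) η ∧ HasCompactSupport η ∧ (∀ x, 0 ≤ η x) ∧
      (∀ x, η x ≠ 0 → ‖x‖ ∈ Set.Icc δ (T - δ)) ∧
      ∀ x, ‖x‖ ∈ Set.Icc (2 * δ) (T - 2 * δ) → η x = 1 := by
  let χ₁ : ContDiffBump (0 : Space d) := ⟨T - 2 * δ, T - δ, by linarith, by linarith⟩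
  let χ₂ : ContDiffBump (0 : Space d) := ⟨δ, 2 * δ, hδ, by linarith⟩
  have h1 : ∀ x : Space d, ‖x‖ ≤ T - 2 * δ → χ₁ x = 1 := fun x hx =>
    χ₁.one_of_mem_closedBall (by rwa [mem_closedBall_zero_iff])
  have h2 : ∀ x : Space d, T - δ ≤ ‖x‖ → χ₁ x = 0 := fun x hx =>
    χ₁.zero_of_le_dist (by rwa [dist_zero_right])
  have h3 : ∀ x : Space d, ‖x‖ ≤ δ → χ₂ x = 1 := fun x hx =>
    χ₂.one_of_mem_closedBall (by rwa [mem_closedBall_zero_iff])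
  have h4 : ∀ x : Space d, 2 * δ ≤ ‖x‖ → χ₂ x = 0 := fun x hx =>
    χ₂.zero_of_le_dist (by rwa [dist_zero_right])
  refine ⟨fun x => χ₁ x - χ₂ x, χ₁.contDiff.sub χ₂.contDiff,
    χ₁.hasCompactSupport.sub χ₂.hasCompactSupport, fun x => ?_, fun x hx => ?_, fun x hx => ?_⟩
  · beta_reduce
    rcases le_total ‖x‖ (2 * δ) with h | h
    · rw [h1 x (by linarith)]; linarith [χ₂.le_one (x := x)]
    · rw [h4 x h]; linarith [χ₁.nonneg (x := x)]
  · by_contra hc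
    refine hx ?_
    beta_reduce
    rw [Set.mem_Icc, not_and_or, not_le, not_le] at hc
    rcases hc with h | h
    · rw [h1 x (by linarith), h3 x h.le, sub_self]
    · rw [h2 x h.le, h4 x (by linarith), sub_self]
  · beta_reduce
    rw [h1 x hx.2, h4 x hx.1, sub_zero]

theorem invConst_pos {d : ℕ} (hd : 1 ≤ d) : 0 < invConst d := by
  have h := toSphere_univ_ne_zero hd
  have : 0 < (volume : Measure (Space d)).toSphere.real Set.univ :=
    ENNReal.toReal_pos h (measure_ne_top _ _)
  have := Real.pi_pos
  unfold invConst
  positivity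

/-- The Fourier inversion integral of a radial function, as an improper integral. -/
def invLim (d : ℕ) (F : ℝ → ℝ) (r : ℝ) : ℝ :=
  limUnder atTop fun R : ℝ => invPart d F R r

theorem tendstoUniformlyOn_invLim {d : ℕ} {F : ℝ → ℝ} {s : Set ℝ}
    (h : ∃ L, TendstoUniformlyOn (invPart d F) L atTop s) :
    TendstoUniformlyOn (invPart d F) (invLim d F) atTop s := by
  obtain ⟨L, hL⟩ := h
  exact hL.congr_right fun r hr => ((hL.tendsto_at hr).limUnder_eq).symm

theorem continuousOn_invLim {d : ℕ} (hd : 2 ≤ d) {F : ℝ → ℝ} (hF : Continuous F) {T : ℝ}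
    (hinv : ∀ δ, 0 < δ → δ < T → ∃ L, TendstoUniformlyOn (invPart d F) L atTop
      (Set.Icc δ (T - δ))) : ContinuousOn (invLim d F) (Set.Ioo 0 T) := by
  refine TendstoLocallyUniformlyOn.continuousOn (F := invPart d F) (p := atTop) ?_
    (Frequently.of_forall fun R => (continuous_invPart hd hF R).continuousOn)
  refine tendstoLocallyUniformlyOn_of_forall_exists_nhds fun r hr => ?_
  have h0 : 0 < min r (T - r) := lt_min hr.1 (sub_pos.2 hr.2)
  have h1 := min_le_left r (T - r)
  have h2 := min_le_right r (T - r)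
  refine ⟨Set.Icc (min r (T - r) / 2) (T - min r (T - r) / 2), mem_nhdsWithin_of_mem_nhds
    (Icc_mem_nhds (by linarith) (by linarith)), tendstoUniformlyOn_invLim
    (hinv _ (by linarith) (by linarith))⟩

/-- Fourier inversion tested against smooth functions supported in an annulus. -/
theorem integral_eq_integral_mul_invLim {d : ℕ} (hd : 2 ≤ d) {μ : Measure (Space d)}
    [IsFiniteMeasure μ] {F : ℝ → ℝ} (hF : Continuous F) (hμ : ∀ ξ, charFun μ ξ = F ‖ξ‖) {T : ℝ}
    (hinv : ∀ δ, 0 < δ → δ < T → ∃ L, TendstoUniformlyOn (invPart d F) L atTop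
      (Set.Icc δ (T - δ))) {φ : Space d → ℂ} (hφ : ContDiff ℝ (⊤ : ℕ∞) φ)
    (hφc : HasCompactSupport φ) {δ : ℝ} (hδ : 0 < δ) (hδT : δ < T)
    (hφδ : ∀ x, φ x ≠ 0 → ‖x‖ ∈ Set.Icc δ (T - δ)) :
    ∫ x, φ x ∂μ = ∫ x, φ x * (invConst d * invLim d F ‖x‖ : ℝ) := by
  have hU := tendstoUniformlyOn_invLim (hinv δ hδ hδT)
  have hC := (continuousOn_invLim hd hF hinv).mono
    (show Set.Icc δ (T - δ) ⊆ Set.Ioo 0 T from fun r hr => ⟨by linarith [hr.1], by linarith [hr.2]⟩)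
  obtain ⟨M, hM⟩ := isCompact_Icc.exists_bound_of_continuousOn hC
  have hi : Integrable φ := hφ.continuous.integrable_of_hasCompactSupport hφc
  have h1 := tendsto_integral_mul_invPart hd hF hμ (hφc.toSchwartzMap hφ)
  refine tendsto_nhds_unique h1 ?_
  have hcoe : ∀ x, (hφc.toSchwartzMap hφ) x = φ x := fun x => rfl
  simp only [hcoe]
  have hK := (invConst_pos (d := d) (by omega)).le
  -- Uniform convergence puts the truncated integrals within 1 of their limit, which M bounds on the
  -- annulus.
  refine tendsto_integral_filter_of_dominated_convergence
    (fun x => ‖φ x‖ * (invConst d * (M + 1))) (Eventually.of_forall fun R => ?_) ?_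
    (hi.norm.mul_const _) (Eventually.of_forall fun x => ?_)
  · have := continuous_invPart hd hF R
    have := hφ.continuous
    exact Continuous.aestronglyMeasurable (by fun_prop)
  · filter_upwards [Metric.tendstoUniformlyOn_iff.1 hU 1 one_pos] with R hR
    refine Eventually.of_forall fun x => ?_
    rw [norm_mul, Complex.norm_real, norm_mul, Real.norm_of_nonneg hK]
    rcases eq_or_ne (φ x) 0 with h0 | h0
    · simp [h0]
    · have h2 := hR _ (hφδ x h0)
      have h3 := hM _ (hφδ x h0)
      rw [dist_comm, Real.dist_eq] at h2
      rw [Real.norm_eq_abs] at h3 ⊢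
      gcongr
      calc |invPart d F R ‖x‖| = |invLim d F ‖x‖ + (invPart d F R ‖x‖ - invLim d F ‖x‖)| := by
            congr 1; ring
        _ ≤ _ := (abs_add_le _ _).trans (add_le_add h3 h2.le)
  · rcases eq_or_ne (φ x) 0 with h0 | h0
    · simp [h0]
    · have h2 := hU.tendsto_at (hφδ x h0)
      exact (((Complex.continuous_ofReal.tendsto _).comp (h2.const_mul _)).const_mul _)

theorem isOpen_annulus (d : ℕ) (r T : ℝ) : IsOpen {x : Space d | ‖x‖ ∈ Set.Ioo r T} :=
  isOpen_Ioo.preimage continuous_norm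

theorem continuous_mul_invLim {d : ℕ} (hd : 2 ≤ d) {F : ℝ → ℝ} (hF : Continuous F) {T : ℝ}
    (hinv : ∀ δ, 0 < δ → δ < T → ∃ L, TendstoUniformlyOn (invPart d F) L atTop
      (Set.Icc δ (T - δ))) {η : Space d → ℝ} (hη : Continuous η) {δ : ℝ} (hδ : 0 < δ)
    (hηδ : ∀ x, η x ≠ 0 → ‖x‖ ∈ Set.Icc δ (T - δ)) :
    Continuous fun x => η x * (invConst d * invLim d F ‖x‖) := by
  refine ContinuousOn.continuous_of_tsupport_subset (s := {x : Space d | ‖x‖ ∈ Set.Ioo 0 T}) ?_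
    (isOpen_annulus d 0 T) ?_
  · exact hη.continuousOn.mul (continuousOn_const.mul
      ((continuousOn_invLim hd hF hinv).comp continuous_norm.continuousOn fun x hx => hx))
  · have h1 : IsClosed {x : Space d | ‖x‖ ∈ Set.Icc δ (T - δ)} :=
      isClosed_Icc.preimage continuous_norm
    refine (closure_minimal (fun x hx => hηδ x ?_) h1).trans fun x hx =>
      ⟨hδ.trans_le hx.1, hx.2.trans_lt (by linarith)⟩
    exact left_ne_zero_of_mul hx

/-- If the limit were negative at r, it would be negative near a point of norm r by continuity, and
a bump there would have negative integral against the positive measure μ. -/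
theorem invLim_nonneg {d : ℕ} (hd : 2 ≤ d) {μ : Measure (Space d)}
    [IsFiniteMeasure μ] {F : ℝ → ℝ} (hF : Continuous F) (hμ : ∀ ξ, charFun μ ξ = F ‖ξ‖) {T : ℝ}
    (hinv : ∀ δ, 0 < δ → δ < T → ∃ L, TendstoUniformlyOn (invPart d F) L atTop
      (Set.Icc δ (T - δ))) {r : ℝ} (hr : r ∈ Set.Ioo 0 T) : 0 ≤ invLim d F r := by
  by_contra! hneg
  obtain ⟨e, he⟩ := exists_unit hd
  set x₀ : Space d := r • e with hx₀
  have hx₀r : ‖x₀‖ = r := by rw [hx₀, norm_smul, he, mul_one, Real.norm_of_nonneg hr.1.le]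
  have h0 : 0 < min r (T - r) := lt_min hr.1 (sub_pos.2 hr.2)
  have h1 := min_le_left r (T - r)
  have h2 := min_le_right r (T - r)
  set δ := min r (T - r) / 2 with hδ
  have hδ0 : 0 < δ := by positivity
  have hev : ∀ᶠ x in 𝓝 x₀, ‖x‖ ∈ Set.Icc δ (T - δ) ∧ invLim d F ‖x‖ < 0 := by
    have hn : Tendsto (fun x : Space d => ‖x‖) (𝓝 x₀) (𝓝 r) := by
      rw [← hx₀r]; exact continuous_norm.tendsto x₀
    have hI : ∀ᶠ u in 𝓝 r, u ∈ Set.Icc δ (T - δ) := Icc_mem_nhds (by linarith) (by linarith)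
    exact hn.eventually (hI.and (((continuousOn_invLim hd hF hinv).continuousAt
      (Ioo_mem_nhds hr.1 hr.2)).eventually_lt_const hneg))
  obtain ⟨ε, hε, hball⟩ := Metric.eventually_nhds_iff.1 hev
  let ψ : ContDiffBump x₀ := ⟨ε / 2, ε, by positivity, by linarith⟩
  have hψδ : ∀ x, ψ x ≠ 0 → ‖x‖ ∈ Set.Icc δ (T - δ) ∧ invLim d F ‖x‖ < 0 := fun x hx => by
    refine hball ?_
    by_contra! h
    exact hx (ψ.zero_of_le_dist h)
  have hK := invConst_pos (d := d) (by omega)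
  have key := integral_eq_integral_mul_invLim hd hF hμ hinv (φ := fun x => (ψ x : ℂ))
    (Complex.ofRealCLM.contDiff.comp ψ.contDiff)
    (ψ.hasCompactSupport.comp_left Complex.ofReal_zero) hδ0 (by linarith [hr.1, hr.2])
    (fun x hx => (hψδ x (by exact_mod_cast hx)).1)
  simp only [← Complex.ofReal_mul] at key
  rw [integral_complex_ofReal, integral_complex_ofReal] at key
  have key' : ∫ x, ψ x ∂μ = ∫ x, ψ x * (invConst d * invLim d F ‖x‖) := by exact_mod_cast key
  have hpos : 0 < ∫ x, -(ψ x * (invConst d * invLim d F ‖x‖)) := by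
    refine Continuous.integral_pos_of_hasCompactSupport_nonneg_nonzero (x := x₀)
      (continuous_mul_invLim hd hF hinv ψ.continuous hδ0 fun x hx => (hψδ x hx).1).neg ?_
      (fun x => ?_) ?_
    · exact HasCompactSupport.comp_left (g := fun y : ℝ => -y) ψ.hasCompactSupport.mul_right neg_zero
    · simp only [Pi.zero_apply]
      rcases eq_or_ne (ψ x) 0 with h | h
      · simp [h]
      · have := (hψδ x h).2
        have h3 := ψ.nonneg (x := x)
        nlinarith [mul_nonneg h3 (mul_nonneg hK.le (neg_nonneg.2 this.le))]
    · rw [ψ.one_of_mem_closedBall (Metric.mem_closedBall_self (by positivity)), hx₀r]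
      simp only [one_mul, ne_eq, neg_eq_zero]
      exact (mul_neg_of_pos_of_neg hK hneg).ne
  rw [integral_neg, ← key'] at hpos
  have := integral_nonneg (μ := μ) (f := ψ) fun x => ψ.nonneg
  linarith

/-- A finite measure carried by a punctured ball, with radial characteristic function, has the
density given by Fourier inversion, provided that the inversion integral converges locally uniformly
on the punctured ball. -/
theorem eq_withDensity_invLim {d : ℕ} (hd : 2 ≤ d) {μ : Measure (Space d)}
    [IsFiniteMeasure μ] {F : ℝ → ℝ} (hF : Continuous F) (hμ : ∀ ξ, charFun μ ξ = F ‖ξ‖) {T : ℝ}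
    (hT : 0 < T) (hinv : ∀ δ, 0 < δ → δ < T → ∃ L, TendstoUniformlyOn (invPart d F) L atTop
      (Set.Icc δ (T - δ))) (hcar : ∀ᵐ x ∂μ, ‖x‖ ∈ Set.Ioo 0 T) :
    μ = (volume.restrict (Metric.ball (0 : Space d) T)).withDensity
      fun x => ENNReal.ofReal (invConst d * invLim d F ‖x‖) := by
  have hK := invConst_pos (d := d) (by omega)
  set q : Space d → ℝ := fun x => invConst d * invLim d F ‖x‖ with hq
  have hmU : MeasurableSet {x : Space d | ‖x‖ ∈ Set.Ioo 0 T} := (isOpen_annulus d 0 T).measurableSet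
  -- The ball and the punctured ball differ by a single point, which is Lebesgue null.
  have hball : volume.restrict (Metric.ball (0 : Space d) T) =
      volume.restrict {x : Space d | ‖x‖ ∈ Set.Ioo 0 T} := by
    have : Nonempty (Fin d) := ⟨⟨0, by omega⟩⟩
    refine Measure.restrict_congr_set ?_
    have h0 : ∀ᵐ x : Space d, x ≠ 0 := by
      rw [ae_iff]; simp
    filter_upwards [h0] with x hx
    have : 0 < ‖x‖ := norm_pos_iff.2 hx
    exact propext ⟨fun h => ⟨this, mem_ball_zero_iff.1 h⟩, fun h => mem_ball_zero_iff.2 h.2⟩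
  rw [hball, ← restrict_withDensity hmU]
  refine (Measure.restrict_eq_self_of_ae_mem
    (s := {x : Space d | ‖x‖ ∈ Set.Ioo 0 T}) hcar).symm.trans ?_
  -- The punctured ball is exhausted by closed annuli; the shift by 4 ensures 4 δ ≤ T, as the cutoff
  -- requires.
  set s : ℕ → Set (Space d) := fun k => {x | ‖x‖ ∈ Set.Icc (2 * (T / (k + 4))) (T - 2 * (T / (k + 4)))}
    with hs
  have hms : ∀ k, MeasurableSet (s k) := fun k => (isClosed_Icc.preimage continuous_norm).measurableSet
  have hUs : {x : Space d | ‖x‖ ∈ Set.Ioo 0 T} = ⋃ k, s k := by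
    ext x
    simp only [hs, Set.mem_iUnion, Set.mem_ofPred_eq]
    constructor
    · intro hx
      have h0 : 0 < min ‖x‖ (T - ‖x‖) := lt_min hx.1 (sub_pos.2 hx.2)
      obtain ⟨k, hk⟩ := exists_nat_gt (2 * T / min ‖x‖ (T - ‖x‖))
      rw [div_lt_iff₀ h0] at hk
      have h3 : 2 * (T / (k + 4)) ≤ min ‖x‖ (T - ‖x‖) := by
        rw [← mul_div_assoc, div_le_iff₀ (by positivity)]
        nlinarith
      exact ⟨k, h3.trans (min_le_left _ _), by linarith [h3.trans (min_le_right _ _)]⟩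
    · rintro ⟨k, h1, h2⟩
      have : 0 < T / ((k : ℝ) + 4) := by positivity
      exact ⟨by linarith, by linarith⟩
  rw [hUs, Measure.restrict_iUnion_congr]
  intro k
  set δ : ℝ := T / (k + 4) with hδ
  have hδ0 : 0 < δ := by positivity
  have hδT : 4 * δ ≤ T := by
    rw [hδ, ← mul_div_assoc, div_le_iff₀ (by positivity)]
    nlinarith [(Nat.cast_nonneg k : (0 : ℝ) ≤ k)]
  obtain ⟨η, hηs, hηc, hη0, hηδ, hη1⟩ := exists_annulus_cutoff d hδ0 hδT
  have hηcont := hηs.continuous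
  have hqc := continuous_mul_invLim hd hF hinv hηcont hδ0 hηδ
  have hηqc : HasCompactSupport fun x => η x * q x := hηc.mul_right
  have hηq0 : ∀ x, 0 ≤ η x * q x := fun x => by
    rcases eq_or_ne (η x) 0 with h | h
    · simp [h]
    · have h1 := hηδ x h
      have h2 := invLim_nonneg hd hF hμ hinv (r := ‖x‖)
        ⟨by linarith [h1.1], by linarith [h1.2]⟩
      exact mul_nonneg (hη0 x) (mul_nonneg hK.le h2)
  set ν₁ := μ.withDensity fun x => ENNReal.ofReal (η x) with hν₁
  set ν₂ := (volume : Measure (Space d)).withDensity fun x => ENNReal.ofReal (η x * q x) with hν₂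
  have hf₁ : IsFiniteMeasure ν₁ := isFiniteMeasure_withDensity_ofReal
    (hηcont.integrable_of_hasCompactSupport hηc).2
  have hf₂ : IsFiniteMeasure ν₂ := isFiniteMeasure_withDensity_ofReal
    (hqc.integrable_of_hasCompactSupport hηqc).2
  -- Multiplying a plane wave by the cutoff gives an admissible test function, so the two localised
  -- measures have the same characteristic function.
  have hν : ν₁ = ν₂ := by
    refine Measure.ext_of_charFun (funext fun ξ => ?_)
    rw [charFun_apply, charFun_apply, hν₁, hν₂,
      integral_withDensity_eq_integral_toReal_smul (by fun_prop)
        (Eventually.of_forall fun _ => ENNReal.ofReal_lt_top),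
      integral_withDensity_eq_integral_toReal_smul (hqc.measurable.ennreal_ofReal)
        (Eventually.of_forall fun _ => ENNReal.ofReal_lt_top)]
    have key := integral_eq_integral_mul_invLim hd hF hμ hinv
      (φ := fun x => (η x : ℂ) * Complex.exp ((inner ℝ x ξ : ℝ) * Complex.I))
      ((Complex.ofRealCLM.contDiff.comp hηs).mul
        (((Complex.ofRealCLM.contDiff.comp (contDiff_id.inner ℝ contDiff_const)).mul
          contDiff_const).cexp))
      ((hηc.comp_left Complex.ofReal_zero).mul_right) hδ0 (by linarith)
      (fun x hx => hηδ x (by exact_mod_cast left_ne_zero_of_mul hx))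
    refine (integral_congr_ae (Eventually.of_forall fun x => ?_)).trans
      (key.trans (integral_congr_ae (Eventually.of_forall fun x => ?_)))
    · rw [ENNReal.toReal_ofReal (hη0 x), Complex.real_smul]
    · beta_reduce
      rw [ENNReal.toReal_ofReal (hηq0 x), Complex.real_smul, hq]
      push_cast; ring
  have e₁ : ν₁.restrict (s k) = μ.restrict (s k) := by
    rw [hν₁, restrict_withDensity (hms k)]
    conv_rhs => rw [← withDensity_one (μ := μ.restrict (s k))]
    refine withDensity_congr_ae ?_
    filter_upwards [ae_restrict_mem (hms k)] with x hx
    rw [hη1 x hx, ENNReal.ofReal_one, Pi.one_apply]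
  have e₂ : ν₂.restrict (s k) = ((volume : Measure (Space d)).withDensity
      fun x => ENNReal.ofReal (q x)).restrict (s k) := by
    rw [hν₂, restrict_withDensity (hms k), restrict_withDensity (hms k)]
    refine withDensity_congr_ae ?_
    filter_upwards [ae_restrict_mem (hms k)] with x hx
    rw [hη1 x hx, one_mul]
  rw [← e₁, hν, e₂]

/-! ### From Fourier inversion to the Bessel formula. -/

theorem gdDensity_eq {n : ℕ} (a b : Fin n → ℝ) (t : ℝ) (τ : Fin n → ℝ) :
    gdDensity a b t τ = gdConst a b t * gdKernel a b t τ := rfl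

theorem gdKernel_nonneg {n : ℕ} (a b : Fin n → ℝ) {t : ℝ} {τ : Fin n → ℝ} (h : τ ∈ simplex n t) :
    0 ≤ gdKernel a b t τ :=
  Finset.prod_nonneg fun k _ => mul_nonneg (Real.rpow_nonneg (h k).1.le _)
    (Real.rpow_nonneg (rest_pos_of_mem_simplex h k).le _)

theorem gdLaw_eq {n : ℕ} (a b : Fin n → ℝ) (t : ℝ) :
    gdLaw a b t = ENNReal.ofReal (gdConst a b t) • gdWeight a b t := by
  rw [gdWeight, ← withDensity_smul _ (measurable_gdKernel a b t).ennreal_ofReal]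
  refine withDensity_congr_ae ?_
  filter_upwards [ae_restrict_mem (measurableSet_simplex n t)] with τ hτ
  rw [gdDensity_eq, ENNReal.ofReal_mul' (gdKernel_nonneg a b hτ)]
  rfl

/-- With a nonpositive constant the law would be the zero measure. -/
theorem gdConst_pos_of_isProbabilityMeasure {n : ℕ} {a b : Fin n → ℝ} {t : ℝ}
    (h : IsProbabilityMeasure (gdLaw a b t)) : 0 < gdConst a b t := by
  by_contra! hc
  have h1 := h.measure_univ
  rw [gdLaw_eq, ENNReal.ofReal_of_nonpos hc, zero_smul] at h1
  simp at h1

theorem isFiniteMeasure_gdWeight {n : ℕ} {a b : Fin n → ℝ} {t : ℝ}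
    (h : IsProbabilityMeasure (gdLaw a b t)) : IsFiniteMeasure (gdWeight a b t) := by
  have hc := gdConst_pos_of_isProbabilityMeasure h
  have h1 := h.measure_univ
  rw [gdLaw_eq, Measure.smul_apply, smul_eq_mul] at h1
  refine ⟨lt_top_iff_ne_top.2 fun htop => ?_⟩
  rw [htop, ENNReal.mul_top (ENNReal.ofReal_pos.2 hc).ne'] at h1
  exact ENNReal.top_ne_one h1

/-- The characteristic function of the flight, as a function of the norm of the frequency. -/
def flightChar (d : ℕ) (c t : ℝ) {n : ℕ} (a b : Fin n → ℝ) (ρ : ℝ) : ℝ :=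
  ∫ τ, stepsChar d t τ (c * ρ) ∂gdLaw a b t

/-- The value at `0` of the normalised Bessel function, inverted. -/
def besselNorm (d : ℕ) : ℝ := 2 ^ ((d : ℝ) / 2 - 1) * Real.Gamma ((d : ℝ) / 2)

theorem besselNorm_pos {d : ℕ} (hd : 1 ≤ d) : 0 < besselNorm d := by
  have : (0 : ℝ) < d := by exact_mod_cast hd
  have := Real.Gamma_pos_of_pos (half_pos this)
  unfold besselNorm
  positivity

theorem simplexIntegrand_eq {d : ℕ} (hd : 2 ≤ d) {c t : ℝ} (hc : 0 < c) (ht : 0 < t) {n : ℕ}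
    (a b : Fin n → ℝ) {ρ : ℝ} (hρ : 0 < ρ) {τ : Fin n → ℝ} (hτ : τ ∈ simplex n t) :
    simplexIntegrand d c t a b ρ τ =
      gdDensity a b t τ * stepsChar d t τ (c * ρ) / besselNorm d ^ (n + 1) := by
  rw [simplexIntegrand, mul_div_assoc]
  congr 1
  have hpow : besselNorm d ^ (n + 1) = ∏ _k : Fin (n + 1), besselNorm d := by
    rw [Finset.prod_const, Finset.card_univ, Fintype.card_fin]
  rw [stepsChar, hpow, ← Finset.prod_div_distrib]
  refine Finset.prod_congr rfl fun k _ => ?_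
  have hk := durations_pos ht hτ k
  have hs : 0 < c * durations t τ k * ρ := by positivity
  rw [besselJ_eq_coordChar hd hs, mul_div_cancel_left₀ _ (Real.rpow_pos_of_pos hs _).ne',
    besselNorm, show c * durations t τ k * ρ = durations t τ k * (c * ρ) by ring]

theorem integrableOn_gdDensity_mul_stepsChar {d : ℕ} (hd : 2 ≤ d) {t : ℝ} {n : ℕ}
    {a b : Fin n → ℝ} (h : IsProbabilityMeasure (gdLaw a b t)) (s : ℝ) :
    IntegrableOn (fun τ => gdDensity a b t τ * stepsChar d t τ s) (simplex n t) := by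
  have hm : Measurable (gdDensity a b t) := (measurable_gdKernel a b t).const_mul _
  have hi : Integrable (fun τ : Fin n → ℝ => stepsChar d t τ s) (gdLaw a b t) :=
    Integrable.of_bound (measurable_stepsChar hd t s).aestronglyMeasurable 1
      (Eventually.of_forall fun τ => abs_stepsChar_le_one hd t τ s)
  rw [gdLaw, integrable_withDensity_iff_integrable_smul' hm.ennreal_ofReal
    (Eventually.of_forall fun _ => ENNReal.ofReal_lt_top)] at hi
  refine hi.congr ?_
  filter_upwards [ae_restrict_mem (measurableSet_simplex n t)] with τ hτ
  rw [gdDensity_eq, ENNReal.toReal_ofReal (mul_nonneg (gdConst_pos_of_isProbabilityMeasure h).le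
    (gdKernel_nonneg a b hτ)), smul_eq_mul]

theorem integrableOn_simplexIntegrand {d : ℕ} (hd : 2 ≤ d) {c t : ℝ} (hc : 0 < c) (ht : 0 < t)
    {n : ℕ} {a b : Fin n → ℝ} (h : IsProbabilityMeasure (gdLaw a b t)) {ρ : ℝ} (hρ : 0 < ρ) :
    IntegrableOn (simplexIntegrand d c t a b ρ) (simplex n t) :=
  IntegrableOn.congr_fun ((integrableOn_gdDensity_mul_stepsChar hd h (c * ρ)).div_const
    (besselNorm d ^ (n + 1))) (fun _ hτ => (simplexIntegrand_eq hd hc ht a b hρ hτ).symm) (measurableSet_simplex n t)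

theorem setIntegral_simplexIntegrand {d : ℕ} (hd : 2 ≤ d) {c t : ℝ} (hc : 0 < c) (ht : 0 < t)
    {n : ℕ} {a b : Fin n → ℝ} (h : IsProbabilityMeasure (gdLaw a b t)) {ρ : ℝ} (hρ : 0 < ρ) :
    ∫ τ in simplex n t, simplexIntegrand d c t a b ρ τ =
      flightChar d c t a b ρ / besselNorm d ^ (n + 1) := by
  have hm : Measurable (gdDensity a b t) := (measurable_gdKernel a b t).const_mul _
  rw [setIntegral_congr_fun (measurableSet_simplex n t)
    (fun τ hτ => simplexIntegrand_eq hd hc ht a b hρ hτ), integral_div, flightChar, gdLaw,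
    integral_withDensity_eq_integral_toReal_smul hm.ennreal_ofReal
      (Eventually.of_forall fun _ => ENNReal.ofReal_lt_top)]
  congr 1
  refine setIntegral_congr_fun (measurableSet_simplex n t) fun τ hτ => ?_
  rw [gdDensity_eq, ENNReal.toReal_ofReal (mul_nonneg (gdConst_pos_of_isProbabilityMeasure h).le
    (gdKernel_nonneg a b hτ)), smul_eq_mul]

theorem flightChar_eq {d : ℕ} {c t : ℝ} {n : ℕ} {a b : Fin n → ℝ}
    (h : IsProbabilityMeasure (gdLaw a b t)) (ρ : ℝ) : flightChar d c t a b ρ =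
      gdConst a b t * ∫ τ, stepsChar d t τ (c * ρ) ∂gdWeight a b t := by
  rw [flightChar, gdLaw_eq, integral_smul_measure,
    ENNReal.toReal_ofReal (gdConst_pos_of_isProbabilityMeasure h).le, smul_eq_mul]

theorem continuous_flightChar {d : ℕ} (hd : 2 ≤ d) (c t : ℝ) {n : ℕ} {a b : Fin n → ℝ}
    (h : IsProbabilityMeasure (gdLaw a b t)) : Continuous (flightChar d c t a b) := by
  have := isFiniteMeasure_gdWeight h
  rw [show flightChar d c t a b = _ from funext (flightChar_eq h)]
  exact ((continuous_integral_stepsChar hd a b t).comp (by fun_prop)).const_mul _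

theorem exists_tendstoUniformlyOn_invPart {d : ℕ} (hd : 2 ≤ d) {c t : ℝ} (hc : 0 < c) (ht : 0 < t)
    {n : ℕ} (hn : 1 ≤ n) {a b : Fin n → ℝ} (ha : ∀ k, 0 < a k)
    (h : IsProbabilityMeasure (gdLaw a b t)) {δ : ℝ} (hδ : 0 < δ) (hδT : δ < c * t) :
    ∃ L, TendstoUniformlyOn (invPart d (flightChar d c t a b)) L atTop
      (Set.Icc δ (c * t - δ)) := by
  have hfin := isFiniteMeasure_gdWeight h
  obtain ⟨S, _, μ, z, C, hz, hC⟩ := exists_isConormal_stepsChar hd ha ht hfin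
  refine exists_tendstoUniformlyOn_inversion hd hz (T := c * t) (by positivity)
    (C := gdConst a b t * C) (F := flightChar d c t a b) (fun ρ => ?_) ?_ hδ hδT
  · have h1 := hC (c * ρ)
    rw [integral_complex_ofReal] at h1
    rw [flightChar_eq h, Complex.ofReal_mul, h1, ← mul_assoc]
    push_cast
    congr 2; funext s
    congr 2; ring
  · have h1 := (tendsto_pow_mul_integral_stepsChar hd hn a b hc ht).const_mul |gdConst a b t|
    rw [mul_zero] at h1
    refine h1.congr fun ρ => ?_
    rw [flightChar_eq h, abs_mul]; ring

/-- There are n + 1 normalised Bessel factors from the steps and one from the outer function, and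
ρ^(d/2) ρ^(d/2-1) = ρ^(d-1). -/
theorem hankelIntegrand_eq {d : ℕ} (hd : 2 ≤ d) {c t : ℝ} (hc : 0 < c) (ht : 0 < t)
    {n : ℕ} {a b : Fin n → ℝ} (h : IsProbabilityMeasure (gdLaw a b t)) {r : ℝ} (hr : 0 < r)
    {ρ : ℝ} (hρ : 0 < ρ) :
    hankelIntegrand d c t a b r ρ = r ^ ((d : ℝ) / 2 - 1) / besselNorm d ^ (n + 2) *
      (ρ ^ (d - 1) * (coordChar d (ρ * r) * flightChar d c t a b ρ)) := by
  have hK := besselNorm_pos (d := d) (by omega)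
  have h1 : ρ ^ (d - 1) = ρ ^ ((d : ℝ) / 2) * ρ ^ ((d : ℝ) / 2 - 1) := by
    rw [← Real.rpow_add hρ, ← Real.rpow_natCast, Nat.cast_sub (by omega)]
    congr 1; push_cast; ring
  rw [hankelIntegrand, setIntegral_simplexIntegrand hd hc ht h hρ,
    besselJ_eq_coordChar hd (mul_pos hρ hr), ← besselNorm, Real.mul_rpow hρ.le hr.le, h1,
    pow_succ (besselNorm d) (n + 1)]
  field_simp

theorem intervalIntegrable_hankelIntegrand {d : ℕ} (hd : 2 ≤ d) {c t : ℝ} (hc : 0 < c)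
    (ht : 0 < t) {n : ℕ} {a b : Fin n → ℝ} (h : IsProbabilityMeasure (gdLaw a b t)) {r : ℝ}
    (hr : 0 < r) {R : ℝ} (hR : 0 ≤ R) :
    IntervalIntegrable (hankelIntegrand d c t a b r) volume 0 R := by
  have h1 := continuous_flightChar hd c t h
  have h2 := continuous_coordChar hd
  have h3 : Continuous fun ρ : ℝ => r ^ ((d : ℝ) / 2 - 1) / besselNorm d ^ (n + 2) *
      (ρ ^ (d - 1) * (coordChar d (ρ * r) * flightChar d c t a b ρ)) := by fun_prop
  refine (h3.intervalIntegrable 0 R).congr fun ρ hρ => ?_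
  rw [Set.uIoc_of_le hR] at hρ
  exact (hankelIntegrand_eq hd hc ht h hr hρ.1).symm

theorem integral_hankelIntegrand {d : ℕ} (hd : 2 ≤ d) {c t : ℝ} (hc : 0 < c)
    (ht : 0 < t) {n : ℕ} {a b : Fin n → ℝ} (h : IsProbabilityMeasure (gdLaw a b t)) {r : ℝ}
    (hr : 0 < r) {R : ℝ} (hR : 0 ≤ R) :
    ∫ ρ in (0 : ℝ)..R, hankelIntegrand d c t a b r ρ =
      r ^ ((d : ℝ) / 2 - 1) / besselNorm d ^ (n + 2) * invPart d (flightChar d c t a b) R r := by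
  rw [invPart, ← intervalIntegral.integral_const_mul]
  refine intervalIntegral.integral_congr_ae (Eventually.of_forall fun ρ hρ => ?_)
  rw [Set.uIoc_of_le hR] at hρ
  exact hankelIntegrand_eq hd hc ht h hr hρ.1

/-- The surface of the unit sphere is d times the volume of the unit ball, which is π^(d/2) / Γ(d/2
+ 1). -/
theorem invConst_eq {d : ℕ} (hd : 1 ≤ d) :
    invConst d = 1 / ((2 * Real.pi) ^ ((d : ℝ) / 2) * besselNorm d) := by
  have : Nonempty (Fin d) := ⟨⟨0, hd⟩⟩
  have hd0 : (0 : ℝ) < d := by exact_mod_cast hd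
  have hpi := Real.pi_pos
  have hΓ := Real.Gamma_pos_of_pos (half_pos hd0)
  have hvol : (volume : Measure (Space d)).real (Metric.ball 0 1) =
      Real.pi ^ ((d : ℝ) / 2) / ((d : ℝ) / 2 * Real.Gamma ((d : ℝ) / 2)) := by
    rw [measureReal_def, EuclideanSpace.volume_ball, Fintype.card_fin, ENNReal.ofReal_one, one_pow,
      one_mul, ENNReal.toReal_ofReal, Real.Gamma_add_one (by positivity), Real.sqrt_eq_rpow,
      ← Real.rpow_natCast, ← Real.rpow_mul hpi.le]
    · congr 2; ring
    · rw [Real.Gamma_add_one (by positivity)]; positivity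
  rw [invConst, Measure.toSphere_real_apply_univ, finrank_euclideanSpace_fin, hvol, besselNorm]
  have h1 : (2 * Real.pi) ^ d = (2 * Real.pi) ^ ((d : ℝ) / 2) * (2 * Real.pi) ^ ((d : ℝ) / 2) := by
    rw [← Real.rpow_add (by positivity), ← Real.rpow_natCast]; congr 1; ring
  have h2 : (2 * Real.pi) ^ ((d : ℝ) / 2) =
      2 * (2 : ℝ) ^ ((d : ℝ) / 2 - 1) * Real.pi ^ ((d : ℝ) / 2) := by
    rw [Real.mul_rpow (by norm_num) hpi.le, Real.rpow_sub (by norm_num), Real.rpow_one]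
    ring
  rw [h1, mul_inv]
  nth_rewrite 2 [h2]
  field_simp

theorem tendsto_integral_hankelIntegrand {d : ℕ} (hd : 2 ≤ d) {c t : ℝ} (hc : 0 < c)
    (ht : 0 < t) {n : ℕ} {a b : Fin n → ℝ} (h : IsProbabilityMeasure (gdLaw a b t)) {r : ℝ}
    (hr : 0 < r) (hlim : Tendsto (fun R => invPart d (flightChar d c t a b) R r) atTop
      (𝓝 (invLim d (flightChar d c t a b) r))) :
    Tendsto (fun R : ℝ => ∫ ρ in (0 : ℝ)..R, hankelIntegrand d c t a b r ρ) atTop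
      (𝓝 (r ^ ((d : ℝ) / 2 - 1) / besselNorm d ^ (n + 2) *
        invLim d (flightChar d c t a b) r)) := by
  refine (hlim.const_mul _).congr' ?_
  filter_upwards [eventually_ge_atTop 0] with R hR
  exact (integral_hankelIntegrand hd hc ht h hr hR).symm

theorem flightDensity_eq {d : ℕ} (hd : 2 ≤ d) {c t : ℝ} (hc : 0 < c)
    (ht : 0 < t) {n : ℕ} {a b : Fin n → ℝ} (h : IsProbabilityMeasure (gdLaw a b t)) {x : Space d}
    (hx : 0 < ‖x‖) (hlim : Tendsto (fun R => invPart d (flightChar d c t a b) R ‖x‖) atTop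
      (𝓝 (invLim d (flightChar d c t a b) ‖x‖))) :
    flightDensity d c t a b x = invConst d * invLim d (flightChar d c t a b) ‖x‖ := by
  have hK := besselNorm_pos (d := d) (by omega)
  have hpi := Real.pi_pos
  rw [flightDensity, improperIntegral,
    (tendsto_integral_hankelIntegrand hd hc ht h hx hlim).limUnder_eq, invConst_eq (by omega),
    ← besselNorm, pow_succ (besselNorm d) (n + 1)]
  field_simp

/-! ### The end point lies in the punctured ball. -/

open Pointwise in
-- The cone over a point of the sphere lies in a line, which is null in dimension at least two.
theorem uniformDirection_singleton {d : ℕ} (hd : 2 ≤ d) (v : Direction d) :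
    uniformDirection d {v} = 0 := by
  rw [uniformDirection, Measure.smul_apply, smul_eq_mul, Measure.toSphere_apply' _
    (measurableSet_singleton v), Set.image_singleton]
  have h1 : Set.Ioo (0 : ℝ) 1 • ({(v : Space d)} : Set (Space d)) ⊆ ((Submodule.span ℝ {(v : Space d)} : Submodule ℝ (Space d)) : Set (Space d)) := by
    rintro _ ⟨r, -, _, rfl, rfl⟩
    exact Submodule.smul_mem _ _ (Submodule.mem_span_singleton_self _)
  have h2 : volume ((Submodule.span ℝ {(v : Space d)} : Submodule ℝ (Space d)) : Set (Space d)) = 0 := by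
    refine Measure.addHaar_submodule _ _ fun htop => ?_
    have h3 := finrank_span_le_card (R := ℝ) ({(v : Space d)} : Set (Space d))
    rw [htop, finrank_top, finrank_euclideanSpace_fin] at h3
    simp at h3
    omega
  rw [measure_mono_null h1 h2, mul_zero, mul_zero]

theorem ae_direction_ne {d : ℕ} (hd : 2 ≤ d) {α : Type*} [MeasurableSpace α] (ν : Measure α)
    [SFinite ν] {g : α → Space d} (hg : Measurable g) :
    ∀ᵐ p ∂(uniformDirection d).prod ν, (p.1 : Space d) ≠ g p.2 := by
  have := isProbabilityMeasure_uniformDirection (d := d) (by omega)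
  have : NullSingletonClass (uniformDirection d) := ⟨uniformDirection_singleton hd⟩
  rw [ae_iff]
  simp only [ne_eq, not_not]
  rw [Measure.prod_apply_symm (measurableSet_eq_fun (by fun_prop) (by fun_prop))]
  refine (lintegral_congr fun y => ?_).trans lintegral_zero
  refine Set.Subsingleton.measure_zero (fun x hx x' hx' => Subtype.ext ?_) _
  exact (show (x : Space d) = g y from hx).trans (show (x' : Space d) = g y from hx').symm

/-- A sum of at least two independent uniform directions with positive weights is nonzero and
shorter than the sum of the weights. -/
theorem ae_norm_sum_direction_mem_Ioo {d : ℕ} (hd : 2 ≤ d) {n : ℕ} (hn : 1 ≤ n)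
    {u : Fin (n + 1) → ℝ} (hu : ∀ k, 0 < u k) :
    ∀ᵐ v ∂Measure.pi fun _ : Fin (n + 1) => uniformDirection d,
      ‖∑ k, u k • (v k : Space d)‖ ∈ Set.Ioo 0 (∑ k, u k) := by
  have := isProbabilityMeasure_uniformDirection (d := d) (by omega)
  obtain ⟨m, rfl⟩ : ∃ m, n = m + 1 := ⟨n - 1, by omega⟩
  have hq := (measurePreserving_piFinSuccAbove
    (fun _ : Fin (m + 1 + 1) => uniformDirection d) 0).quasiMeasurePreserving
  -- The first direction is compared with two functions of the others: the value at which the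
  -- weighted sum would vanish, and the next direction, equality with which would spoil the strict
  -- triangle inequality.
  have h1 := hq.ae (ae_direction_ne hd (Measure.pi fun _ : Fin (m + 1) => uniformDirection d)
    (g := fun w => -(u 0)⁻¹ • ∑ k, u (Fin.succ k) • (w k : Space d)) (by fun_prop))
  have h2 := hq.ae (ae_direction_ne hd (Measure.pi fun _ : Fin (m + 1) => uniformDirection d)
    (g := fun w => (w 0 : Space d)) (by fun_prop))
  filter_upwards [h1, h2] with v hv1 hv2
  simp only [MeasurableEquiv.piFinSuccAbove_apply, Fin.insertNthEquiv_symm_apply, Fin.removeNth,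
    Fin.zero_succAbove] at hv1 hv2
  constructor
  · rw [norm_pos_iff]
    intro h0
    refine hv1 ?_
    rw [Fin.sum_univ_succ, add_comm, add_eq_zero_iff_eq_neg] at h0
    rw [h0, smul_neg, neg_smul, neg_neg, inv_smul_smul₀ (hu 0).ne']
  · rw [Fin.sum_univ_succ, Fin.sum_univ_succ, ← add_assoc, Fin.sum_univ_succ u,
      Fin.sum_univ_succ fun k => u (Fin.succ k), ← add_assoc]
    refine (norm_add_le _ _).trans_lt (add_lt_add_of_lt_of_le ?_ ?_)
    · have h3 : inner ℝ (v 0 : Space d) (v (Fin.succ 0) : Space d) < 1 := by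
        rw [inner_lt_one_iff_real_of_norm_eq_one (norm_eq_of_mem_sphere _)
          (norm_eq_of_mem_sphere _)]
        exact hv2
      have h4 := hu 0
      have h5 := hu (Fin.succ 0)
      refine lt_of_pow_lt_pow_left₀ 2 (by positivity) ?_
      rw [norm_add_sq_real, norm_smul, norm_smul, norm_eq_of_mem_sphere, norm_eq_of_mem_sphere,
        inner_smul_left, inner_smul_right, Real.norm_of_nonneg h4.le, Real.norm_of_nonneg h5.le]
      simp only [conj_trivial]
      nlinarith [mul_pos h4 h5]
    · refine (norm_sum_le _ _).trans (Finset.sum_le_sum fun k _ => ?_)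
      rw [norm_smul, norm_eq_of_mem_sphere, mul_one, Real.norm_of_nonneg (hu _).le]

/-! ### The conditional law of the position. -/

/-- The end point of the flight with durations `τ` and directions `v`. -/
def endpoint {d n : ℕ} (c t : ℝ) (p : (Fin n → ℝ) × (Fin (n + 1) → Direction d)) : Space d :=
  c • ∑ k, durations t p.1 k • (p.2 k : Space d)

theorem measurable_endpoint {d n : ℕ} (c t : ℝ) :
    Measurable (endpoint (d := d) (n := n) c t) := by
  have h1 : ∀ k, Measurable fun p : (Fin n → ℝ) × (Fin (n + 1) → Direction d) =>
      durations t p.1 k := fun k =>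
    (measurable_pi_apply k).comp ((measurable_durations t).comp measurable_fst)
  have h2 : ∀ k, Measurable fun p : (Fin n → ℝ) × (Fin (n + 1) → Direction d) =>
      (p.2 k : Space d) := fun k =>
    measurable_subtype_coe.comp ((measurable_pi_apply k).comp measurable_snd)
  have h3 : Measurable fun p : (Fin n → ℝ) × (Fin (n + 1) → Direction d) =>
      ∑ k, durations t p.1 k • (p.2 k : Space d) :=
    Finset.measurable_fun_sum _ fun k _ => (h1 k).smul (h2 k)
  exact h3.const_smul c

/-- The law of the end point of a flight with independent uniform directions and durations
distributed according to `ν`. -/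
def endpointLaw (d : ℕ) {n : ℕ} (c t : ℝ) (ν : Measure (Fin n → ℝ)) : Measure (Space d) :=
  (ν.prod (Measure.pi fun _ : Fin (n + 1) => uniformDirection d)).map (endpoint c t)

theorem charFun_endpointLaw {d : ℕ} (hd : 2 ≤ d) {n : ℕ} {c : ℝ} (hc : 0 ≤ c) (t : ℝ)
    (ν : Measure (Fin n → ℝ)) [IsFiniteMeasure ν] (ξ : Space d) :
    charFun (endpointLaw d c t ν) ξ = (∫ τ, stepsChar d t τ (c * ‖ξ‖) ∂ν : ℝ) := by
  have := isProbabilityMeasure_uniformDirection (d := d) (by omega)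
  have hm := measurable_endpoint (d := d) (n := n) c t
  rw [charFun_apply, endpointLaw, integral_map hm.aemeasurable
    (Continuous.aestronglyMeasurable (by fun_prop)), integral_prod, ← integral_complex_ofReal]
  · congr 1; funext τ
    have h1 : ∀ v : Fin (n + 1) → Direction d,
        Complex.exp ((inner ℝ (endpoint c t (τ, v)) ξ : ℝ) * Complex.I) =
        ∏ k, Complex.exp ((inner ℝ (v k : Space d) ((c * durations t τ k) • ξ) : ℝ) *
          Complex.I) := by
      intro v
      rw [← Complex.exp_sum, ← Finset.sum_mul, endpoint, inner_smul_left, sum_inner,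
        Finset.mul_sum]
      push_cast
      congr 3; funext k
      rw [inner_smul_left, inner_smul_right]
      simp [mul_assoc]
    simp only [h1]
    rw [integral_fintype_prod_eq_prod (fun k (v : Direction d) =>
      Complex.exp ((inner ℝ (v : Space d) ((c * durations t τ k) • ξ) : ℝ) * Complex.I)),
      stepsChar, Complex.ofReal_prod]
    refine Finset.prod_congr rfl fun k _ => ?_
    rw [integral_exp_inner_uniformDirection hd, norm_smul, Real.norm_eq_abs, abs_mul,
      abs_of_nonneg hc]
    congr 1
    -- Durations may be negative off the simplex; `coordChar` is even, so the sign is immaterial.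
    rcases abs_choice (durations t τ k) with h | h
    · rw [h]; congr 1; ring
    · rw [h, ← coordChar_neg]; congr 1; ring
  · refine Integrable.of_bound (Measurable.aestronglyMeasurable (by fun_prop)) 1
      (Eventually.of_forall fun p => (Complex.norm_exp_ofReal_mul_I _).le)

theorem ae_norm_endpointLaw_mem_Ioo {d : ℕ} (hd : 2 ≤ d) {n : ℕ} (hn : 1 ≤ n) {c t : ℝ}
    (hc : 0 < c) (ht : 0 < t) {ν : Measure (Fin n → ℝ)} [SFinite ν]
    (hν : ∀ᵐ τ ∂ν, τ ∈ simplex n t) :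
    ∀ᵐ x ∂endpointLaw d c t ν, ‖x‖ ∈ Set.Ioo 0 (c * t) := by
  have := isProbabilityMeasure_uniformDirection (d := d) (by omega)
  have hm := measurable_endpoint (d := d) (n := n) c t
  have hU : MeasurableSet {x : Space d | ‖x‖ ∈ Set.Ioo 0 (c * t)} :=
    (isOpen_annulus d 0 (c * t)).measurableSet
  rw [endpointLaw, ae_map_iff hm.aemeasurable hU]
  refine (Measure.ae_prod_iff_ae_ae (p := fun p => ‖endpoint c t p‖ ∈ Set.Ioo 0 (c * t))
    (hm hU)).2 ?_
  filter_upwards [hν] with τ hτ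
  filter_upwards [ae_norm_sum_direction_mem_Ioo hd hn (durations_pos ht hτ)] with v hv
  rw [sum_durations] at hv
  rw [endpoint, norm_smul, Real.norm_of_nonneg hc.le]
  exact ⟨mul_pos hc hv.1, mul_lt_mul_of_pos_left hv.2 hc⟩

theorem changes_le_iff {Ω : Type*} (T : ℕ → Ω → ℝ) (t : ℝ) (ω : Ω) (m : ℕ) :
    changes T t ω ≤ m ↔ ∀ k, 1 ≤ k → T k ω ≤ t → k ≤ m := by
  simp only [changes, sSup_le_iff, Set.forall_mem_image, Set.mem_ofPred_eq, Nat.cast_le, and_imp]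

theorem measurableSet_changes_eq {Ω : Type*} [MeasurableSpace Ω] {T : ℕ → Ω → ℝ}
    (hT : ∀ k, Measurable (T k)) (t : ℝ) {n : ℕ} (hn : 1 ≤ n) :
    MeasurableSet {ω | changes T t ω = n} := by
  have hle : ∀ m : ℕ, MeasurableSet {ω | changes T t ω ≤ m} := by
    intro m
    simp only [changes_le_iff, Set.ofPred_forall]
    refine MeasurableSet.iInter fun k => MeasurableSet.iInter fun _ => ?_
    by_cases hk : k ≤ m
    · simp [hk]
    · simp only [hk, imp_false, not_le]
      exact measurableSet_lt measurable_const (hT k)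
  have h : {ω | changes T t ω = n} = {ω | changes T t ω ≤ n} \ {ω | changes T t ω ≤ (n - 1 : ℕ)} := by
    ext ω
    simp only [Set.mem_ofPred_eq, Set.mem_sdiff, not_le]
    constructor
    · intro h
      rw [h]
      exact ⟨le_rfl, by exact_mod_cast (by omega : n - 1 < n)⟩
    · rintro ⟨h1, h2⟩
      refine le_antisymm h1 ?_
      have h3 : ((n - 1 + 1 : ℕ) : ℕ∞) ≤ changes T t ω := Order.add_one_le_of_lt h2
      rwa [Nat.sub_add_cancel hn] at h3
  rw [h]
  exact (hle n).diff (hle (n - 1))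

/-- The steps telescope to T n because T 0 = 0, so the unfinished last step has duration t - T n. -/
theorem position_eq_endpoint {Ω : Type*} {d n : ℕ} (c : ℝ) {t : ℝ} {T : ℕ → Ω → ℝ}
    (V : ℕ → Ω → Direction d) {ω : Ω} (h0 : T 0 ω = 0) (hω : changes T t ω = n) :
    position c T V t ω = endpoint c t (steps T n ω, fun k : Fin (n + 1) => V k ω) := by
  have h1 : ∑ k : Fin n, steps T n ω k = T n ω := by
    simp only [steps]
    rw [Fin.sum_univ_eq_sum_range (fun k => T (k + 1) ω - T k ω) n,
      Finset.sum_range_sub (fun k => T k ω), h0, sub_zero]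
  simp only [position, hω, ENat.toNat_natCast, endpoint]
  rw [Fin.sum_univ_castSucc]
  simp only [durations, Fin.snoc_castSucc, Fin.snoc_last, h1, Fin.val_castSucc, Fin.val_last]
  simp only [steps]
  rw [Fin.sum_univ_eq_sum_range (fun k => (T (k + 1) ω - T k ω) • (V k ω : Space d)) n]

theorem measurable_steps {Ω : Type*} [MeasurableSpace Ω] {T : ℕ → Ω → ℝ}
    (hT : ∀ k, Measurable (T k)) (n : ℕ) : Measurable (steps T n) :=
  measurable_pi_lambda _ fun k => (hT (k + 1)).sub (hT k)

/-- Given the number of changes of direction, the durations are independent of the directions. -/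
theorem IsFlight.map_cond_steps_dir {Ω : Type*} [MeasurableSpace Ω] {P : Measure Ω}
    [IsProbabilityMeasure P] {d : ℕ} (hd : 2 ≤ d) {T : ℕ → Ω → ℝ} {V : ℕ → Ω → Direction d}
    (hflight : IsFlight P T V) (t : ℝ) {n : ℕ} (hn : 1 ≤ n) :
    (P[|{ω | changes T t ω = n}]).map
      (fun ω => (steps T n ω, fun k : Fin (n + 1) => V k ω)) =
    ((P[|{ω | changes T t ω = n}]).map (steps T n)).prod
      (Measure.pi fun _ : Fin (n + 1) => uniformDirection d) := by
  have hprob := isProbabilityMeasure_uniformDirection (d := d) (by omega)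
  have hTm := hflight.measurable_time
  have hVm := hflight.measurable_dir
  have hE := measurableSet_changes_eq hTm t hn
  have hsm := measurable_steps hTm n
  have hVm' : Measurable fun ω => fun k : Fin (n + 1) => V k ω :=
    measurable_pi_lambda _ fun k => hVm k
  have hpi : P.map (fun ω => fun k : Fin (n + 1) => V k ω) =
      Measure.pi fun _ : Fin (n + 1) => uniformDirection d := by
    have h1 := (iIndepFun_iff_map_fun_eq_pi_map (f := fun (k : Fin (n + 1)) ω => V k ω) (μ := P)
      fun k => (hVm k).aemeasurable).1
      (hflight.dir_indep.precomp (g := fun k : Fin (n + 1) => (k : ℕ)) Fin.val_injective)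
    rw [h1]
    congr 1; funext k
    exact hflight.dir_uniform k
  refine (Measure.prod_eq fun A B hA hB => ?_).symm
  have hT' : ∀ k : ℕ, Measurable fun s : ℕ → ℝ => s k := fun k => measurable_pi_apply k
  -- The number of changes and the steps are functions of the sequence of instants. Expressed
  -- through the coordinate process on ℕ → ℝ, they form one event to which the independence from the
  -- directions applies.
  have hind := hflight.dir_indep_time.measure_inter_preimage_eq_mul
    ((fun v (k : Fin (n + 1)) => v k) ⁻¹' B)
    ({s | changes (fun k (s : ℕ → ℝ) => s k) t s = n} ∩ steps (fun k (s : ℕ → ℝ) => s k) n ⁻¹' A)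
    ((measurable_pi_lambda _ fun k => measurable_pi_apply _) hB)
    ((measurableSet_changes_eq hT' t hn).inter (measurable_steps hT' n hA))
  rw [Measure.map_apply (hsm.prodMk hVm') (hA.prod hB), Measure.map_apply hsm hA, ← hpi,
    Measure.map_apply hVm' hB, cond_apply hE, cond_apply hE, mul_assoc]
  congr 1
  rw [mul_comm]
  refine Eq.trans ?_ hind
  congr 1
  ext ω
  constructor
  · rintro ⟨h1, h2, h3⟩; exact ⟨h3, h1, h2⟩
  · rintro ⟨h3, h1, h2⟩; exact ⟨h1, h2, h3⟩

/-- The law of the position, given the number of changes of direction. -/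
theorem IsFlight.map_cond_position {Ω : Type*} [MeasurableSpace Ω] {P : Measure Ω}
    [IsProbabilityMeasure P] {d : ℕ} (hd : 2 ≤ d) {T : ℕ → Ω → ℝ} {V : ℕ → Ω → Direction d}
    (hflight : IsFlight P T V) (c t : ℝ) {n : ℕ} (hn : 1 ≤ n) :
    (P[|{ω | changes T t ω = n}]).map (position c T V t) =
      endpointLaw d c t ((P[|{ω | changes T t ω = n}]).map (steps T n)) := by
  have hE := measurableSet_changes_eq hflight.measurable_time t hn
  have hm : Measurable fun ω => (steps T n ω, fun k : Fin (n + 1) => V k ω) :=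
    (measurable_steps hflight.measurable_time n).prodMk
      (measurable_pi_lambda _ fun k => hflight.measurable_dir k)
  rw [endpointLaw, ← hflight.map_cond_steps_dir hd t hn,
    Measure.map_map (measurable_endpoint c t) hm]
  refine Measure.map_congr ?_
  filter_upwards [ae_cond_mem hE, cond_absolutelyContinuous.ae_le hflight.time_zero] with ω h1 h2
  exact position_eq_endpoint c V h2 h1

end RandomFlight

end

theorem mainTheorem3 {Ω : Type*} [MeasurableSpace Ω] (P : Measure Ω) [IsProbabilityMeasure P]
    (d : ℕ) (hd : 2 ≤ d) (n : ℕ) (hn : 1 ≤ n) (c t : ℝ) (hc : 0 < c) (ht : 0 < t)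
    (a b : Fin n → ℝ) (ha : ∀ k, 0 < a k) (hb : ∀ k, 0 < b k)
    (T : ℕ → Ω → ℝ) (V : ℕ → Ω → RandomFlight.Direction d)
    (hflight : RandomFlight.IsFlight P T V)
    (hpos : P {ω | RandomFlight.changes T t ω = n} ≠ 0)
    (hgd : (P[|{ω | RandomFlight.changes T t ω = n}]).map (RandomFlight.steps T n) =
      RandomFlight.gdLaw a b t) :
    (∀ ρ : ℝ, 0 < ρ →
      IntegrableOn (RandomFlight.simplexIntegrand d c t a b ρ) (RandomFlight.simplex n t)) ∧
    (∀ x : RandomFlight.Space d, 0 < ‖x‖ → ‖x‖ < c * t →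
      RandomFlight.HasImproperIntegral (RandomFlight.hankelIntegrand d c t a b ‖x‖)
        (RandomFlight.improperIntegral (RandomFlight.hankelIntegrand d c t a b ‖x‖)) ∧
      0 ≤ RandomFlight.flightDensity d c t a b x) ∧
    (P[|{ω | RandomFlight.changes T t ω = n}]).map (RandomFlight.position c T V t) =
      (volume.restrict (Metric.ball (0 : RandomFlight.Space d) (c * t))).withDensity
        fun x => ENNReal.ofReal (RandomFlight.flightDensity d c t a b x) := by
  have hct : 0 < c * t := mul_pos hc ht
  have hcond := cond_isProbabilityMeasure hpos
  -- Being a conditional law, the Dirichlet law has mass one; the finiteness and the sign of the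
  -- constant used throughout come from this.
  have hprob : IsProbabilityMeasure (RandomFlight.gdLaw a b t) := by
    rw [← hgd]
    exact Measure.isProbabilityMeasure_map
      (RandomFlight.measurable_steps hflight.measurable_time n).aemeasurable
  have huni := RandomFlight.isProbabilityMeasure_uniformDirection (d := d) (by omega)
  have hinv : ∀ δ, 0 < δ → δ < c * t → ∃ L, TendstoUniformlyOn
      (RandomFlight.invPart d (RandomFlight.flightChar d c t a b)) L atTop
      (Set.Icc δ (c * t - δ)) := fun δ hδ hδT =>
    RandomFlight.exists_tendstoUniformlyOn_invPart hd hc ht hn ha hprob hδ hδT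
  have hcont := RandomFlight.continuous_flightChar hd c t hprob
  have hlim : ∀ r ∈ Set.Ioo 0 (c * t), Tendsto
      (fun R => RandomFlight.invPart d (RandomFlight.flightChar d c t a b) R r) atTop
      (𝓝 (RandomFlight.invLim d (RandomFlight.flightChar d c t a b) r)) := by
    intro r hr
    have h0 : 0 < min r (c * t - r) := lt_min hr.1 (sub_pos.2 hr.2)
    have h1 := min_le_left r (c * t - r)
    have h2 := min_le_right r (c * t - r)
    exact (RandomFlight.tendstoUniformlyOn_invLim
      (hinv _ h0 (h1.trans_lt hr.2))).tendsto_at ⟨h1, by linarith⟩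
  have hfin : IsFiniteMeasure (RandomFlight.endpointLaw d c t (RandomFlight.gdLaw a b t)) := by
    unfold RandomFlight.endpointLaw; infer_instance
  have hchar : ∀ ξ, charFun (RandomFlight.endpointLaw d c t (RandomFlight.gdLaw a b t)) ξ =
      RandomFlight.flightChar d c t a b ‖ξ‖ := fun ξ =>
    RandomFlight.charFun_endpointLaw hd hc.le t _ ξ
  have hcar : ∀ᵐ x ∂(RandomFlight.endpointLaw d c t (RandomFlight.gdLaw a b t)),
      ‖x‖ ∈ Set.Ioo 0 (c * t) :=
    RandomFlight.ae_norm_endpointLaw_mem_Ioo hd hn hc ht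
      ((withDensity_absolutelyContinuous _ _).ae_le
        (ae_restrict_mem (RandomFlight.measurableSet_simplex n t)))
  refine ⟨fun ρ hρ => RandomFlight.integrableOn_simplexIntegrand hd hc ht hprob hρ,
    fun x hx hxT => ⟨⟨fun R hR =>
      RandomFlight.intervalIntegrable_hankelIntegrand hd hc ht hprob hx hR.le, ?_⟩, ?_⟩, ?_⟩
  · have h := RandomFlight.tendsto_integral_hankelIntegrand hd hc ht hprob hx (hlim _ ⟨hx, hxT⟩)
    rw [RandomFlight.improperIntegral, h.limUnder_eq]
    exact h
  · rw [RandomFlight.flightDensity_eq hd hc ht hprob hx (hlim _ ⟨hx, hxT⟩)]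
    exact mul_nonneg (RandomFlight.invConst_pos (by omega)).le
      (RandomFlight.invLim_nonneg hd hcont hchar hinv ⟨hx, hxT⟩)
  · rw [hflight.map_cond_position hd c t hn, hgd,
      RandomFlight.eq_withDensity_invLim hd hcont hchar hct hinv hcar]
    refine withDensity_congr_ae ?_
    have : Nonempty (Fin d) := ⟨⟨0, by omega⟩⟩
    -- The density formula is identified off the origin only, which suffices almost everywhere.
    have h0 : ∀ᵐ x : RandomFlight.Space d ∂volume.restrict (Metric.ball 0 (c * t)), x ≠ 0 := by
      refine ae_restrict_of_ae ?_
      rw [ae_iff]; simp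
    filter_upwards [ae_restrict_mem measurableSet_ball, h0] with x hx hx0
    have hx' : 0 < ‖x‖ := norm_pos_iff.2 hx0
    rw [RandomFlight.flightDensity_eq hd hc ht hprob hx' (hlim _ ⟨hx', mem_ball_zero_iff.1 hx⟩)]
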